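/- For a Boolean function $f:\{0,1\}^n\to\{0,1\}$ that is not identically $0$ and $g:\{0,1\}^n\to\{0,1\}$ let $\mathrm{reldist}(f,g)=|f^{-1}(1)\,\triangle\,g^{-1}(1)|/|f^{-1}(1)|$; for $\epsilon>0$, $f$ is $\epsilon$-far from a class $\mathcal C$ in relative distance if $\min_{g\in\mathcal C}\mathrm{reldist}(f,g)\ge\epsilon$. A function $f$ is monotone if $x\le y$ coordinatewise implies $f(x)\le f(y)$, and unate if $x\mapsto f(x\oplus a)$ is monotone for some $a\in\{0,1\}^n$. A relative-error algorithm is a randomized adaptive algorithm that may call a membership oracle (given $x$, it returns $f(x)$) and a sampling oracle (it returns a fresh uniformly random element of $f^{-1}(1)$); each call to either oracle counts as one query. For every constant $\alpha\in(0,1)$ there is a constant $\kappa\ge 1$ such that for every constant $c>0$ there is a constant $\epsilon=\epsilon_{c,\alpha}>0$ for which the following holds, for $\mathcal C$ the class of monotone functions and for $\mathcal C$ the class of unate functions. Let $n,N$ be positive integers with $N\le 2^{\alpha n}$, and consider the functions $f:\{0,1\}^n\to\{0,1\}$ with $|f^{-1}(1)|=\Theta(N)$, meaning $N/\kappa\le|f^{-1}(1)|\le\kappa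 N$. Any relative-error algorithm that, on every such $f$, answers "yes" with probability at least $2/3$ if $f\in\mathcal C$, and answers "no" with probability at least $2/3$ if $f$ is $\epsilon$-far from $\mathcal C$ in relative distance (two-sided error), must make $\tilde\Omega\big((\log N)^{1-c}\big)$ queries in the worst case. That is, there are $a>0$ and $k,N_0\in\mathbb N$, depending only on $c$ and $\alpha$, such that for all $N\ge N_0$ and all $n$ with $N\le 2^{\alpha n}$ the number of queries, maximized over all such $f$ and all random outcomes, is at least $a(\log N)^{1-c}/(\log\log N)^{k}$. -/

import Mathlib

namespace RelativeError

/-- Boolean functions on the hypercube of dimension `n`; `true` is 1 and `false` is 0. The order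
on points is the coordinatewise one. -/
abbrev BoolFn (n : ℕ) : Type := (Fin n → Bool) → Bool

/-- The set of satisfying assignments, that is, the preimage of 1. -/
def ones {n : ℕ} (f : BoolFn n) : Finset (Fin n → Bool) :=
  Finset.univ.filter fun x => f x = true

/-- The class of monotone functions. -/
def monotoneClass (n : ℕ) : Set (BoolFn n) := {f | Monotone f}

/-- The class of unate functions: those that become monotone after XOR-ing the input with some
fixed string `a`. -/
def unateClass (n : ℕ) : Set (BoolFn n) :=
  {f | ∃ a : Fin n → Bool, Monotone fun x : Fin n → Bool => f fun i => xor (x i) (a i)}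

/-- Relative distance from `f` to `g`: the size of the symmetric difference of the preimages of 1,
divided by the size of the preimage of 1 under `f` (the function that is being tested). -/
noncomputable def relDist {n : ℕ} (f g : BoolFn n) : ℝ :=
  ((symmDiff (ones f) (ones g)).card : ℝ) / ((ones f).card : ℝ)

/-- Relative distance from `f` to a class (the infimum is a minimum for a nonempty class, since
there are finitely many functions). -/
noncomputable def relDistTo {n : ℕ} (f : BoolFn n) (P : Set (BoolFn n)) : ℝ :=
  ⨅ g : P, relDist f g.1

/-- Deterministic adaptive algorithms with a membership oracle and a sampling oracle. The algorithm
either halts with an answer (`true` is "yes"), or asks for the value of the unknown function at a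
point, or asks for a random satisfying assignment; what it does next may depend on the reply. -/
inductive Alg (n : ℕ) : Type
  | answer (b : Bool) : Alg n
  | query (x : Fin n → Bool) (next : Bool → Alg n) : Alg n
  | samp (next : (Fin n → Bool) → Alg n) : Alg n

/-- Distribution of the answer of a deterministic algorithm on `f`. Each call to the sampling oracle
returns a fresh uniformly random element of the (nonempty) preimage of 1. -/
noncomputable def Alg.run {n : ℕ} (f : BoolFn n) (hf : (ones f).Nonempty) : Alg n → PMF Bool
  | .answer b => PMF.pure b
  | .query x next => (next (f x)).run f hf
  | .samp next => (PMF.uniformOfFinset (ones f) hf).bind fun x => (next x).run f hf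

/-- The largest number of oracle calls (of both kinds) of a deterministic algorithm on `f`, over all
possible replies of the sampling oracle. -/
def Alg.calls {n : ℕ} (f : BoolFn n) : Alg n → ℕ
  | .answer _ => 0
  | .query x next => (next (f x)).calls f + 1
  | .samp next => ((ones f).sup fun x => (next x).calls f) + 1

/-- Randomized algorithms: probability distributions over deterministic ones. (`Alg n` is
countable, because every node branches finitely, so discrete distributions are all of them.) -/
abbrev RandAlg (n : ℕ) : Type := PMF (Alg n)

/-- Distribution of the answer of a randomized algorithm on `f`; its own randomness is independent
of the sampling oracle. -/
noncomputable def RandAlg.run {n : ℕ} (A : RandAlg n) (f : BoolFn n) (hf : (ones f).Nonempty) :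
    PMF Bool :=
  PMF.bind A fun t => t.run f hf

/-- The sparsity promise that the number of satisfying assignments of `f` is `Θ(N)`, with implied
constant `κ`: it lies between `N / κ` and `κ * N`. -/
def Sparsity {n : ℕ} (κ : ℝ) (N : ℕ) (f : BoolFn n) : Prop :=
  (N : ℝ) / κ ≤ ((ones f).card : ℝ) ∧ ((ones f).card : ℝ) ≤ κ * (N : ℝ)

/-- `A` is a two-sided-error relative-error `ε`-tester for the class `P`, on the functions (not
identically 0) that satisfy the promise `S`. -/
def IsTester {n : ℕ} (S : BoolFn n → Prop) (P : Set (BoolFn n)) (ε : ℝ) (A : RandAlg n) : Prop :=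
  ∀ (f : BoolFn n) (hf : (ones f).Nonempty), S f →
    (f ∈ P → 2 / 3 ≤ A.run f hf true) ∧
    (ε ≤ relDistTo f P → 2 / 3 ≤ A.run f hf false)

/-- `A` makes at most `q` oracle calls on every function that satisfies the promise `S`, whatever
its random choices and the replies of the sampling oracle. -/
def MakesAtMost {n : ℕ} (S : BoolFn n → Prop) (A : RandAlg n) (q : ℕ) : Prop :=
  ∀ f : BoolFn n, S f → ∀ t ∈ PMF.support A, t.calls f ≤ q

end RelativeError

open RelativeError

namespace RelativeError

open Finset

/-! The hard instances live on a main cube of dimension `d = 16 * k`, with `k` proportional to `(1 -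
α) * log N`, and are random only on its layers `15 * k` and `15 * k + 1`. A random sequence of
regions is drawn there, and a point is labelled by the first region that contains it, provided that
it lies in the interior of that region. On each label a yes instance takes a random constant, equal
to 1 with probability 1/16, and a no instance takes an antidictator, the negation of a uniformly
random coordinate. A point of these layers has a fraction of about 1/16 zeros, so a single query to
a region has almost the same law in both cases.

Adjacent labelled points carry the same label, because one step from the interior of a region does
not leave the region. Hence yes instances are monotone (`hardFn_constVal_monotone`), while in a no
instance most points of the upper layer are the top of an edge that violates monotonicity
(`card_few_violated_le`). For unateness a selector coordinate is added: on the half where it is 0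
the function is a plain threshold, so a unate function that decreases in some main direction is
already far there (`card_slice_le_symmDiff`), and one that decreases in no main direction must
repair the violated edges (`card_violated_le_symmDiff`).

An antidictator betrays itself only through queries to one region that vary in its coordinate. The
advantage of a decision tree is therefore at most its expected cost divided by `k`, where the cost
adds up, over the regions met, one plus the number of varying coordinates (`sum_const_le_sum_anti`).

The regions make variation expensive (`card_hit_list_mul_exp_le`). A region is an intersection of
`l` levels. A level hashes the coordinates into `m = (2 * Q + 1) * u` buckets, takes parities,
shifts the resulting code at random and keeps a Hamming ball of radius `Q * u`, slightly below `m /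
2`. If a new point differs from an old one in many more than `m` fresh coordinates, its code is
nearly uniform given the past, and falling into the ball again has probability exponentially small
in `u / Q`. The scales `u` grow geometrically with ratio `R`, so every large number of fresh
coordinates is within a factor `R` of a suitable level, which gives a decay rate `μ` of order `1 /
(Q ^ 3 * R)` per coordinate. With `Q` of order `l` the interior is still most of the region, and `R
≈ k ^ (1 / l)` for a large constant `l` costs only a small power of `k`.

Adaptivity is handled by an exponential moment: summing over both answers and over the region that
receives each query bounds the moment by `(O(M)) ^ M` for `M` queries (`sum_splitSet_path_le`), so
the expected cost is `O(M * log M / μ)`, which is `o(k)` unless `M` is nearly linear in `k`. Samples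
do not help, since rejection sampling from a fixed superset of comparable size replaces them by a
few membership queries (`Alg.exists_dtree`). Finally, free coordinates multiply the number of
satisfying assignments by a power of 2, to match any given `N`. -/

/-- The number of coordinates where a sign vector is negative. -/
def negWeight {m : ℕ} (y : Fin m → ℤˣ) : ℕ := #{s | y s = -1}

/-- The sign of each bucket for the point with support `E`, when the coordinates are hashed to
buckets by `t`: the parity of the number of coordinates of `E` in the bucket. -/
def bucketSign {d m : ℕ} (t : Fin d → Fin m) (E : Finset (Fin d)) : Fin m → ℤˣ :=
  fun s => ∏ l ∈ E, if t l = s then -1 else 1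

/-- Coordinates on which the points of a list do not all agree. -/
def varying {d : ℕ} (H : List (Finset (Fin d))) : Finset (Fin d) :=
  univ.filter fun l => ∃ x ∈ H, ∃ y ∈ H, l ∈ x ∧ l ∉ y

/-! ### Resampling a block of coordinates -/

section Resample

/-- Swap two functions on a set of coordinates. -/
def swapOn {ι κ : Type*} [DecidableEq ι] (F : Finset ι) : (ι → κ) × (ι → κ) → (ι → κ) × (ι → κ) :=
  fun p => (F.piecewise p.2 p.1, F.piecewise p.1 p.2)

lemma swapOn_swapOn {ι κ : Type*} [DecidableEq ι] (F : Finset ι) (p : (ι → κ) × (ι → κ)) : swapOn F (swapOn F p) = p := by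
  ext i <;> by_cases h : i ∈ F <;> simp [swapOn, h]

/-- If `G` does not depend on the coordinates in `F`, and the average of `h` over those coordinates
is at most `β`, then the sum of `G * h` is at most `β` times the sum of `G`. -/
lemma sum_mul_le_of_resample {ι κ : Type*} [Fintype ι] [DecidableEq ι] [Fintype κ] [Nonempty κ]
    (F : Finset ι) (G h : (ι → κ) → ℝ) (β : ℝ) (hG0 : ∀ t, 0 ≤ G t)
    (hG : ∀ t t', G (F.piecewise t' t) = G t)
    (hh : ∀ t, ∑ t', h (F.piecewise t' t) ≤ β * Fintype.card (ι → κ)) :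
    ∑ t, G t * h t ≤ β * ∑ t, G t := by
  have hpos : (0 : ℝ) < Fintype.card (ι → κ) := by exact_mod_cast Fintype.card_pos
  have h1 : ∑ p : (ι → κ) × (ι → κ), G p.1 * h p.1
      = ∑ p : (ι → κ) × (ι → κ), G p.1 * h (F.piecewise p.2 p.1) := by
    -- Swapping the coordinates in `F` between two independent copies preserves the uniform measure
    -- and does not affect `G`.
    rw [← Equiv.sum_comp (Function.Involutive.toPerm (swapOn F) (swapOn_swapOn F))]
    refine Finset.sum_congr rfl fun p _ => ?_
    have : (Function.Involutive.toPerm (swapOn F) (swapOn_swapOn F)) p = swapOn F p := rfl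
    rw [this]
    simp only [swapOn, hG]
  rw [Fintype.sum_prod_type, Fintype.sum_prod_type] at h1
  simp only [sum_const, card_univ, nsmul_eq_mul, ← mul_sum] at h1
  have h2 : ∑ t, G t * ∑ t', h (F.piecewise t' t)
      ≤ ∑ t, G t * (β * Fintype.card (ι → κ)) :=
    sum_le_sum fun t _ => mul_le_mul_of_nonneg_left (hh t) (hG0 t)
  rw [← h1, ← sum_mul] at h2
  nlinarith

end Resample

/-! ### Bucket parities and Hamming balls of sign vectors -/

section Bucket

variable {d m : ℕ}

lemma bucketSign_symmDiff (t : Fin d → Fin m) (E E' : Finset (Fin d)) :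
    bucketSign t (symmDiff E E') = bucketSign t E * bucketSign t E' := by
  ext s
  congr 1
  simp only [bucketSign, Pi.mul_apply]
  have h1 : symmDiff E E' = (E \ E') ∪ (E' \ E) := rfl
  have hd : Disjoint (E \ E') (E' \ E) := disjoint_sdiff_sdiff
  rw [h1, prod_union hd, ← sdiff_union_inter E E', ← prod_sdiff (inter_subset_right : E ∩ E' ⊆ E')]
  simp only [sdiff_union_inter]
  rw [show (E : Finset (Fin d)) = (E \ E') ∪ (E ∩ E') from (sdiff_union_inter E E').symm,
    prod_union (disjoint_sdiff_inter E E'), sdiff_union_inter]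
  have h3 : E' \ (E ∩ E') = E' \ E := by ext; simp
  rw [h3]
  have h4 : (∏ l ∈ E ∩ E', if t l = s then (-1 : ℤˣ) else 1) *
      (∏ l ∈ E ∩ E', if t l = s then (-1 : ℤˣ) else 1) = 1 := Int.units_mul_self _
  calc _ = (∏ l ∈ E \ E', if t l = s then (-1 : ℤˣ) else 1) *
      (∏ l ∈ E' \ E, if t l = s then (-1 : ℤˣ) else 1) *
      ((∏ l ∈ E ∩ E', if t l = s then (-1 : ℤˣ) else 1) *
      (∏ l ∈ E ∩ E', if t l = s then (-1 : ℤˣ) else 1)) := by rw [h4, mul_one]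
    _ = _ := by ac_rfl

lemma bucketSign_union (t : Fin d → Fin m) {E E' : Finset (Fin d)} (h : Disjoint E E') :
    bucketSign t (E ∪ E') = bucketSign t E * bucketSign t E' := by
  ext s
  simp [bucketSign, prod_union h]

lemma bucketSign_congr {t t' : Fin d → Fin m} {E : Finset (Fin d)} (h : ∀ l ∈ E, t l = t' l) :
    bucketSign t E = bucketSign t' E := by
  ext s
  simp only [bucketSign]
  rw [prod_congr rfl fun l hl => by rw [h l hl]]

lemma bucketSign_insert_of_ne (t : Fin d → Fin m) {E : Finset (Fin d)} {l : Fin d} (hl : l ∉ E)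
    {s : Fin m} (hs : t l ≠ s) : bucketSign t (insert l E) s = bucketSign t E s := by
  simp [bucketSign, prod_insert hl, hs]

/-- Changing one coordinate of a point changes the weight of its code by at most one. -/
lemma negWeight_le_succ {y y' : Fin m → ℤˣ} {a : Fin m} (h : ∀ s, s ≠ a → y s = y' s) :
    negWeight y ≤ negWeight y' + 1 := by
  have : (univ.filter fun s => y s = -1) ⊆ insert a (univ.filter fun s => y' s = -1) := by
    intro s hs
    by_cases hsa : s = a
    · simp [hsa]
    · simp only [mem_filter, mem_univ, true_and] at hs
      simp [hsa, ← h s hsa, hs]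
  exact (card_le_card this).trans (card_insert_le _ _)

lemma card_negWeight_eq (m j : ℕ) :
    #{y : Fin m → ℤˣ | negWeight y = j} = m.choose j := by
  rw [show m.choose j = #(powersetCard j (univ : Finset (Fin m))) by simp]
  refine card_nbij' (fun y => univ.filter fun s => y s = -1)
    (fun S s => if s ∈ S then -1 else 1) ?_ ?_ ?_ ?_
  · intro y hy
    have hy' : negWeight y = j := by simpa using hy
    simpa [mem_powersetCard, negWeight] using hy'
  · intro S hS
    have hS' : #S = j := by simpa using hS
    have h : negWeight (fun s => if s ∈ S then (-1 : ℤˣ) else 1) = j := by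
      rw [← hS', negWeight]
      congr 1
      ext s
      by_cases h : s ∈ S <;> simp [h]
    simpa using h
  · intro y _
    ext s
    rcases Int.units_eq_one_or (y s) with h | h <;> simp [h] 
  · intro S _
    ext s
    by_cases h : s ∈ S <;> simp [h]

/-- Size of the ball of radius `ρ` around the all-ones sign vector. -/
def ballCard (m ρ : ℕ) : ℕ := #{y : Fin m → ℤˣ | negWeight y ≤ ρ}

lemma ballCard_eq_sum (m ρ : ℕ) : ballCard m ρ = ∑ j ∈ range (ρ + 1), m.choose j := by
  rw [ballCard, card_eq_sum_card_fiberwise (f := negWeight) (t := range (ρ + 1))]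
  · refine sum_congr rfl fun j hj => ?_
    rw [← card_negWeight_eq, filter_filter]
    congr 1
    ext y
    simp only [mem_range] at hj
    simp only [mem_filter, mem_univ, true_and]
    omega
  · intro y hy
    simp at hy ⊢
    omega

lemma card_filter_mul_right (y : Fin m → ℤˣ) (p : (Fin m → ℤˣ) → Prop) [DecidablePred p] :
    #{v : Fin m → ℤˣ | p (v * y)} = #{v : Fin m → ℤˣ | p v} := by
  refine card_nbij' (fun v => v * y) (fun v => v * y⁻¹) ?_ ?_ ?_ ?_ <;> intro v hv <;> simp_all

end Bucket

/-! ### Fourier bound for the weight of a rehashed code -/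

section Mgf

variable {d m : ℕ}

/-- The real value of a sign. -/
def signVal (e : ℤˣ) : ℝ := ((e : ℤ) : ℝ)

lemma signVal_prod {α : Type*} (s : Finset α) (g : α → ℤˣ) :
    signVal (∏ l ∈ s, g l) = ∏ l ∈ s, signVal (g l) := by
  simp [signVal, Units.coe_prod, Int.cast_prod]

lemma signVal_mul (a b : ℤˣ) : signVal (a * b) = signVal a * signVal b := by
  simp [signVal]

lemma abs_signVal (a : ℤˣ) : |signVal a| = 1 := by
  rcases Int.units_eq_one_or a with h | h <;> simp [signVal, h]

/-- Each factor is 1 at a positive sign and `c` at a negative one. This form is affine in every sign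
and hence expands into characters. -/
lemma pow_negWeight (y : Fin m → ℤˣ) (c : ℝ) :
    c ^ negWeight y = ∏ s, ((1 + c) / 2 + (1 - c) / 2 * signVal (y s)) := by
  rw [negWeight, ← prod_const, prod_filter]
  refine prod_congr rfl fun s _ => ?_
  rcases Int.units_eq_one_or (y s) with h | h
  · rw [h, if_neg (by decide)]; simp [signVal]; ring
  · rw [h, if_pos rfl]; simp [signVal]; ring

lemma signVal_bucketSign_prod (t : Fin d → Fin m) (F : Finset (Fin d)) (S : Finset (Fin m)) :
    ∏ s ∈ S, signVal (bucketSign t F s) = ∏ l ∈ F, if t l ∈ S then (-1 : ℝ) else 1 := by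
  simp only [bucketSign, signVal_prod]
  rw [prod_comm]
  refine prod_congr rfl fun l _ => ?_
  have : ∀ s, signVal (if t l = s then -1 else 1) = if t l = s then (-1 : ℝ) else 1 := by
    intro s; split <;> simp [signVal]
  simp only [this]
  rw [Finset.prod_ite_eq]

/-- The coordinates are hashed independently, so the sum factors. A coordinate in `F` contributes -1
when it lands in `S` and 1 otherwise, in total `m - 2 * #S`. -/
lemma sum_char_bucketSign (F : Finset (Fin d)) (S : Finset (Fin m)) :
    ∑ t : Fin d → Fin m, ∏ s ∈ S, signVal (bucketSign t F s)
      = (m : ℝ) ^ (d - #F) * ((m : ℝ) - 2 * #S) ^ #F := by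
  have h1 : ∀ t : Fin d → Fin m, ∏ s ∈ S, signVal (bucketSign t F s)
      = ∏ l, (if l ∈ F then (if t l ∈ S then (-1 : ℝ) else 1) else 1) := by
    intro t
    rw [signVal_bucketSign_prod, prod_ite_mem, univ_inter]
  simp only [h1]
  have h2 := Finset.prod_univ_sum (fun _ : Fin d => (univ : Finset (Fin m)))
    (fun l j => if l ∈ F then (if j ∈ S then (-1 : ℝ) else 1) else 1)
  rw [Fintype.piFinset_univ] at h2
  rw [← h2]
  have h3 : ∀ l : Fin d, ∑ j : Fin m, (if l ∈ F then (if j ∈ S then (-1 : ℝ) else 1) else 1)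
      = if l ∈ F then ((m : ℝ) - 2 * #S) else m := by
    intro l
    split
    · have : ∀ j : Fin m, (if j ∈ S then (-1 : ℝ) else 1) = 1 - 2 * (if j ∈ S then 1 else 0) := by
        intro j; split <;> norm_num
      simp only [this, sum_sub_distrib, ← mul_sum]
      simp
    · simp
  simp only [h3]
  rw [prod_ite]
  simp only [prod_const]
  rw [mul_comm]
  congr 2
  · rw [filter_not, filter_mem_eq_inter, univ_inter, card_sdiff_of_subset (subset_univ _), card_univ,
      Fintype.card_fin]
  · rw [filter_mem_eq_inter, univ_inter]

/-- With `i = min j (m - j)` the left base is `m - 2 * i ≤ m * exp (-2 * i / m)`. Both exponentials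
appear on the right because large characters decay no better than small ones: a character close to
full sees only the parity of `#F`. -/
lemma abs_pow_le_add (m j D f : ℕ) (hm : 0 < m) (hj : j ≤ m) (hf : D * m ≤ f) :
    |((m : ℝ) - 2 * j)| ^ f ≤ (m : ℝ) ^ f *
      (Real.exp (-(2 * D)) ^ j + Real.exp (-(2 * D)) ^ (m - j)) := by
  have hm' : (0 : ℝ) < m := by exact_mod_cast hm
  have hf' : (D : ℝ) * m ≤ f := by exact_mod_cast hf
  have key : ∀ i : ℕ, |(m : ℝ) - 2 * j| ≤ m - 2 * i →
      |((m : ℝ) - 2 * j)| ^ f ≤ (m : ℝ) ^ f * Real.exp (-(2 * D)) ^ i := by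
    intro i hi
    have h1 : (m : ℝ) - 2 * i ≤ m * Real.exp (-(2 * i / m)) := by
      have := Real.add_one_le_exp (-(2 * (i : ℝ) / m))
      calc (m : ℝ) - 2 * i = m * (-(2 * (i : ℝ) / m) + 1) := by field_simp; ring
        _ ≤ _ := mul_le_mul_of_nonneg_left this hm'.le
    calc |((m : ℝ) - 2 * j)| ^ f ≤ (m * Real.exp (-(2 * i / m))) ^ f :=
          pow_le_pow_left₀ (abs_nonneg _) (hi.trans h1) _
      _ = m ^ f * Real.exp (-(2 * i * (f / m))) := by
          rw [mul_pow, ← Real.exp_nat_mul]; congr 2; field_simp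
      _ ≤ _ := by
          refine mul_le_mul_of_nonneg_left ?_ (by positivity)
          rw [← Real.exp_nat_mul]
          refine Real.exp_le_exp.2 ?_
          have h2 : (D : ℝ) ≤ f / m := by rw [le_div_iff₀ hm']; exact hf'
          have h3 : (i : ℝ) * D ≤ i * (f / m) := mul_le_mul_of_nonneg_left h2 (by positivity)
          linarith
  rcases le_total (2 * j) m with h | h
  · have := key j (by
      rw [abs_of_nonneg]
      have : (2 * (j : ℝ)) ≤ m := by exact_mod_cast h
      linarith)
    refine this.trans (mul_le_mul_of_nonneg_left ?_ (by positivity))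
    have : 0 ≤ Real.exp (-(2 * (D : ℝ))) ^ (m - j) := by positivity
    linarith
  · have := key (m - j) (by
      rw [abs_of_nonpos, Nat.cast_sub hj]
      · linarith
      · have : (m : ℝ) ≤ 2 * j := by exact_mod_cast h
        linarith)
    refine this.trans (mul_le_mul_of_nonneg_left ?_ (by positivity))
    have : 0 ≤ Real.exp (-(2 * (D : ℝ))) ^ j := by positivity
    linarith

/-- Moment generating function of the weight after rehashing many coordinates. -/
lemma sum_pow_negWeight_le (y : Fin m → ℤˣ) (F : Finset (Fin d)) (D : ℕ) (hm : 0 < m)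
    (hF : D * m ≤ #F) {c : ℝ} (hc0 : 0 ≤ c) (hc1 : c ≤ 1) :
    ∑ t : Fin d → Fin m, c ^ negWeight (y * bucketSign t F)
      ≤ 2 * ((1 + c) / 2 + (1 - c) / 2 * Real.exp (-(2 * D))) ^ m * (m : ℝ) ^ d := by
  set a : ℝ := (1 + c) / 2
  set b : ℝ := (1 - c) / 2
  set E : ℝ := Real.exp (-(2 * D))
  have ha : 0 ≤ a := by simp only [a]; linarith
  have hb : 0 ≤ b := by simp only [b]; linarith
  have hba : b ≤ a := by simp only [a, b]; linarith
  have hE0 : 0 < E := Real.exp_pos _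
  have hE1 : E ≤ 1 := by
    simp only [E]; rw [Real.exp_le_one_iff]
    have : (0 : ℝ) ≤ D := by positivity
    linarith
  have hFd : #F ≤ d := by simpa using card_le_univ F
  have h1 : ∀ t : Fin d → Fin m, c ^ negWeight (y * bucketSign t F)
      = ∑ S : Finset (Fin m), (a ^ #Sᶜ * b ^ #S * ∏ s ∈ S, signVal (y s)) *
          ∏ s ∈ S, signVal (bucketSign t F s) := by
    intro t
    rw [pow_negWeight]
    have : ∀ s, ((1 + c) / 2 + (1 - c) / 2 * signVal ((y * bucketSign t F) s))
        = b * (signVal (y s) * signVal (bucketSign t F s)) + a := by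
      intro s
      rw [Pi.mul_apply, signVal_mul]; simp only [a, b]; ring
    simp only [this]
    rw [prod_add]
    simp only [powerset_univ, prod_mul_distrib, prod_const]
    refine sum_congr rfl fun S _ => ?_
    rw [compl_eq_univ_sdiff]
    ring
  simp only [h1]
  rw [sum_comm]
  have h2 : ∀ S : Finset (Fin m), ∑ t : Fin d → Fin m,
      (a ^ #Sᶜ * b ^ #S * ∏ s ∈ S, signVal (y s)) * ∏ s ∈ S, signVal (bucketSign t F s)
      ≤ (m : ℝ) ^ d * ((b * E) ^ #S * a ^ (m - #S) + b ^ #S * (a * E) ^ (m - #S)) := by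
    intro S
    have hS : #S ≤ m := by simpa using card_le_univ S
    rw [← mul_sum, sum_char_bucketSign, card_compl, Fintype.card_fin]
    have habs : |∏ s ∈ S, signVal (y s)| = 1 := by
      rw [abs_prod]; simp [abs_signVal]
    refine (le_abs_self _).trans ?_
    rw [abs_mul, abs_mul, habs, mul_one, abs_of_nonneg (by positivity : 0 ≤ a ^ (m - #S) * b ^ #S),
      abs_mul, abs_of_nonneg (by positivity : (0 : ℝ) ≤ (m : ℝ) ^ (d - #F)), abs_pow]
    have h3 := abs_pow_le_add m #S D #F hm hS hF
    calc a ^ (m - #S) * b ^ #S * ((m : ℝ) ^ (d - #F) * |(m : ℝ) - 2 * #S| ^ #F)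
        ≤ a ^ (m - #S) * b ^ #S * ((m : ℝ) ^ (d - #F) * ((m : ℝ) ^ #F * (E ^ #S + E ^ (m - #S)))) := by
          gcongr
      _ = a ^ (m - #S) * b ^ #S * (((m : ℝ) ^ (d - #F) * (m : ℝ) ^ #F) * (E ^ #S + E ^ (m - #S))) := by
          ring
      _ = _ := by
          rw [← pow_add, Nat.sub_add_cancel hFd, mul_pow, mul_pow]; ring
  refine (sum_le_sum fun S _ => h2 S).trans ?_
  rw [← mul_sum, sum_add_distrib]
  have h4 : ∀ p q : ℝ, ∑ S : Finset (Fin m), p ^ #S * q ^ (m - #S) = (p + q) ^ m := by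
    intro p q
    have := Finset.sum_pow_mul_eq_add_pow p q (univ : Finset (Fin m))
    simpa using this
  rw [h4, h4]
  -- The characters near the full set contribute no more than those near the empty set, as `b ≤ a`
  -- and `E ≤ 1`; this is the factor 2 in the bound.
  have h5 : (b + a * E) ^ m ≤ (b * E + a) ^ m := by
    apply pow_le_pow_left₀ (by positivity)
    nlinarith
  have h6 : (b * E + a) = a + b * E := by ring
  rw [h6] at h5 ⊢
  have : (0 : ℝ) ≤ (m : ℝ) ^ d := by positivity
  nlinarith

/-- After rehashing many coordinates, the weight is far below `m / 2` with exponentially small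
probability. -/
lemma card_negWeight_le_of_rehash (Q u : ℕ) (hu : 0 < u) (hm : m = (2 * Q + 1) * u)
    (y : Fin m → ℤˣ) (F : Finset (Fin d)) (hF : (2 * Q + 1) * m ≤ #F) :
    (#{t : Fin d → Fin m | negWeight (y * bucketSign t F) ≤ Q * u} : ℝ)
      ≤ 2 * Real.exp (-(u / (4 * (2 * Q + 1)))) * (m : ℝ) ^ d := by
  set D : ℕ := 2 * Q + 1 with hD
  have hDpos : (0 : ℝ) < D := by positivity
  have hm0 : 0 < m := by rw [hm]; positivity
  have hmR : (m : ℝ) = D * u := by rw [hm]; push_cast; ring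
  have hDQ : (D : ℝ) = 2 * Q + 1 := by rw [hD]; push_cast; ring
  rw [← hDQ]
  -- Chernoff bound with parameter `2 * τ`. The radius `Q * u` equals `(m / 2) * (1 - 1 / D)`, so `τ
  -- = 1 / D` minimizes the exponent up to the error `E`, with value `-u / (2 * D)`.
  set τ : ℝ := 1 / D with hτ
  have hτ0 : 0 < τ := by positivity
  set c : ℝ := Real.exp (-(2 * τ)) with hc
  have hc0 : 0 < c := Real.exp_pos _
  have hc1 : c ≤ 1 := by rw [hc, Real.exp_le_one_iff]; linarith
  set E : ℝ := Real.exp (-(2 * D)) with hE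
  have h1 : (#{t : Fin d → Fin m | negWeight (y * bucketSign t F) ≤ Q * u} : ℝ)
      ≤ Real.exp (2 * τ * (Q * u)) * ∑ t : Fin d → Fin m, c ^ negWeight (y * bucketSign t F) := by
    rw [card_filter, Nat.cast_sum, mul_sum]
    refine sum_le_sum fun t _ => ?_
    split_ifs with h
    · rw [Nat.cast_one, hc, ← Real.exp_nat_mul, ← Real.exp_add, Real.one_le_exp_iff]
      have : (negWeight (y * bucketSign t F) : ℝ) ≤ Q * u := by exact_mod_cast h
      nlinarith
    · simp only [Nat.cast_zero]; positivity
  refine h1.trans ?_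
  have h2 := sum_pow_negWeight_le y F D hm0 hF hc0.le hc1
  have hab : (1 + c) / 2 + (1 - c) / 2 * E ≤ Real.exp (-τ) * (Real.cosh τ * Real.exp E) := by
    have e1 : (1 + c) / 2 = Real.exp (-τ) * Real.cosh τ := by
      rw [Real.cosh_eq, hc, show -(2 * τ) = -τ + -τ by ring, Real.exp_add]
      have : Real.exp (-τ) * Real.exp τ = 1 := by rw [← Real.exp_add]; simp
      linear_combination (-(1 : ℝ) / 2) * this
    have e2 : (1 - c) / 2 ≤ (1 + c) / 2 := by linarith
    have hE0 : 0 < E := Real.exp_pos _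
    have e3 := Real.add_one_le_exp E
    calc (1 + c) / 2 + (1 - c) / 2 * E ≤ (1 + c) / 2 * (E + 1) := by nlinarith
      _ ≤ (1 + c) / 2 * Real.exp E := by gcongr
      _ = _ := by rw [e1]; ring
  have hab0 : 0 ≤ (1 + c) / 2 + (1 - c) / 2 * E := by
    have : 0 < E := Real.exp_pos _
    have : 0 ≤ (1 - c) / 2 := by linarith
    positivity
  have h3 : ((1 + c) / 2 + (1 - c) / 2 * E) ^ m
      ≤ Real.exp (m * (-τ + τ ^ 2 / 2 + E)) := by
    rw [Real.exp_nat_mul]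
    refine pow_le_pow_left₀ hab0 (hab.trans ?_) _
    rw [Real.exp_add, Real.exp_add, mul_assoc]
    gcongr
    exact Real.cosh_le_exp_half_sq τ
  -- From `2 * D ≤ exp D`. The non-uniformity of the rehashed code then spends at most half of the
  -- exponent `u / (2 * D)`.
  have hEs : E ≤ 1 / (4 * D ^ 2) := by
    rw [hE, Real.exp_neg, ← one_div]
    apply one_div_le_one_div_of_le (by positivity)
    have e1 : (2 * D : ℝ) ≤ Real.exp D := by
      have := Real.add_one_le_exp ((D : ℝ) - 1)
      have e2 : Real.exp D = Real.exp (D - 1) * Real.exp 1 := by rw [← Real.exp_add]; ring_nf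
      have e3 : (2 : ℝ) ≤ Real.exp 1 := by
        have := Real.add_one_le_exp (1 : ℝ); linarith
      rw [e2]
      nlinarith
    calc (4 * D ^ 2 : ℝ) = (2 * D) ^ 2 := by ring
      _ ≤ (Real.exp D) ^ 2 := by gcongr
      _ = _ := by rw [← Real.exp_nat_mul]; norm_num
  calc Real.exp (2 * τ * (Q * u)) * ∑ t : Fin d → Fin m, c ^ negWeight (y * bucketSign t F)
      ≤ Real.exp (2 * τ * (Q * u)) * (2 * Real.exp (m * (-τ + τ ^ 2 / 2 + E)) * (m : ℝ) ^ d) := by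
        refine mul_le_mul_of_nonneg_left (h2.trans ?_) (Real.exp_pos _).le
        gcongr
    _ = 2 * Real.exp (2 * τ * (Q * u) + m * (-τ + τ ^ 2 / 2 + E)) * (m : ℝ) ^ d := by
        rw [Real.exp_add]; ring
    _ ≤ _ := by
        gcongr
        have hu' : (0 : ℝ) < u := by exact_mod_cast hu
        have e1 : (m : ℝ) * E ≤ u / (4 * D) := by
          calc (m : ℝ) * E ≤ m * (1 / (4 * D ^ 2)) := by gcongr
            _ = u / (4 * D) := by rw [hmR]; field_simp
        have e2 : 2 * τ * (Q * u) + m * (-τ + τ ^ 2 / 2) = -(u / (2 * D)) := by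
          rw [hmR, hτ]
          have : (Q : ℝ) = (D - 1) / 2 := by rw [hDQ]; ring
          rw [this]
          field_simp
          ring
        have e3 : -(u / (2 * D)) + u / (4 * D) = -(u / (4 * D) : ℝ) := by field_simp; ring
        have e4 : (2 : ℝ) * τ * (Q * u) + m * (-τ + τ ^ 2 / 2 + E)
            = (2 * τ * (Q * u) + m * (-τ + τ ^ 2 / 2)) + m * E := by ring
        linarith

end Mgf

/-! ### One level: a random hash with a random shift -/

section Level

variable {d m : ℕ}

/-- Weight of the code of the point with support `x` for the hash function `p.1` and the shift
`p.2`. -/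
def hashWeight (p : (Fin d → Fin m) × (Fin m → ℤˣ)) (x : Finset (Fin d)) : ℕ :=
  negWeight (p.2 * bucketSign p.1 x)

lemma hashWeight_insert_le (p : (Fin d → Fin m) × (Fin m → ℤˣ)) {x : Finset (Fin d)} {l : Fin d}
    (hl : l ∉ x) : hashWeight p (insert l x) ≤ hashWeight p x + 1 ∧
      hashWeight p x ≤ hashWeight p (insert l x) + 1 := by
  constructor
  · refine negWeight_le_succ (a := p.1 l) fun s hs => ?_
    simp [bucketSign_insert_of_ne p.1 hl (Ne.symm hs)]
  · refine negWeight_le_succ (a := p.1 l) fun s hs => ?_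
    simp [bucketSign_insert_of_ne p.1 hl (Ne.symm hs)]

/-- Multiplying the shift by the code of `x0` is a bijection for each hash function. In the new
parameters the shifted code of `x0` is `v` itself, and other points depend on the hash only through
their difference from `x0`. -/
lemma card_filter_shift (P : ((Fin d → Fin m) × (Fin m → ℤˣ)) → Prop) [DecidablePred P]
    (x0 : Finset (Fin d)) :
    #{p | P p} = ∑ v : Fin m → ℤˣ, #{t : Fin d → Fin m | P (t, v * bucketSign t x0)} := by
  have h1 : #{p | P p} = ∑ t : Fin d → Fin m, #{v : Fin m → ℤˣ | P (t, v)} := by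
    simp only [card_filter]
    rw [Fintype.sum_prod_type]
  have h2 : ∀ t : Fin d → Fin m, #{v : Fin m → ℤˣ | P (t, v)}
      = #{v : Fin m → ℤˣ | P (t, v * bucketSign t x0)} := fun t =>
    (card_filter_mul_right (bucketSign t x0) fun v => P (t, v)).symm
  rw [h1]
  simp only [h2, card_filter]
  rw [sum_comm]

lemma card_hashWeight (x : Finset (Fin d)) (q : ℕ → Prop) [DecidablePred q] :
    #{p : (Fin d → Fin m) × (Fin m → ℤˣ) | q (hashWeight p x)}
      = m ^ d * #{y : Fin m → ℤˣ | q (negWeight y)} := by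
  rw [card_filter_shift _ x]
  have h : ∀ (t : Fin d → Fin m) (v : Fin m → ℤˣ),
      hashWeight (t, v * bucketSign t x) x = negWeight v := by
    intro t v
    have : bucketSign t x * bucketSign t x = 1 := by
      ext s; simp
    simp only [hashWeight, mul_assoc, this, mul_one]
  simp only [h, card_filter]
  rw [sum_comm]
  simp

/-- Number of hash functions and shifts that give small weight to all points of a list. -/
def hashCount (d m ρ : ℕ) (H : List (Finset (Fin d))) : ℕ :=
  #{p : (Fin d → Fin m) × (Fin m → ℤˣ) | ∀ x ∈ H, hashWeight p x ≤ ρ}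

lemma hashCount_cons_le (ρ : ℕ) (x : Finset (Fin d)) (H : List (Finset (Fin d))) :
    hashCount d m ρ (x :: H) ≤ hashCount d m ρ H := by
  refine card_le_card fun p hp => ?_
  simp only [mem_filter, mem_univ, true_and, List.mem_cons, forall_eq_or_imp] at hp ⊢
  exact hp.2

lemma symmDiff_subset_varying {H : List (Finset (Fin d))} {x y : Finset (Fin d)} (hx : x ∈ H)
    (hy : y ∈ H) : symmDiff x y ⊆ varying H := by
  intro l hl
  rw [varying, mem_filter]
  refine ⟨mem_univ _, ?_⟩
  rcases mem_symmDiff.1 hl with h | h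
  · exact ⟨x, hx, y, hy, h⟩
  · exact ⟨y, hy, x, hx, h⟩

lemma varying_cons_subset {H : List (Finset (Fin d))} {x x0 : Finset (Fin d)} (h0 : x0 ∈ H) :
    varying (x :: H) ⊆ varying H ∪ (symmDiff x x0 \ varying H) := by
  intro l hl
  by_cases hlV : l ∈ varying H
  · exact mem_union_left _ hlV
  refine mem_union_right _ (mem_sdiff.2 ⟨?_, hlV⟩)
  have hag : ∀ y ∈ H, (l ∈ y ↔ l ∈ x0) := by
    intro y hy
    by_contra hne
    exact hlV (symmDiff_subset_varying hy h0 (mem_symmDiff.2 (by tauto)))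
  simp only [varying, mem_filter, mem_univ, true_and, List.mem_cons] at hl
  obtain ⟨y, hy, z, hz, hly, hlz⟩ := hl
  rw [mem_symmDiff]
  rcases hy with rfl | hy <;> rcases hz with rfl | hz
  · exact absurd hly hlz
  · left; exact ⟨hly, fun h => hlz ((hag z hz).2 h)⟩
  · right; exact ⟨(hag y hy).1 hly, hlz⟩
  · exact absurd ((hag z hz).2 ((hag y hy).1 hly)) hlz

/-- One more point that differs in many new coordinates decreases the count exponentially. -/
lemma hashCount_cons_le_mul (Q u : ℕ) (hu : 0 < u) (hm : m = (2 * Q + 1) * u)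
    {H : List (Finset (Fin d))} {x x0 : Finset (Fin d)} (h0 : x0 ∈ H)
    (hF : (2 * Q + 1) * m ≤ #(symmDiff x x0 \ varying H)) :
    (hashCount d m (Q * u) (x :: H) : ℝ)
      ≤ 2 * Real.exp (-(u / (4 * (2 * Q + 1)))) * hashCount d m (Q * u) H := by
  set β : ℝ := 2 * Real.exp (-(u / (4 * (2 * Q + 1)))) with hβ
  set F := symmDiff x x0 \ varying H with hFdef
  have hm0 : 0 < m := by rw [hm]; positivity
  have : Nonempty (Fin m) := ⟨⟨0, hm0⟩⟩
  have hw : ∀ (t : Fin d → Fin m) (v : Fin m → ℤˣ) (y : Finset (Fin d)),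
      hashWeight (t, v * bucketSign t x0) y = negWeight (v * bucketSign t (symmDiff y x0)) := by
    intro t v y
    rw [hashWeight, bucketSign_symmDiff, mul_assoc, mul_comm (bucketSign t x0)]
  rw [hashCount, hashCount, card_filter_shift _ x0, card_filter_shift _ x0]
  push_cast
  rw [mul_sum]
  refine sum_le_sum fun v _ => ?_
  simp only [hw]
  -- For fixed `v`, the event for the old points uses only hashes of coordinates in `varying H`. The
  -- hashes on `F` are fresh and decide the event for the new point.
  have key := sum_mul_le_of_resample F
    (fun t : Fin d → Fin m =>
      if ∀ y ∈ H, negWeight (v * bucketSign t (symmDiff y x0)) ≤ Q * u then (1 : ℝ) else 0)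
    (fun t : Fin d → Fin m =>
      if negWeight (v * bucketSign t (symmDiff x x0)) ≤ Q * u then (1 : ℝ) else 0) β
    (fun t => by positivity) ?_ ?_
  · rw [card_filter, card_filter]
    push_cast
    refine le_trans (le_of_eq (sum_congr rfl fun t _ => ?_)) key
    simp only [List.mem_cons, forall_eq_or_imp, ite_and]
    split_ifs <;> simp
  · intro t t'
    have : ∀ y ∈ H, bucketSign (F.piecewise t' t) (symmDiff y x0)
        = bucketSign t (symmDiff y x0) := by
      intro y hy
      refine bucketSign_congr fun l hl => ?_
      have : l ∉ F := fun h => (mem_sdiff.1 h).2 (symmDiff_subset_varying hy h0 hl)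
      simp [this]
    have h2 : (∀ y ∈ H, negWeight (v * bucketSign (F.piecewise t' t) (symmDiff y x0)) ≤ Q * u) ↔
        ∀ y ∈ H, negWeight (v * bucketSign t (symmDiff y x0)) ≤ Q * u :=
      forall₂_congr fun y hy => by rw [this y hy]
    simp only [h2]
  -- The coordinates of the difference outside `F` act as a fixed shift, and the rehashing bound
  -- holds for every shift.
  · intro t
    have hsub : F ⊆ symmDiff x x0 := sdiff_subset
    have h3 : ∀ t' : Fin d → Fin m, v * bucketSign (F.piecewise t' t) (symmDiff x x0)
        = (v * bucketSign t (symmDiff x x0 \ F)) * bucketSign t' F := by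
      intro t'
      rw [← sdiff_union_of_subset hsub, bucketSign_union _ sdiff_disjoint, mul_assoc,
        sdiff_union_of_subset hsub]
      congr 2
      · refine bucketSign_congr fun l hl => ?_
        simp [(mem_sdiff.1 hl).2]
      · refine bucketSign_congr fun l hl => ?_
        simp [hl]
    simp only [h3]
    have h4 := card_negWeight_le_of_rehash Q u hu hm (v * bucketSign t (symmDiff x x0 \ F)) F hF
    rw [card_filter] at h4
    push_cast at h4
    simpa using h4

end Level

/-! ### Regions: intersections of levels at geometric scales -/

section Block

/-- A block: hash functions and shifts for a number of levels with `(2 * Q + 1) * u a` buckets. -/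
abbrev Block (d l Q : ℕ) (u : Fin l → ℕ) : Type :=
  ∀ a : Fin l, (Fin d → Fin ((2 * Q + 1) * u a)) × (Fin ((2 * Q + 1) * u a) → ℤˣ)

variable {d l Q : ℕ} {u : Fin l → ℕ}

/-- The random region of the cube that belongs to a block. -/
def Block.Hit (b : Block d l Q u) (x : Finset (Fin d)) : Prop :=
  ∀ a, hashWeight (b a) x ≤ Q * u a

/-- The interior of the region. -/
def Block.Core (b : Block d l Q u) (x : Finset (Fin d)) : Prop :=
  ∀ a, hashWeight (b a) x + 1 ≤ Q * u a

/-- A step changes the parity of one bucket in each level, so a margin of one in every level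
suffices. This and the next lemma are all that the monotonicity argument needs from the geometry of
the regions. -/
lemma Block.Core.hit_insert {b : Block d l Q u} {x : Finset (Fin d)} {i : Fin d} (hi : i ∉ x)
    (h : b.Core x) : b.Hit (insert i x) := fun a =>
  (hashWeight_insert_le (b a) hi).1.trans (h a)

lemma Block.Core.hit_of_insert {b : Block d l Q u} {x : Finset (Fin d)} {i : Fin d} (hi : i ∉ x)
    (h : b.Core (insert i x)) : b.Hit x := fun a =>
  (hashWeight_insert_le (b a) hi).2.trans (h a)

/-- Number of blocks whose region contains a given point. -/
def hitCount (d l Q : ℕ) (u : Fin l → ℕ) : ℕ :=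
  ∏ a : Fin l, ((2 * Q + 1) * u a) ^ d * ballCard ((2 * Q + 1) * u a) (Q * u a)

open scoped Classical in
lemma card_hit_list (H : List (Finset (Fin d))) :
    #{b : Block d l Q u | ∀ x ∈ H, b.Hit x}
      = ∏ a, hashCount d ((2 * Q + 1) * u a) (Q * u a) H := by
  simp only [hashCount]
  rw [← Fintype.card_piFinset]
  congr 1
  ext b
  rw [Fintype.mem_piFinset]
  refine ⟨fun h a => ?_, fun h => ?_⟩
  · rw [mem_filter]
    exact ⟨mem_univ _, fun x hx => (mem_filter.1 h).2 x hx a⟩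
  · rw [mem_filter]
    exact ⟨mem_univ _, fun x hx a => (mem_filter.1 (h a)).2 x hx⟩

lemma hashCount_singleton (m ρ : ℕ) (x : Finset (Fin d)) :
    hashCount d m ρ [x] = m ^ d * ballCard m ρ := by
  simp only [hashCount, List.mem_singleton, forall_eq, ballCard]
  exact card_hashWeight x (fun w => w ≤ ρ)

open scoped Classical in
lemma card_hit (x : Finset (Fin d)) : #{b : Block d l Q u | b.Hit x} = hitCount d l Q u := by
  have := card_hit_list (d := d) (l := l) (Q := Q) (u := u) [x]
  simp only [List.mem_singleton, forall_eq] at this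
  rw [this]
  simp only [hashCount_singleton, hitCount]

/-- Chooses the level whose number of buckets fits a given number of fresh coordinates, up to the
ratio `R`. -/
lemma exists_scale (A R l f : ℕ) (h1 : A ≤ f) (h2 : f < A * R ^ l) :
    ∃ a < l, A * R ^ a ≤ f ∧ f < A * R ^ (a + 1) := by
  induction l with
  | zero => simp at h2; omega
  | succ l ih =>
    by_cases h : f < A * R ^ l
    · obtain ⟨a, ha, h3⟩ := ih h
      exact ⟨a, by omega, h3⟩
    · exact ⟨l, by omega, by omega, h2⟩

lemma mul_mul_le_of_factor {A X B P' P e w : ℝ} (hA : A ≤ 2 * B * X) (hX : 0 ≤ X) (hP' : 0 ≤ P')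
    (hP : P' ≤ P) (he : 0 ≤ e) (hBe : B * e ≤ 1) (hw : w = X * P) : A * P' * e ≤ 3 * w := by
  have h1 : A * P' * e ≤ 2 * B * X * P' * e := by gcongr
  have h2 : 2 * B * X * P' * e = 2 * (X * P') * (B * e) := by ring
  have h3 : 2 * (X * P') * (B * e) ≤ 2 * (X * P') * 1 := by gcongr
  have h4 : X * P' ≤ X * P := by gcongr
  have h5 : 0 ≤ X * P' := mul_nonneg hX hP'
  rw [hw]
  linarith

/-- A single well-chosen level pays for the whole factor `exp (μ * #F)`; in the other levels the
count merely does not increase. The value of `μ` is the largest for which the gain `exp (-u / (4 *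
(2 * Q + 1)))` of a level covers all numbers of fresh coordinates up to `R` times its threshold. -/
lemma prod_hashCount_cons_mul_exp_le (R J : ℕ) (hR : 0 < R) (hJ : 0 < J) (hJQ : J ≤ 2 * Q + 1)
    (hu : ∀ a, u a = J * R ^ (a : ℕ)) (hd : d < (2 * Q + 1) ^ 2 * J * R ^ l)
    {H : List (Finset (Fin d))} {x x0 : Finset (Fin d)} (h0 : x0 ∈ H) :
    (∏ a : Fin l, (hashCount d ((2 * Q + 1) * u a) (Q * u a) (x :: H) : ℝ)) *
        Real.exp (1 / (4 * (2 * Q + 1) ^ 3 * R) * #(symmDiff x x0 \ varying H))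
      ≤ 3 * ∏ a : Fin l, (hashCount d ((2 * Q + 1) * u a) (Q * u a) H : ℝ) := by
  set μ : ℝ := 1 / (4 * (2 * Q + 1) ^ 3 * R) with hμ
  set F := symmDiff x x0 \ varying H with hF
  have hRr : (1 : ℝ) ≤ R := by exact_mod_cast hR
  have hDr : (1 : ℝ) ≤ 2 * Q + 1 := by
    have : (0 : ℝ) ≤ Q := by positivity
    linarith
  have hFd : #F ≤ d := by simpa using card_le_univ F
  have hmono : ∀ a : Fin l, (hashCount d ((2 * Q + 1) * u a) (Q * u a) (x :: H) : ℝ)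
      ≤ hashCount d ((2 * Q + 1) * u a) (Q * u a) H := fun a => by
    exact_mod_cast hashCount_cons_le _ _ _
  by_cases hsmall : #F < (2 * Q + 1) ^ 2 * J
  -- Below the smallest scale no level gains anything, but there `μ * #F ≤ 1`, because `J ≤ 2 * Q +
  -- 1`, and the factor 3 absorbs `e`.
  · have h1 : Real.exp (μ * #F) ≤ 3 := by
      have e3 : Real.exp 1 ≤ 3 := by have := Real.exp_one_lt_d9; linarith
      refine (Real.exp_le_exp.2 ?_).trans e3
      have h2 : (#F : ℝ) ≤ (2 * Q + 1) ^ 2 * (2 * Q + 1) := by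
        have : #F ≤ (2 * Q + 1) ^ 2 * (2 * Q + 1) :=
          hsmall.le.trans (Nat.mul_le_mul_left _ hJQ)
        exact_mod_cast this
      rw [hμ, div_mul_eq_mul_div, one_mul, div_le_one (by positivity)]
      nlinarith [pow_pos (lt_of_lt_of_le one_pos hDr) 3]
    rw [mul_comm]
    exact mul_le_mul h1 (prod_le_prod (fun _ _ => by positivity) fun a _ => hmono a)
      (prod_nonneg fun _ _ => by positivity) (by norm_num)
  · obtain ⟨a, hal, ha1, ha2⟩ := exists_scale ((2 * Q + 1) ^ 2 * J) R l #F (by omega) (by omega)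
    set a' : Fin l := ⟨a, hal⟩
    have hua : u a' = J * R ^ a := hu a'
    have hua0 : 0 < u a' := by rw [hua]; positivity
    have hl := hashCount_cons_le_mul (m := (2 * Q + 1) * u a') Q (u a') hua0 rfl (x := x) h0
      (by rw [hua]; calc _ = (2 * Q + 1) ^ 2 * J * R ^ a := by ring
            _ ≤ _ := ha1)
    rw [← mul_prod_erase univ _ (mem_univ a')]
    refine mul_mul_le_of_factor hl (by positivity) (prod_nonneg fun _ _ => by positivity)
      (prod_le_prod (fun _ _ => by positivity) fun a _ => hmono a) (Real.exp_pos _).le ?_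
      (mul_prod_erase univ _ (mem_univ a')).symm
    rw [← Real.exp_add, Real.exp_le_one_iff]
    have h2 : (#F : ℝ) ≤ (2 * Q + 1) ^ 2 * (u a' * R) := by
      have : #F ≤ (2 * Q + 1) ^ 2 * (u a' * R) := by
        rw [hua]; refine ha2.le.trans (le_of_eq ?_); ring
      exact_mod_cast this
    have h3 : μ * #F ≤ u a' / (4 * (2 * Q + 1)) := by
      calc μ * #F ≤ μ * ((2 * Q + 1) ^ 2 * (u a' * R)) := by gcongr
        _ = _ := by rw [hμ]; field_simp
    linarith

open scoped Classical in
/-- The regions spread: the probability that a region contains a list of points decays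
exponentially with the number of coordinates that vary within the list. -/
lemma card_hit_list_mul_exp_le (R J : ℕ) (hR : 0 < R) (hJ : 0 < J) (hJQ : J ≤ 2 * Q + 1)
    (hu : ∀ a, u a = J * R ^ (a : ℕ)) (hd : d < (2 * Q + 1) ^ 2 * J * R ^ l)
    (H : List (Finset (Fin d))) (hH : H ≠ []) :
    (#{b : Block d l Q u | ∀ x ∈ H, b.Hit x} : ℝ) *
      Real.exp (1 / (4 * (2 * Q + 1) ^ 3 * R) * #(varying H))
      ≤ hitCount d l Q u * 3 ^ H.length := by
  induction H with
  | nil => exact absurd rfl hH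
  | cons x H ih =>
    rcases H.eq_nil_or_concat with rfl | hne
    · have hv : varying [x] = ∅ := by
        ext i; simp only [varying, mem_filter, mem_univ, true_and, List.mem_singleton,
          exists_eq_left, notMem_empty, iff_false]; tauto
      rw [hv]
      have h1 : #{b : Block d l Q u | ∀ y ∈ [x], b.Hit y} = hitCount d l Q u := by
        simpa using card_hit (l := l) (Q := Q) (u := u) x
      rw [h1]
      have : (0 : ℝ) ≤ hitCount d l Q u := by positivity
      simp; linarith
    · have hH' : H ≠ [] := by
        obtain ⟨L, b, rfl⟩ := hne; simp
      have ih := ih hH'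
      obtain ⟨x0, h0⟩ := List.exists_mem_of_ne_nil H hH'
      have hvar : (#(varying (x :: H)) : ℝ) ≤ #(symmDiff x x0 \ varying H) + #(varying H) := by
        rw [add_comm]
        exact_mod_cast (card_le_card (varying_cons_subset h0)).trans (card_union_le _ _)
      have step := prod_hashCount_cons_mul_exp_le R J hR hJ hJQ hu hd (x := x) h0
      rw [card_hit_list] at ih ⊢
      push_cast at ih ⊢
      set μ : ℝ := 1 / (4 * (2 * Q + 1) ^ 3 * R)
      have hμ0 : 0 ≤ μ := by positivity
      calc _ ≤ (∏ a : Fin l, (hashCount d ((2 * Q + 1) * u a) (Q * u a) (x :: H) : ℝ)) *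
            Real.exp (μ * (#(symmDiff x x0 \ varying H) + #(varying H))) :=
            mul_le_mul_of_nonneg_left
              (Real.exp_le_exp.2 (mul_le_mul_of_nonneg_left hvar hμ0))
              (prod_nonneg fun _ _ => by positivity)
        _ = ((∏ a : Fin l, (hashCount d ((2 * Q + 1) * u a) (Q * u a) (x :: H) : ℝ)) *
            Real.exp (μ * #(symmDiff x x0 \ varying H))) * Real.exp (μ * #(varying H)) := by
            rw [mul_add, Real.exp_add]; ring
        _ ≤ (3 * ∏ a : Fin l, (hashCount d ((2 * Q + 1) * u a) (Q * u a) H : ℝ)) *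
            Real.exp (μ * #(varying H)) := mul_le_mul_of_nonneg_right step (Real.exp_pos _).le
        _ = 3 * ((∏ a : Fin l, (hashCount d ((2 * Q + 1) * u a) (Q * u a) H : ℝ)) *
            Real.exp (μ * #(varying H))) := by ring
        _ ≤ 3 * (hitCount d l Q u * 3 ^ H.length) := mul_le_mul_of_nonneg_left ih (by norm_num)
        _ = _ := by rw [List.length_cons, pow_succ]; ring

end Block

/-! ### The boundary of a region is a small part of it -/

section Padding

/-- For `j` between `(Q - 1) * u` and `Q * u - 1` the ratio `(j + 1) / (m - j)` of consecutive
binomial coefficients is at least `(Q - 1) / (Q + 2) = 1 - 3 / (Q + 2)`. -/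
lemma choose_sub_ge (Q u J i : ℕ) (hJu : J ≤ u) (hi : i ≤ J) (hQ1 : 1 ≤ Q) :
    (1 - 3 / (Q + 2) : ℝ) ^ i * ((2 * Q + 1) * u).choose (Q * u)
      ≤ ((2 * Q + 1) * u).choose (Q * u - i) := by
  induction i with
  | zero => simp
  | succ i ih =>
    have ih := ih (by omega)
    set m := (2 * Q + 1) * u with hm
    have hu : i + 1 ≤ u := by omega
    have hQu : u ≤ Q * u := Nat.le_mul_of_pos_left u hQ1
    set j := Q * u - (i + 1) with hj
    have hji : Q * u - i = j + 1 := by omega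
    rw [hji] at ih
    have hjm : j ≤ m := by rw [hm]; nlinarith [Nat.sub_le (Q * u) (i + 1)]
    have h1 : (m.choose (j + 1) : ℝ) * (j + 1) = m.choose j * (m - j) := by
      have := Nat.choose_succ_right_eq m j
      rw [← Nat.cast_sub hjm]
      exact_mod_cast this
    have hjr : (j : ℝ) = Q * u - (i + 1) := by
      rw [hj, Nat.cast_sub (by omega)]; push_cast; ring
    have hmr : (m : ℝ) = (2 * Q + 1) * u := by rw [hm]; push_cast; ring
    have hur : (i : ℝ) + 1 ≤ u := by exact_mod_cast hu
    have hi0 : (0 : ℝ) ≤ i := by positivity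
    have hQr : (1 : ℝ) ≤ Q := by exact_mod_cast hQ1
    have hA : (0 : ℝ) ≤ m.choose (j + 1) := by positivity
    have hu0 : (0 : ℝ) < u := by linarith
    have hpos : (0 : ℝ) < m - j := by rw [hmr, hjr]; nlinarith
    have h2 : (1 - 3 / (Q + 2) : ℝ) * m.choose (j + 1) ≤ m.choose j := by
      have h3 : (m.choose j : ℝ) = m.choose (j + 1) * (j + 1) / (m - j) := by
        rw [h1]; field_simp
      rw [h3, le_div_iff₀ hpos]
      have h4 : (1 - 3 / (Q + 2) : ℝ) * (m - j) ≤ j + 1 := by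
        have : (1 - 3 / (Q + 2) : ℝ) = (Q - 1) / (Q + 2) := by field_simp; ring
        rw [this, div_mul_eq_mul_div, div_le_iff₀ (by positivity), hmr, hjr]
        nlinarith
      nlinarith
    have hθ : (0 : ℝ) ≤ 1 - 3 / (Q + 2) := by
      rw [sub_nonneg, div_le_one (by positivity)]; linarith
    calc _ = (1 - 3 / (Q + 2) : ℝ) * ((1 - 3 / (Q + 2) : ℝ) ^ i * m.choose (Q * u)) := by ring
      _ ≤ (1 - 3 / (Q + 2) : ℝ) * m.choose (j + 1) := mul_le_mul_of_nonneg_left ih hθ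
      _ ≤ _ := h2

/-- The sphere is a small part of the ball. -/
lemma mul_choose_le_ballCard (Q u J : ℕ) (hJu : J ≤ u) (hQ : 6 * J ≤ Q + 2) (hQ1 : 1 ≤ Q) :
    (J : ℝ) * ((2 * Q + 1) * u).choose (Q * u) ≤ 2 * ballCard ((2 * Q + 1) * u) (Q * u) := by
  set m := (2 * Q + 1) * u
  have hQu : u ≤ Q * u := Nat.le_mul_of_pos_left u hQ1
  have h1 : ∀ i ∈ range J, (1 / 2 : ℝ) * m.choose (Q * u) ≤ m.choose (Q * u - i) := by
    intro i hi
    rw [mem_range] at hi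
    refine le_trans (mul_le_mul_of_nonneg_right ?_ (by positivity))
      (choose_sub_ge Q u J i hJu hi.le hQ1)
    -- Bernoulli's inequality: for `6 * i ≤ Q + 2` the loss over `i` layers is at most one half, so
    -- the ball contains `J` layers each at least half as large as the sphere.
    have h2 := one_add_mul_le_pow (a := (-(3 / (Q + 2)) : ℝ)) (by
      rw [neg_le_neg_iff, div_le_iff₀ (by positivity)]
      have : (0 : ℝ) ≤ Q := by positivity
      linarith) i
    have h3 : (i : ℝ) * (3 / (Q + 2)) ≤ 1 / 2 := by
      rw [mul_div_assoc', div_le_iff₀ (by positivity)]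
      have : (6 * i : ℝ) ≤ Q + 2 := by
        have : 6 * i ≤ Q + 2 := by omega
        exact_mod_cast this
      linarith
    have h4 : (1 - 3 / (Q + 2) : ℝ) = 1 + -(3 / (Q + 2)) := by ring
    rw [h4]
    linarith
  have h2 : ∑ i ∈ range J, m.choose (Q * u - i) ≤ ballCard m (Q * u) := by
    rw [ballCard_eq_sum]
    rw [← sum_image (f := fun j => m.choose j) (g := fun i => Q * u - i) (s := range J)]
    · refine sum_le_sum_of_subset ?_
      intro j hj
      simp only [mem_image, mem_range] at hj ⊢
      omega
    · intro i hi j hj h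
      simp only [coe_range, Set.mem_Iio] at hi hj
      simp only at h
      omega
  have h3 := sum_le_sum h1
  simp only [sum_const, card_range, nsmul_eq_mul] at h3
  have h4 : (∑ i ∈ range J, (m.choose (Q * u - i) : ℝ)) ≤ ballCard m (Q * u) := by
    exact_mod_cast h2
  linarith

variable {d l Q : ℕ} {u : Fin l → ℕ}

open scoped Classical in
-- Only the factor of level `a` changes from ball to sphere, since the levels are independent. A
-- union bound over the `l` levels then bounds the whole boundary.
lemma card_hit_boundary_level_le (J : ℕ) (hQ : 6 * J ≤ Q + 2) (hQ1 : 1 ≤ Q) (hu : ∀ a, J ≤ u a)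
    (x : Finset (Fin d)) (a : Fin l) :
    (J : ℝ) * #{b : Block d l Q u | b.Hit x ∧ hashWeight (b a) x = Q * u a}
      ≤ 2 * hitCount d l Q u := by
  have h1 : #{b : Block d l Q u | b.Hit x ∧ hashWeight (b a) x = Q * u a}
      ≤ ∏ c : Fin l, if c = a then
        ((2 * Q + 1) * u c) ^ d * ((2 * Q + 1) * u c).choose (Q * u c)
        else ((2 * Q + 1) * u c) ^ d * ballCard ((2 * Q + 1) * u c) (Q * u c) := by
    have h2 : ∀ c : Fin l, (if c = a then
        ((2 * Q + 1) * u c) ^ d * ((2 * Q + 1) * u c).choose (Q * u c)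
        else ((2 * Q + 1) * u c) ^ d * ballCard ((2 * Q + 1) * u c) (Q * u c))
        = #{p : (Fin d → Fin ((2 * Q + 1) * u c)) × (Fin ((2 * Q + 1) * u c) → ℤˣ) |
            if c = a then hashWeight p x = Q * u c else hashWeight p x ≤ Q * u c} := by
      intro c
      split_ifs with h
      · rw [card_hashWeight x (fun w => w = Q * u c), card_negWeight_eq]
      · exact (card_hashWeight x (fun w => w ≤ Q * u c)).symm
    simp only [h2]
    rw [← Fintype.card_piFinset]
    refine card_le_card fun b hb => ?_
    obtain ⟨h3, h4⟩ := (mem_filter.1 hb).2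
    rw [Fintype.mem_piFinset]
    intro c
    rw [mem_filter]
    refine ⟨mem_univ _, ?_⟩
    split_ifs with h
    · subst h; exact h4
    · exact h3 c
  have h3 : (J : ℝ) * ((∏ c : Fin l, if c = a then
        ((2 * Q + 1) * u c) ^ d * ((2 * Q + 1) * u c).choose (Q * u c)
        else ((2 * Q + 1) * u c) ^ d * ballCard ((2 * Q + 1) * u c) (Q * u c) : ℕ) : ℝ)
      ≤ 2 * hitCount d l Q u := by
    rw [hitCount, ← mul_prod_erase univ _ (mem_univ a), ← mul_prod_erase univ
      (fun c => ((2 * Q + 1) * u c) ^ d * ballCard ((2 * Q + 1) * u c) (Q * u c)) (mem_univ a),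
      if_pos rfl]
    have h4 : ∏ c ∈ univ.erase a, (if c = a then
        ((2 * Q + 1) * u c) ^ d * ((2 * Q + 1) * u c).choose (Q * u c)
        else ((2 * Q + 1) * u c) ^ d * ballCard ((2 * Q + 1) * u c) (Q * u c))
        = ∏ c ∈ univ.erase a, ((2 * Q + 1) * u c) ^ d * ballCard ((2 * Q + 1) * u c) (Q * u c) :=
      prod_congr rfl fun c hc => by rw [if_neg (ne_of_mem_erase hc)]
    rw [h4]
    have h5 := mul_choose_le_ballCard Q (u a) J (hu a) hQ hQ1
    set P := ∏ c ∈ univ.erase a, ((2 * Q + 1) * u c) ^ d * ballCard ((2 * Q + 1) * u c) (Q * u c)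
    rw [Nat.cast_mul, Nat.cast_mul, Nat.cast_mul, Nat.cast_mul]
    calc _ = ((((2 * Q + 1) * u a) ^ d : ℕ) : ℝ) * P *
          (J * ((2 * Q + 1) * u a).choose (Q * u a)) := by ring
      _ ≤ ((((2 * Q + 1) * u a) ^ d : ℕ) : ℝ) * P *
          (2 * ballCard ((2 * Q + 1) * u a) (Q * u a)) := by gcongr
      _ = _ := by ring
  refine le_trans (mul_le_mul_of_nonneg_left ?_ (by positivity)) h3
  exact_mod_cast h1

open scoped Classical in
/-- Most of a region is in its interior. -/
lemma card_hit_not_core_le (J : ℕ) (hQ : 6 * J ≤ Q + 2) (hQ1 : 1 ≤ Q) (hu : ∀ a, J ≤ u a)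
    (x : Finset (Fin d)) :
    (J : ℝ) * #{b : Block d l Q u | b.Hit x ∧ ¬ b.Core x} ≤ 2 * l * hitCount d l Q u := by
  have h1 : #{b : Block d l Q u | b.Hit x ∧ ¬ b.Core x}
      ≤ ∑ a : Fin l, #{b : Block d l Q u | b.Hit x ∧ hashWeight (b a) x = Q * u a} := by
    refine le_trans (card_le_card fun b hb => ?_) card_biUnion_le
    obtain ⟨h2, h3⟩ := (mem_filter.1 hb).2
    rw [Block.Core, not_forall] at h3
    obtain ⟨a, ha⟩ := h3
    rw [mem_biUnion]
    refine ⟨a, mem_univ _, mem_filter.2 ⟨mem_univ _, h2, ?_⟩⟩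
    have := h2 a
    omega
  calc (J : ℝ) * #{b : Block d l Q u | b.Hit x ∧ ¬ b.Core x}
      ≤ J * ∑ a : Fin l, (#{b : Block d l Q u | b.Hit x ∧ hashWeight (b a) x = Q * u a} : ℝ) := by
        gcongr; exact_mod_cast h1
    _ = ∑ a : Fin l, (J : ℝ) * #{b : Block d l Q u | b.Hit x ∧ hashWeight (b a) x = Q * u a} := by
        rw [mul_sum]
    _ ≤ ∑ _a : Fin l, (2 * hitCount d l Q u : ℝ) :=
        sum_le_sum fun a _ => card_hit_boundary_level_le J hQ hQ1 hu x a
    _ = _ := by simp; ring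

lemma hitCount_pos (hu : ∀ a, 0 < u a) : 0 < hitCount d l Q u := by
  refine prod_pos fun a _ => Nat.mul_pos (Nat.pow_pos ?_) ?_
  · have := hu a; positivity
  · rw [ballCard, card_pos]
    refine ⟨fun _ => 1, ?_⟩
    have h : (univ.filter fun _ : Fin ((2 * Q + 1) * u a) => (1 : ℤˣ) = -1) = ∅ := by
      rw [filter_eq_empty_iff]; intro _ _; decide
    rw [mem_filter, negWeight, h]
    simp

lemma hitCount_le_card : hitCount d l Q u ≤ Fintype.card (Block d l Q u) := by
  classical
  rw [← card_hit (∅ : Finset (Fin d))]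
  exact card_le_univ _

end Padding

/-! ### Decision trees and functions overlaid on a sequence of regions -/

/-- Deterministic adaptive algorithms with a membership oracle only. -/
inductive DTree (Z : Type*)
  | leaf (b : Bool) : DTree Z
  | node (z : Z) (next : Bool → DTree Z) : DTree Z

namespace DTree

variable {Z : Type*}

/-- The answer of a decision tree on a function. -/
def eval (f : Z → Bool) : DTree Z → Bool
  | leaf b => b
  | node z next => (next (f z)).eval f

/-- The points queried on a function, most recent first, put in front of the list `acc`. -/
def path (f : Z → Bool) : DTree Z → List Z → List Z
  | leaf _, acc => acc
  | node z next, acc => (next (f z)).path f (z :: acc)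

/-- The largest number of queries. -/
def depth : DTree Z → ℕ
  | leaf _ => 0
  | node _ next => max (next true).depth (next false).depth + 1

lemma depth_next_lt (z : Z) (next : Bool → DTree Z) (b : Bool) :
    (next b).depth + 1 ≤ (node z next).depth := by
  cases b <;> simp [depth]

end DTree

section Overlay

variable {Z B : Type*} {d L : ℕ}

/-- The region with index `i` is the first one that contains `z`. -/
def IsFirst (hit : B → Z → Prop) (w : Fin L → B) (i : Fin L) (z : Z) : Prop :=
  hit (w i) z ∧ ∀ j < i, ¬ hit (w j) z

lemma IsFirst.unique {hit : B → Z → Prop} {w : Fin L → B} {i j : Fin L} {z : Z}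
    (hi : IsFirst hit w i z) (hj : IsFirst hit w j z) : i = j := by
  rcases lt_trichotomy i j with h | h | h
  · exact absurd hi.1 (hj.2 i h)
  · exact h
  · exact absurd hj.1 (hi.2 j h)

lemma exists_isFirst {hit : B → Z → Prop} {w : Fin L → B} {z : Z} (h : ∃ i, hit (w i) z) :
    ∃ i, IsFirst hit w i z := by
  classical
  obtain ⟨i, hi⟩ := h
  have hne : (univ.filter fun j => hit (w j) z).Nonempty := ⟨i, by simp [hi]⟩
  refine ⟨_, (mem_filter.1 (min'_mem _ hne)).2, fun j hj h => ?_⟩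
  exact absurd (min'_le (univ.filter fun j => hit (w j) z) j (by simp [h])) (not_le.2 hj)

/-- The point `z` is labelled `i`: it lies in the interior of the first region that contains it. -/
def IsLab (hit core : B → Z → Prop) (w : Fin L → B) (i : Fin L) (z : Z) : Prop :=
  IsFirst hit w i z ∧ core (w i) z

open scoped Classical in
/-- The function that has the values `h i` on the points with label `i` and agrees with `base` on
the points without a label. -/
noncomputable def overlay (hit core : B → Z → Prop) (base : Z → Bool) (w : Fin L → B)
    (h : Fin L → Z → Bool) (z : Z) : Bool :=
  decide ((∃ i, IsLab hit core w i z ∧ h i z = true) ∨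
    (base z = true ∧ ∀ i, ¬ IsLab hit core w i z))

lemma overlay_of_lab {hit core : B → Z → Prop} {base : Z → Bool} {w : Fin L → B}
    {h : Fin L → Z → Bool} {z : Z} {i : Fin L} (hi : IsLab hit core w i z) :
    overlay hit core base w h z = h i z := by
  classical
  rw [Bool.eq_iff_iff]
  simp only [overlay, decide_eq_true_eq]
  constructor
  · rintro (⟨j, hj, hv⟩ | ⟨_, h2⟩)
    · rwa [hi.1.unique hj.1]
    · exact absurd hi (h2 i)
  · exact fun hv => Or.inl ⟨i, hi, hv⟩

lemma overlay_of_not_lab {hit core : B → Z → Prop} {base : Z → Bool} {w : Fin L → B}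
    {h : Fin L → Z → Bool} {z : Z} (hz : ∀ i, ¬ IsLab hit core w i z) :
    overlay hit core base w h z = base z := by
  classical
  rw [Bool.eq_iff_iff]
  simp only [overlay, decide_eq_true_eq]
  constructor
  · rintro (⟨j, hj, _⟩ | ⟨h1, _⟩)
    · exact absurd hj (hz j)
    · exact h1
  · exact fun hv => Or.inr ⟨hv, hz⟩

/-- Constant values on each region. -/
def constVal (k : ℕ) (s : Fin L → Fin d) : Fin L → Z → Bool := fun i _ => decide ((s i : ℕ) < k)

/-- An antidictator on each region. -/
def antiVal (main : Z → Finset (Fin d)) (s : Fin L → Fin d) : Fin L → Z → Bool :=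
  fun i z => decide (s i ∉ main z)

/-- One plus the number of coordinates that vary within a list of queries to the same region. -/
def regionCost (main : Z → Finset (Fin d)) (H : List Z) : ℕ :=
  if H.isEmpty then 0 else 1 + #(varying (H.map main))

open scoped Classical in
/-- Total cost of a list of queries. -/
noncomputable def cost (main : Z → Finset (Fin d)) (hit : B → Z → Prop) (w : Fin L → B)
    (H : List Z) : ℕ :=
  ∑ i, regionCost main (H.filter fun z => IsFirst hit w i z)

end Overlay

/-! ### Comparing constants with antidictators for fixed regions -/

section Likelihood

variable {Z B : Type*} {d L : ℕ}

/-- Weierstrass product inequality; it turns likelihood ratios of single regions into one for the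
whole history. -/
lemma one_sub_sum_le_prod {ι : Type*} (s : Finset ι) (e r : ι → ℝ) (he : ∀ i ∈ s, 0 ≤ e i)
    (hr : ∀ i ∈ s, 0 ≤ r i) (h : ∀ i ∈ s, 1 - e i ≤ r i) :
    1 - ∑ i ∈ s, e i ≤ ∏ i ∈ s, r i := by
  classical
  induction s using Finset.induction_on with
  | empty => simp
  | insert a s ha ih =>
    rw [sum_insert ha, prod_insert ha]
    have ih := ih (fun i hi => he i (mem_insert_of_mem hi)) (fun i hi => hr i (mem_insert_of_mem hi))
      (fun i hi => h i (mem_insert_of_mem hi))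
    have h1 := h a (mem_insert_self a s)
    have h2 := he a (mem_insert_self a s)
    have h3 := hr a (mem_insert_self a s)
    have h4 : 0 ≤ ∏ i ∈ s, r i := prod_nonneg fun i hi => hr i (mem_insert_of_mem hi)
    have h5 : 0 ≤ ∑ i ∈ s, e i := sum_nonneg fun i hi => he i (mem_insert_of_mem hi)
    by_cases hneg : 1 - e a ≤ 0
    · have : 0 ≤ r a * ∏ i ∈ s, r i := mul_nonneg h3 h4
      linarith
    · nlinarith [mul_le_mul_of_nonneg_right h1 h4]

lemma card_filter_lt_eq (d k : ℕ) (hk : k ≤ d) :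
    #{s : Fin d | (s : ℕ) < k} = k := by
  rw [Fin.card_filter_val_lt, min_eq_right hk]

variable (main : Z → Finset (Fin d)) (hit core : B → Z → Prop) (w : Fin L → B)

open scoped Classical in
/-- The assignments of one region for which `val` explains the answers in the history. -/
noncomputable def explain (val : Fin d → Z → Bool) (hist : List (Z × Bool)) (i : Fin L) :
    Finset (Fin d) :=
  univ.filter fun s => ∀ p ∈ hist, IsLab hit core w i p.1 → val s p.1 = p.2

open scoped Classical in
-- If some constant explains the history, then all answers with label `i` are equal. An antidictator
-- that gives this answer at one labelled point gives it at all of them unless its coordinate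
-- varies. So at most `regionCost` explanations are lost, out of at least `k`.
lemma card_explain_ge {k : ℕ} (hk : 0 < k) (hd : d = 16 * k)
    (hcore : ∀ b z, core b z → #(main z) = 15 * k ∨ #(main z) = 15 * k + 1)
    (hist : List (Z × Bool)) (i : Fin L)
    (hY : (explain hit core w (fun (s : Fin d) (_ : Z) => decide ((s : ℕ) < k)) hist i).Nonempty) :
    (#(explain hit core w (fun (s : Fin d) (_ : Z) => decide ((s : ℕ) < k)) hist i) : ℝ) *
      (1 - regionCost main ((hist.map Prod.fst).filter fun z => IsFirst hit w i z) / k)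
      ≤ #(explain hit core w (fun (s : Fin d) (z : Z) => decide (s ∉ main z)) hist i) := by
  set H := (hist.map Prod.fst).filter fun z => IsFirst hit w i z with hH
  set Y := explain hit core w (fun (s : Fin d) (_ : Z) => decide ((s : ℕ) < k)) hist i with hYd
  set A := explain hit core w (fun (s : Fin d) (z : Z) => decide (s ∉ main z)) hist i with hAd
  by_cases hno : ∃ p ∈ hist, IsLab hit core w i p.1
  · obtain ⟨p0, hp0, hl0⟩ := hno
    obtain ⟨s0, hs0⟩ := hY
    have hs0' := (mem_filter.1 hs0).2
    have ha : ∀ p ∈ hist, IsLab hit core w i p.1 → p.2 = p0.2 := fun p hp hl => by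
      rw [← hs0' p hp hl, ← hs0' p0 hp0 hl0]
    have hYeq : Y = univ.filter fun s : Fin d => decide ((s : ℕ) < k) = p0.2 := by
      ext s
      rw [hYd, explain, mem_filter, mem_filter]
      refine and_congr_right fun _ => ⟨fun h => h p0 hp0 hl0, fun h p hp hl => ?_⟩
      rw [h, ha p hp hl]
    have hmemH : ∀ p ∈ hist, IsLab hit core w i p.1 → p.1 ∈ H := fun p hp hl => by
      rw [hH, List.mem_filter]
      exact ⟨List.mem_map_of_mem hp, by simpa using hl.1⟩
    have hAsub : (univ.filter fun s : Fin d => decide (s ∉ main p0.1) = p0.2) \ varying (H.map main)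
        ⊆ A := by
      intro s hs
      obtain ⟨h1, h2⟩ := mem_sdiff.1 hs
      rw [hAd, explain, mem_filter]
      refine ⟨mem_univ _, fun p hp hl => ?_⟩
      rw [ha p hp hl, ← (mem_filter.1 h1).2]
      have hiff : s ∈ main p.1 ↔ s ∈ main p0.1 := by
        by_contra hne
        refine h2 (symmDiff_subset_varying (List.mem_map_of_mem (f := main) (hmemH p hp hl))
          (List.mem_map_of_mem (f := main) (hmemH p0 hp0 hl0)) (mem_symmDiff.2 (by tauto)))
      simp only [hiff]
    have hne : H.isEmpty = false := by
      have := hmemH p0 hp0 hl0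
      cases hh : H with
      | nil => rw [hh] at this; simp at this
      | cons => rfl
    have hcost : regionCost main H = 1 + #(varying (H.map main)) := by
      rw [regionCost, hne]; rfl
    have hsz := hcore _ _ hl0.2
    have hklt : #{s : Fin d | (s : ℕ) < k} = k := card_filter_lt_eq d k (by omega)
    have hkge : #{s : Fin d | ¬ (s : ℕ) < k} = 15 * k := by
      have := card_filter_add_card_filter_not (s := (univ : Finset (Fin d))) (fun s => (s : ℕ) < k)
      rw [card_univ, Fintype.card_fin] at this
      omega
    have hmn : #{s : Fin d | s ∈ main p0.1} = #(main p0.1) := by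
      rw [filter_mem_eq_inter, univ_inter]
    have hmc : #{s : Fin d | s ∉ main p0.1} = d - #(main p0.1) := by
      have := card_filter_add_card_filter_not (s := (univ : Finset (Fin d))) (fun s => s ∈ main p0.1)
      rw [card_univ, Fintype.card_fin] at this
      omega
    -- On layer `15 * k` the two counts agree. On layer `15 * k + 1` there are only `k - 1` zeros
    -- instead of `k`; the summand 1 in `regionCost` pays for this.
    have hcards : #Y ≤ #(univ.filter fun s : Fin d => decide (s ∉ main p0.1) = p0.2) + 1 ∧
        k ≤ #Y := by
      rw [hYeq]
      cases hp : p0.2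
      · simp only [decide_eq_false_iff_not, not_not]
        rw [hkge, hmn]
        omega
      · simp only [decide_eq_true_eq]
        rw [hklt, hmc]
        omega
    have h1 : #Y ≤ #A + regionCost main H := by
      have := card_le_card hAsub
      have h2 := le_card_sdiff (varying (H.map main))
        (univ.filter fun s : Fin d => decide (s ∉ main p0.1) = p0.2)
      rw [hcost]
      omega
    have h1r : (#Y : ℝ) ≤ #A + regionCost main H := by exact_mod_cast h1
    have h2r : (k : ℝ) ≤ #Y := by exact_mod_cast hcards.2
    have hkr : (0 : ℝ) < k := by exact_mod_cast hk
    have h3 : (regionCost main H : ℝ) ≤ #Y * (regionCost main H / k) := by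
      rw [mul_div_assoc', le_div_iff₀ hkr, mul_comm]
      gcongr
    rw [mul_sub, mul_one]
    linarith
  · push Not at hno
    have hA : A = univ := by
      rw [hAd, explain, filter_true_of_mem]
      exact fun s _ p hp hl => absurd hl (hno p hp)
    have h1 : (#Y : ℝ) ≤ #A := by rw [hA]; exact_mod_cast card_le_card (subset_univ _)
    refine le_trans (mul_le_of_le_one_right (by positivity) ?_) h1
    have : (0 : ℝ) ≤ regionCost main H / k := by positivity
    linarith

open scoped Classical in
/-- The assignments to all regions for which `val` explains the answers in the history. -/
noncomputable def explainAll (val : Fin d → Z → Bool) (hist : List (Z × Bool)) :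
    Finset (Fin L → Fin d) :=
  univ.filter fun s => ∀ p ∈ hist, ∀ i, IsLab hit core w i p.1 → val (s i) p.1 = p.2

lemma explainAll_eq_piFinset (val : Fin d → Z → Bool) (hist : List (Z × Bool)) :
    explainAll hit core w val hist = Fintype.piFinset (explain hit core w val hist) := by
  classical
  ext s
  simp only [explainAll, explain, mem_filter, mem_univ, true_and, Fintype.mem_piFinset]
  exact ⟨fun h i p hp hl => h p hp i hl, fun h p hp i hl => h i p hp hl⟩

lemma explainAll_cons_of_lab (val : Fin d → Z → Bool) (hist : List (Z × Bool)) {z : Z} {i : Fin L}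
    (hi : IsLab hit core w i z) (b : Bool) :
    explainAll hit core w val ((z, b) :: hist)
      = (explainAll hit core w val hist).filter fun s => val (s i) z = b := by
  classical
  ext s
  simp only [explainAll, mem_filter, mem_univ, true_and, List.mem_cons, forall_eq_or_imp]
  constructor
  · exact fun h => ⟨h.2, h.1 i hi⟩
  · refine fun h => ⟨fun j hj => ?_, h.1⟩
    rw [hj.1.unique hi.1]
    exact h.2

lemma explainAll_cons_of_not_lab (val : Fin d → Z → Bool) (hist : List (Z × Bool)) {z : Z}
    (hz : ∀ i, ¬ IsLab hit core w i z) (b : Bool) :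
    explainAll hit core w val ((z, b) :: hist) = explainAll hit core w val hist := by
  classical
  ext s
  simp only [explainAll, mem_filter, mem_univ, true_and, List.mem_cons, forall_eq_or_imp]
  exact ⟨fun h => h.2, fun h => ⟨fun j hj => absurd hj (hz j), h⟩⟩

/-- The assignments of different regions are independent, so the explanations form a product set and
the ratios multiply. -/
lemma card_explainAll_ge {k : ℕ} (hk : 0 < k) (hd : d = 16 * k)
    (hcore : ∀ b z, core b z → #(main z) = 15 * k ∨ #(main z) = 15 * k + 1)
    (hist : List (Z × Bool)) :
    (#(explainAll hit core w (fun (s : Fin d) (_ : Z) => decide ((s : ℕ) < k)) hist) : ℝ) *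
      (1 - cost main hit w (hist.map Prod.fst) / k)
      ≤ #(explainAll hit core w (fun (s : Fin d) (z : Z) => decide (s ∉ main z)) hist) := by
  classical
  rw [explainAll_eq_piFinset, explainAll_eq_piFinset, Fintype.card_piFinset, Fintype.card_piFinset]
  push_cast
  by_cases hne : ∀ i, (explain hit core w (fun (s : Fin d) (_ : Z) => decide ((s : ℕ) < k)) hist i).Nonempty
  · have hpos : ∀ i, (0 : ℝ) < #(explain hit core w (fun (s : Fin d) (_ : Z) => decide ((s : ℕ) < k)) hist i) :=
      fun i => by exact_mod_cast card_pos.2 (hne i)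
    have h1 := one_sub_sum_le_prod (univ : Finset (Fin L))
      (fun i => (regionCost main ((hist.map Prod.fst).filter fun z => IsFirst hit w i z) : ℝ) / k)
      (fun i => (#(explain hit core w (fun (s : Fin d) (z : Z) => decide (s ∉ main z)) hist i) : ℝ) /
        #(explain hit core w (fun (s : Fin d) (_ : Z) => decide ((s : ℕ) < k)) hist i))
      (fun i _ => by positivity) (fun i _ => by positivity)
      (fun i _ => by
        rw [le_div_iff₀ (hpos i), mul_comm]
        exact card_explain_ge main hit core w hk hd hcore hist i (hne i))
    rw [prod_div_distrib, le_div_iff₀ (prod_pos fun i _ => hpos i), ← sum_div, mul_comm] at h1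
    have hc : (cost main hit w (hist.map Prod.fst) : ℝ)
        = ∑ i, (regionCost main ((hist.map Prod.fst).filter fun z => IsFirst hit w i z) : ℝ) := by
      unfold cost
      push_cast
      rfl
    rw [hc]
    exact h1
  · push Not at hne
    obtain ⟨i, hi⟩ := hne
    rw [prod_eq_zero (mem_univ i) (by simp [hi]), zero_mul]
    positivity

/-- For fixed regions, a decision tree does not distinguish constant values from antidictators
unless its queries to the same region vary in many coordinates. -/
lemma sum_const_le_sum_anti_aux {k : ℕ} (hk : 0 < k) (hd : d = 16 * k)
    (hcore : ∀ b z, core b z → #(main z) = 15 * k ∨ #(main z) = 15 * k + 1) (base : Z → Bool)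
    (T : DTree Z) (hist : List (Z × Bool)) :
    ∑ s ∈ explainAll hit core w (fun (s : Fin d) (_ : Z) => decide ((s : ℕ) < k)) hist,
      ((if T.eval (overlay hit core base w (constVal k s)) then (1 : ℝ) else 0) -
        cost main hit w (T.path (overlay hit core base w (constVal k s)) (hist.map Prod.fst)) / k)
      ≤ ∑ s ∈ explainAll hit core w (fun (s : Fin d) (z : Z) => decide (s ∉ main z)) hist,
        (if T.eval (overlay hit core base w (antiVal main s)) then (1 : ℝ) else 0) := by
  classical
  induction T generalizing hist with
  | leaf b =>
    cases b
    · simp only [DTree.eval, DTree.path, Bool.false_eq_true, if_false]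
      refine (sum_nonpos fun s _ => ?_).trans (sum_nonneg fun s _ => le_rfl)
      have : (0 : ℝ) ≤ cost main hit w (hist.map Prod.fst) / k := by positivity
      linarith
    -- At an accepting leaf both sums count explanations of the same transcript, and the cost is
    -- constant on it.
    · have h := card_explainAll_ge main hit core w hk hd hcore hist
      rw [← nsmul_eq_mul, ← sum_const, ← mul_one (#(explainAll hit core w
        (fun (s : Fin d) (z : Z) => decide (s ∉ main z)) hist) : ℝ), ← nsmul_eq_mul,
        ← sum_const] at h
      exact h
  | node z next ih =>
    by_cases hz : ∃ i, IsLab hit core w i z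
    · obtain ⟨i, hi⟩ := hz
      have h1 : ∀ s : Fin L → Fin d, overlay hit core base w (constVal k s) z
          = decide ((s i : ℕ) < k) := fun s => overlay_of_lab hi
      have h2 : ∀ s : Fin L → Fin d, overlay hit core base w (antiVal main s) z
          = decide (s i ∉ main z) := fun s => overlay_of_lab hi
      -- Grouping each family by the answer at `z` sends both to the same subtree, where the
      -- induction hypothesis applies with the extended history.
      rw [← sum_fiberwise _ (fun s : Fin L → Fin d => decide ((s i : ℕ) < k)),
        ← sum_fiberwise (explainAll hit core w (fun (s : Fin d) (z : Z) => decide (s ∉ main z)) hist)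
          (fun s : Fin L → Fin d => decide (s i ∉ main z))]
      refine sum_le_sum fun b _ => ?_
      have ih' := ih b ((z, b) :: hist)
      rw [explainAll_cons_of_lab _ _ _ _ _ hi, explainAll_cons_of_lab _ _ _ _ _ hi] at ih'
      refine le_trans (le_of_eq (sum_congr rfl fun s hs => ?_)) (ih'.trans (le_of_eq
        (sum_congr rfl fun s hs => ?_)))
      · have : overlay hit core base w (constVal k s) z = b := by
          rw [h1]; exact (mem_filter.1 hs).2
        simp only [DTree.eval, DTree.path, this, List.map_cons]
      · have : overlay hit core base w (antiVal main s) z = b := by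
          rw [h2]; exact (mem_filter.1 hs).2
        simp only [DTree.eval, this]
    · push Not at hz
      have ih' := ih (base z) ((z, base z) :: hist)
      rw [explainAll_cons_of_not_lab _ _ _ _ _ hz, explainAll_cons_of_not_lab _ _ _ _ _ hz] at ih'
      simpa only [DTree.eval, DTree.path, overlay_of_not_lab hz, List.map_cons] using ih'

lemma sum_const_le_sum_anti {k : ℕ} (hk : 0 < k) (hd : d = 16 * k)
    (hcore : ∀ b z, core b z → #(main z) = 15 * k ∨ #(main z) = 15 * k + 1) (base : Z → Bool)
    (T : DTree Z) :
    ∑ s : Fin L → Fin d,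
      ((if T.eval (overlay hit core base w (constVal k s)) then (1 : ℝ) else 0) -
        cost main hit w (T.path (overlay hit core base w (constVal k s)) []) / k)
      ≤ ∑ s : Fin L → Fin d,
        (if T.eval (overlay hit core base w (antiVal main s)) then (1 : ℝ) else 0) := by
  have h := sum_const_le_sum_anti_aux main hit core w hk hd hcore base T []
  have hu : ∀ val : Fin d → Z → Bool, explainAll hit core w val [] = univ := fun val => by
    classical
    simp [explainAll]
  simpa only [hu, List.map_nil] using h

end Likelihood

/-! ### Exponential moment of the cost of an adaptive algorithm -/

section Moment

variable {Z B : Type*} [Fintype B] {d L : ℕ}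

open scoped Classical in
/-- The sequences of regions for which a list of queries is distributed to the regions in a given
way. -/
noncomputable def splitSet (hit : B → Z → Prop) (acc : List Z) (h : Fin L → List Z) :
    Finset (Fin L → B) :=
  univ.filter fun w => ∀ i, (acc.filter fun z => IsFirst hit w i z) = h i

/-- Bound for the exponential moment of the cost of one region. -/
noncomputable def regionWeight (b v : ℝ) (H : List Z) : ℝ :=
  if H.isEmpty then b else v * 3 ^ H.length

/-- Growth of `regionWeight` when a query is added. -/
noncomputable def regionRatio (b v : ℝ) (H : List Z) : ℝ :=
  if H.isEmpty then 3 * v / b else 3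

lemma regionWeight_cons {b v : ℝ} (hb : b ≠ 0) (z : Z) (H : List Z) :
    regionWeight b v (z :: H) = regionRatio b v H * regionWeight b v H := by
  cases H with
  | nil => simp [regionWeight, regionRatio]; field_simp
  | cons y H => simp [regionWeight, regionRatio]; ring

lemma prod_regionWeight_update {b v : ℝ} (hb : b ≠ 0) (z : Z) (h : Fin L → List Z) (i : Fin L) :
    ∏ j, regionWeight b v (Function.update h i (z :: h i) j)
      = regionRatio b v (h i) * ∏ j, regionWeight b v (h j) := by
  rw [← mul_prod_erase univ _ (mem_univ i), ← mul_prod_erase univ (fun j => regionWeight b v (h j))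
    (mem_univ i), Function.update_self, regionWeight_cons hb, mul_assoc]
  congr 2
  refine prod_congr rfl fun j hj => ?_
  rw [Function.update_of_ne (ne_of_mem_erase hj)]

/-- Each touched region owns a query, and a query has only one first region. -/
lemma card_touched_le {hit : B → Z → Prop} {acc : List Z} {h : Fin L → List Z}
    (hS : (splitSet hit acc h).Nonempty) : #{i | ¬ (h i).isEmpty} ≤ acc.length := by
  classical
  obtain ⟨w, hw⟩ := hS
  have hw := (mem_filter.1 hw).2
  have hex : ∀ i, ¬ (h i).isEmpty → ∃ z ∈ acc, IsFirst hit w i z := by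
    intro i hi
    obtain ⟨z, hz⟩ := List.exists_mem_of_ne_nil (h i) (by simpa using hi)
    rw [← hw i, List.mem_filter] at hz
    exact ⟨z, hz.1, by simpa using hz.2⟩
  rcases isEmpty_or_nonempty Z with hZ | hZ
  · have : ∀ i, (h i).isEmpty := fun i => by
      cases h i with
      | nil => rfl
      | cons z _ => exact (hZ.false z).elim
    simp [this]
  choose! g hg using hex
  refine le_trans (card_le_card_of_injOn g (fun i hi => ?_) fun i hi j hj hij => ?_)
    (List.toFinset_card_le acc)
  · simpa using (hg i (by simpa using hi)).1
  · have h1 := (hg i (by simpa using hi)).2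
    rw [hij] at h1
    exact h1.unique (hg j (by simpa using hj)).2

/-- Opening one of the `L` regions costs `3 * v / b` each, in total at most `3 * θ`. Returning to a
touched region costs 3, and at most `M` regions are touched. -/
lemma sum_regionRatio_le {b v θ : ℝ} (hb : 0 < b) (hv : 0 ≤ v) (hθ : L * v ≤ θ * b)
    (h : Fin L → List Z) {M : ℕ} (hM : #{i | ¬ (h i).isEmpty} ≤ M) :
    ∑ i, regionRatio b v (h i) ≤ 3 * θ + 3 * M := by
  have h1 : ∀ i, regionRatio b v (h i) ≤ 3 * v / b + if ¬ (h i).isEmpty then 3 else 0 := by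
    intro i
    have : 0 ≤ 3 * v / b := by positivity
    unfold regionRatio
    split_ifs <;> simp_all
  refine (sum_le_sum fun i _ => h1 i).trans ?_
  rw [sum_add_distrib, ← sum_filter, sum_const, sum_const, card_univ, Fintype.card_fin,
    nsmul_eq_mul, nsmul_eq_mul]
  have h2 : (L : ℝ) * (3 * v / b) ≤ 3 * θ := by
    rw [mul_div_assoc', div_le_iff₀ hb]
    linarith
  have h3 : (#{i | ¬ (h i).isEmpty} : ℝ) ≤ M := by exact_mod_cast hM
  linarith

variable (main : Z → Finset (Fin d)) (hit : B → Z → Prop)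

lemma splitSet_subset_cons (z : Z) (acc : List Z) (h : Fin L → List Z) {w : Fin L → B}
    (hw : w ∈ splitSet hit acc h) : w ∈ splitSet hit (z :: acc) h ∨
      ∃ i, w ∈ splitSet hit (z :: acc) (Function.update h i (z :: h i)) := by
  classical
  have hw := (mem_filter.1 hw).2
  by_cases hz : ∃ i, IsFirst hit w i z
  · obtain ⟨i, hi⟩ := hz
    refine Or.inr ⟨i, mem_filter.2 ⟨mem_univ _, fun j => ?_⟩⟩
    by_cases hij : j = i
    · subst hij
      rw [Function.update_self, List.filter_cons_of_pos (by simpa using hi), hw]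
    · rw [Function.update_of_ne hij, List.filter_cons_of_neg, hw]
      simpa using fun h => hij (h.unique hi)
  · push Not at hz
    refine Or.inl (mem_filter.2 ⟨mem_univ _, fun j => ?_⟩)
    rw [List.filter_cons_of_neg (by simpa using hz j), hw]

open scoped Classical in
-- On `splitSet` the cost is determined by `h`. The regions are independent, and each must contain
-- all of the queries assigned to it, so the spread hypothesis applies region by region.
lemma sum_splitSet_exp_le {μ hc : ℝ}
    (hspread : ∀ H : List Z, H ≠ [] →
      (#{b : B | ∀ z ∈ H, hit b z} : ℝ) * Real.exp (μ * #(varying (H.map main)))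
        ≤ hc * 3 ^ H.length)
    (acc : List Z) (h : Fin L → List Z) :
    ∑ w ∈ splitSet hit acc h, Real.exp (μ * cost main hit w acc)
      ≤ ∏ i, regionWeight (Fintype.card B) (hc * Real.exp μ) (h i) := by
  have h1 : ∀ w ∈ splitSet hit acc h, Real.exp (μ * cost main hit w acc)
      = ∏ i, Real.exp (μ * regionCost main (h i)) := by
    intro w hw
    have hw := (mem_filter.1 hw).2
    unfold cost
    rw [← Real.exp_sum, Nat.cast_sum, mul_sum]
    congr 1
    refine sum_congr rfl fun i _ => ?_
    rw [← hw i]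
  rw [sum_congr rfl h1, sum_const, nsmul_eq_mul]
  have h2 : #(splitSet hit acc h) ≤ ∏ i, #{b : B | ∀ z ∈ h i, hit b z} := by
    rw [← Fintype.card_piFinset]
    refine card_le_card fun w hw => ?_
    have hw := (mem_filter.1 hw).2
    rw [Fintype.mem_piFinset]
    refine fun i => mem_filter.2 ⟨mem_univ _, fun z hz => ?_⟩
    rw [← hw i, List.mem_filter] at hz
    have := hz.2
    simp only [decide_eq_true_eq] at this
    exact this.1
  have h2r : (#(splitSet hit acc h) : ℝ) ≤ ∏ i, (#{b : B | ∀ z ∈ h i, hit b z} : ℝ) := by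
    exact_mod_cast h2
  refine (mul_le_mul_of_nonneg_right h2r (prod_nonneg fun _ _ => (Real.exp_pos _).le)).trans ?_
  rw [← prod_mul_distrib]
  refine prod_le_prod (fun i _ => by positivity) fun i _ => ?_
  unfold regionWeight regionCost
  cases hi : h i with
  | nil => simp
  | cons z H =>
    have := hspread (z :: H) (by simp)
    simp only [List.isEmpty_cons, Bool.false_eq_true, if_false]
    push_cast
    rw [mul_add, mul_one, Real.exp_add]
    have he := Real.exp_pos μ
    nlinarith [mul_le_mul_of_nonneg_left this he.le]

/-- Exponential moment of the cost of the queries that a decision tree makes, over random regions,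
when the function may depend on the regions arbitrarily. -/
lemma sum_splitSet_path_le [Nonempty B] {μ hc θ : ℝ} (hhc : 0 ≤ hc)
    (hθ : L * (hc * Real.exp μ) ≤ θ * Fintype.card B)
    (hspread : ∀ H : List Z, H ≠ [] → ∀ S : Finset B, (∀ b ∈ S, ∀ z ∈ H, hit b z) →
      (#S : ℝ) * Real.exp (μ * #(varying (H.map main))) ≤ hc * 3 ^ H.length)
    (F : (Fin L → B) → Z → Bool) (M : ℕ) (T : DTree Z) (acc : List Z) (h : Fin L → List Z)
    (hT : T.depth + acc.length ≤ M) :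
    ∑ w ∈ splitSet hit acc h, Real.exp (μ * cost main hit w (T.path (F w) acc))
      ≤ (2 * (1 + 3 * θ + 3 * M)) ^ T.depth *
        ∏ i, regionWeight (Fintype.card B) (hc * Real.exp μ) (h i) := by
  classical
  -- Price of one query: 2 for the possible answers, 1 when no region contains the point, and `3 * θ
  -- + 3 * M` for the choice of its first region. Summing over both answers is what allows `F` to
  -- depend on `w`.
  set K : ℝ := 2 * (1 + 3 * θ + 3 * M) with hK
  have hB : (0 : ℝ) < Fintype.card B := by exact_mod_cast Fintype.card_pos
  have hv : 0 ≤ hc * Real.exp μ := mul_nonneg hhc (Real.exp_pos _).le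
  have hθ0 : 0 ≤ θ := by
    have : 0 ≤ θ * Fintype.card B := le_trans (by positivity) hθ
    exact nonneg_of_mul_nonneg_left this hB
  have hMr : (0 : ℝ) ≤ M := by positivity
  have hK1 : 1 ≤ K := by linarith
  have hW : ∀ h : Fin L → List Z,
      0 ≤ ∏ i, regionWeight (Fintype.card B) (hc * Real.exp μ) (h i) := fun h =>
    prod_nonneg fun i _ => by unfold regionWeight; split_ifs <;> positivity
  induction T generalizing acc h with
  | leaf b =>
    simp only [DTree.path, DTree.depth, pow_zero, one_mul]
    exact sum_splitSet_exp_le main hit (fun H hH => hspread H hH _ (by simp)) acc h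
  | node z next ih =>
    rcases (splitSet hit acc h).eq_empty_or_nonempty with hS | hS
    · rw [hS, sum_empty]
      exact mul_nonneg (by positivity) (hW h)
    have htouch := card_touched_le hS
    set W := ∏ i, regionWeight (Fintype.card B) (hc * Real.exp μ) (h i) with hWd
    set g : Bool → (Fin L → B) → ℝ := fun b w =>
      Real.exp (μ * cost main hit w ((next b).path (F w) (z :: acc))) with hg
    have hg0 : ∀ b w, 0 ≤ g b w := fun b w => (Real.exp_pos _).le
    have hb : ∀ b, ∑ w ∈ splitSet hit acc h, g b w
        ≤ K ^ (next b).depth * (1 + 3 * θ + 3 * M) * W := by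
      intro b
      have hd : (next b).depth + (z :: acc).length ≤ M := by
        have := DTree.depth_next_lt z next b
        simp only [List.length_cons]
        omega
      have hsub : ∑ w ∈ splitSet hit acc h, g b w ≤ ∑ w ∈ splitSet hit (z :: acc) h, g b w +
          ∑ i, ∑ w ∈ splitSet hit (z :: acc) (Function.update h i (z :: h i)), g b w := by
        have e1 : ∀ t : Finset (Fin L → B), ∑ w ∈ t, g b w = ∑ w, if w ∈ t then g b w else 0 :=
          fun t => by rw [sum_ite_mem, univ_inter]
        simp only [e1]
        rw [sum_comm, ← sum_add_distrib]
        refine sum_le_sum fun w _ => ?_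
        have e2 : ∀ t : Finset (Fin L → B), 0 ≤ if w ∈ t then g b w else 0 := fun t => by
          split_ifs
          · exact hg0 b w
          · exact le_rfl
        by_cases hw : w ∈ splitSet hit acc h
        · rw [if_pos hw]
          rcases splitSet_subset_cons hit z acc h hw with h1 | ⟨i, h1⟩
          · rw [if_pos h1]
            exact le_add_of_nonneg_right (sum_nonneg fun i _ => e2 _)
          · refine le_add_of_nonneg_of_le (e2 _) ?_
            refine le_trans (le_of_eq (if_pos h1).symm) (single_le_sum (f := fun i => if w ∈
              splitSet hit (z :: acc) (Function.update h i (z :: h i)) then g b w else 0)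
              (fun i _ => e2 _) (mem_univ i))
        · rw [if_neg hw]
          exact add_nonneg (e2 _) (sum_nonneg fun i _ => e2 _)
      refine hsub.trans ?_
      have h1 := ih b (z :: acc) h hd
      have h2 : ∀ i, ∑ w ∈ splitSet hit (z :: acc) (Function.update h i (z :: h i)), g b w
          ≤ K ^ (next b).depth *
            (regionRatio (Fintype.card B) (hc * Real.exp μ) (h i) * W) := fun i => by
        rw [hWd, ← prod_regionWeight_update hB.ne']
        exact ih b (z :: acc) _ hd
      refine (add_le_add h1 (sum_le_sum fun i _ => h2 i)).trans ?_
      rw [← mul_sum, ← sum_mul]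
      have h3 := sum_regionRatio_le hB hv hθ h (M := M) (htouch.trans (by omega))
      have h4 : 0 ≤ K ^ (next b).depth * W := mul_nonneg (by positivity) (hW h)
      nlinarith [mul_le_mul_of_nonneg_left h3 h4]
    have hpow : ∀ b, K ^ (next b).depth * K ≤ K ^ (DTree.node z next).depth := fun b => by
      rw [← pow_succ]
      exact pow_le_pow_right₀ hK1 (DTree.depth_next_lt z next b)
    have hsplit : ∑ w ∈ splitSet hit acc h,
        Real.exp (μ * cost main hit w ((DTree.node z next).path (F w) acc))
        ≤ ∑ w ∈ splitSet hit acc h, (g true w + g false w) := by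
      refine sum_le_sum fun w _ => ?_
      simp only [DTree.path]
      cases F w z
      · exact le_add_of_nonneg_left (hg0 _ _)
      · exact le_add_of_nonneg_right (hg0 _ _)
    refine hsplit.trans ?_
    rw [sum_add_distrib]
    have hh : ∀ b, K ^ (next b).depth * (1 + 3 * θ + 3 * M) * W
        ≤ K ^ (DTree.node z next).depth * W / 2 := fun b => by
      have := mul_le_mul_of_nonneg_right (hpow b) (hW h)
      rw [hK] at this ⊢
      linarith
    have := (hb true).trans (hh true)
    have := (hb false).trans (hh false)
    linarith

lemma sum_exp_path_le [Nonempty B] {μ hc θ : ℝ} (hhc : 0 ≤ hc)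
    (hθ : L * (hc * Real.exp μ) ≤ θ * Fintype.card B)
    (hspread : ∀ H : List Z, H ≠ [] → ∀ S : Finset B, (∀ b ∈ S, ∀ z ∈ H, hit b z) →
      (#S : ℝ) * Real.exp (μ * #(varying (H.map main))) ≤ hc * 3 ^ H.length)
    (F : (Fin L → B) → Z → Bool) (T : DTree Z) {M : ℕ} (hT : T.depth ≤ M) :
    ∑ w, Real.exp (μ * cost main hit w (T.path (F w) []))
      ≤ (2 * (1 + 3 * θ + 3 * M)) ^ T.depth * (Fintype.card B : ℝ) ^ L := by
  classical
  have h := sum_splitSet_path_le main hit hhc hθ hspread F M T [] (fun _ => []) (by simpa using hT)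
  have hu : splitSet (L := L) hit [] (fun _ => []) = univ := by
    simp [splitSet]
  rw [hu] at h
  simpa [regionWeight] using h

/-- Expected cost of the queries of a decision tree. -/
lemma sum_cost_path_le [Nonempty B] {μ hc θ : ℝ} (hμ : 0 < μ) (hhc : 0 ≤ hc)
    (hθ : L * (hc * Real.exp μ) ≤ θ * Fintype.card B)
    (hspread : ∀ H : List Z, H ≠ [] → ∀ S : Finset B, (∀ b ∈ S, ∀ z ∈ H, hit b z) →
      (#S : ℝ) * Real.exp (μ * #(varying (H.map main))) ≤ hc * 3 ^ H.length)
    (F : (Fin L → B) → Z → Bool) (T : DTree Z) {M : ℕ} (hT : T.depth ≤ M) :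
    ∑ w, (cost main hit w (T.path (F w) []) : ℝ)
      ≤ (Fintype.card B : ℝ) ^ L * ((M * Real.log (2 * (1 + 3 * θ + 3 * M)) + 1) / μ) := by
  classical
  have h := sum_exp_path_le main hit hhc hθ hspread F T hT
  set K : ℝ := 2 * (1 + 3 * θ + 3 * M) with hK
  have hB : (0 : ℝ) < Fintype.card B := by exact_mod_cast Fintype.card_pos
  have hθ0 : 0 ≤ θ := by
    have : 0 ≤ θ * Fintype.card B :=
      le_trans (mul_nonneg (by positivity) (mul_nonneg hhc (Real.exp_pos _).le)) hθ
    exact nonneg_of_mul_nonneg_left this hB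
  have hMr : (0 : ℝ) ≤ M := by positivity
  have hK1 : 1 ≤ K := by linarith
  -- This is `x ≤ t + exp (x - t)` at `t = M * log K`, in place of Jensen's inequality.
  have h1 : ∀ w, μ * (cost main hit w (T.path (F w) []) : ℝ) ≤ M * Real.log K +
      Real.exp (μ * cost main hit w (T.path (F w) [])) / K ^ M := by
    intro w
    set x := μ * (cost main hit w (T.path (F w) []) : ℝ)
    have e1 := Real.add_one_le_exp (x - M * Real.log K)
    rw [Real.exp_sub, ← Real.log_pow, Real.exp_log (by positivity), Real.log_pow] at e1
    linarith
  have h2 := sum_le_sum fun (w : Fin L → B) (_ : w ∈ univ) => h1 w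
  rw [← mul_sum, sum_add_distrib, sum_const, card_univ, ← sum_div, Fintype.card_fun,
    Fintype.card_fin, nsmul_eq_mul] at h2
  have h3 : (∑ w, Real.exp (μ * cost main hit w (T.path (F w) []))) / K ^ M
      ≤ (Fintype.card B : ℝ) ^ L := by
    rw [div_le_iff₀ (by positivity), mul_comm]
    exact h.trans (mul_le_mul_of_nonneg_right (pow_le_pow_right₀ hK1 hT) (by positivity))
  rw [mul_div_assoc', le_div_iff₀ hμ]
  push_cast at h2
  linarith

end Moment

/-! ### Removing the randomness and the samples of an algorithm -/

section Derandomize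

variable {n : ℕ}

/-- Probability that a deterministic algorithm answers "yes". -/
noncomputable def Alg.acc (f : BoolFn n) : Alg n → ℝ
  | .answer b => if b then 1 else 0
  | .query x next => (next (f x)).acc f
  | .samp next => (∑ x ∈ ones f, (next x).acc f) / #(ones f)

lemma Alg.acc_nonneg (f : BoolFn n) (t : Alg n) : 0 ≤ t.acc f := by
  induction t with
  | answer b => unfold Alg.acc; split_ifs <;> norm_num
  | query x next ih => exact ih (f x)
  | samp next ih => exact div_nonneg (sum_nonneg fun x _ => ih x) (by positivity)

lemma Alg.acc_le_one (f : BoolFn n) (t : Alg n) : t.acc f ≤ 1 := by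
  induction t with
  | answer b => unfold Alg.acc; split_ifs <;> norm_num
  | query x next ih => exact ih (f x)
  | samp next ih =>
    refine div_le_one_of_le₀ ?_ (by positivity)
    exact (sum_le_sum fun x _ => ih x).trans (by simp)

lemma Alg.run_true (f : BoolFn n) (hf : (ones f).Nonempty) (t : Alg n) :
    t.run f hf true = ENNReal.ofReal (t.acc f) := by
  induction t with
  | answer b => cases b <;> simp [Alg.run, Alg.acc]
  | query x next ih => exact ih (f x)
  | samp next ih =>
    have hpos : (0 : ℝ) < #(ones f) := by exact_mod_cast hf.card_pos
    simp only [Alg.run, Alg.acc, PMF.bind_apply, ih, PMF.uniformOfFinset_apply]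
    rw [tsum_eq_sum (s := ones f) (fun x hx => by simp [hx]),
      ENNReal.ofReal_div_of_pos hpos, ENNReal.ofReal_sum_of_nonneg fun x _ => acc_nonneg f _,
      div_eq_mul_inv, sum_mul]
    refine sum_congr rfl fun x hx => ?_
    rw [if_pos hx, mul_comm, ENNReal.ofReal_natCast]

/-- A statement about all deterministic algorithms in the support passes to the mixture. -/
lemma RandAlg.sum_run_le {ι : Type*} [Fintype ι] (A : RandAlg n) (f g : ι → BoolFn n)
    (hf : ∀ i, (ones (f i)).Nonempty) (hg : ∀ i, (ones (g i)).Nonempty) {δ : ℝ} (hδ : 0 ≤ δ)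
    (h : ∀ t ∈ PMF.support A, ∑ i, t.acc (f i) ≤ ∑ i, t.acc (g i) + δ) :
    ∑ i, (A.run (f i) (hf i) true).toReal ≤ ∑ i, (A.run (g i) (hg i) true).toReal + δ := by
  have key : ∀ (f : ι → BoolFn n) (hf : ∀ i, (ones (f i)).Nonempty),
      ∑ i, A.run (f i) (hf i) true = ∑' t, A t * ENNReal.ofReal (∑ i, t.acc (f i)) := by
    intro f hf
    simp only [RandAlg.run, PMF.bind_apply, Alg.run_true]
    rw [← Summable.tsum_finsetSum fun i _ => ENNReal.summable]
    refine tsum_congr fun t => ?_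
    rw [← mul_sum, ENNReal.ofReal_sum_of_nonneg fun i _ => Alg.acc_nonneg _ _]
  have h1 : ∑ i, A.run (f i) (hf i) true ≤ ∑ i, A.run (g i) (hg i) true + ENNReal.ofReal δ := by
    rw [key f hf, key g hg]
    have h2 : ENNReal.ofReal δ = ∑' t, A t * ENNReal.ofReal δ := by
      rw [ENNReal.tsum_mul_right, A.tsum_coe, one_mul]
    rw [h2, ← ENNReal.tsum_add]
    refine ENNReal.tsum_le_tsum fun t => ?_
    by_cases ht : t ∈ PMF.support A
    · rw [← mul_add, ← ENNReal.ofReal_add (sum_nonneg fun i _ => Alg.acc_nonneg _ _) hδ]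
      gcongr
      exact h t ht
    · have : A t = 0 := by simpa [PMF.mem_support_iff] using ht
      simp [this]
  have hfin : ∀ (f : BoolFn n) (hf : (ones f).Nonempty), A.run f hf true ≠ ⊤ := fun f hf =>
    PMF.apply_ne_top _ _
  rw [← ENNReal.toReal_sum fun i _ => hfin _ _, ← ENNReal.toReal_sum fun i _ => hfin _ _]
  have h3 := ENNReal.toReal_mono (by
    refine ENNReal.add_ne_top.2 ⟨ENNReal.sum_ne_top.2 fun i _ => hfin _ _, ENNReal.ofReal_ne_top⟩) h1
  rwa [ENNReal.toReal_add (ENNReal.sum_ne_top.2 fun i _ => hfin _ _) ENNReal.ofReal_ne_top,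
    ENNReal.toReal_ofReal hδ] at h3

/-- Indicator of the answer of a decision tree. -/
def DTree.val {Z : Type*} (f : Z → Bool) (T : DTree Z) : ℝ := if T.eval f then 1 else 0

lemma DTree.sum_val_node {Z ι : Type*} (F : ι → Z → Bool) (S : Finset ι) (w : ι → ℝ) (z : Z)
    (next : Bool → DTree Z) :
    ∑ i ∈ S, w i * (DTree.node z next).val (F i)
      = ∑ i ∈ S with F i z = true, w i * (next true).val (F i) +
        ∑ i ∈ S with ¬ F i z = true, w i * (next false).val (F i) := by
  rw [← sum_filter_add_sum_filter_not S fun i => F i z = true]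
  congr 1
  · refine sum_congr rfl fun i hi => ?_
    simp only [DTree.val, DTree.eval, (mem_filter.1 hi).2]
  · refine sum_congr rfl fun i hi => ?_
    have : F i z = false := by simpa using (mem_filter.1 hi).2
    simp only [DTree.val, DTree.eval, this]

/-- For a finite family of functions, an algorithm can be replaced by a decision tree without
samples: a sample is simulated by trying random points of a superset of similar size, and the
random points are then fixed in the best way. -/
lemma Alg.exists_dtree {ι : Type*} (F : ι → BoolFn n) (U : Finset (Fin n → Bool)) {ρ : ℝ}
    (hρ1 : ρ ≤ 1) {τ : ℕ} (hτ : 1 ≤ τ) (w : ι → ℝ) (t : Alg n) (S : Finset ι) (q : ℕ)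
    (hne : ∀ i ∈ S, (ones (F i)).Nonempty) (hU : ∀ i ∈ S, ones (F i) ⊆ U)
    (hρ : ∀ i ∈ S, ρ * #U ≤ #(ones (F i))) (hq : ∀ i ∈ S, t.calls (F i) ≤ q) :
    ∃ T : DTree (Fin n → Bool), T.depth ≤ q * τ ∧
      ∑ i ∈ S, w i * t.acc (F i)
        ≤ ∑ i ∈ S, w i * T.val (F i) + q * (1 - ρ) ^ τ * ∑ i ∈ S, |w i| := by
  have hρ0 : 0 ≤ 1 - ρ := by linarith
  have habs : ∀ S : Finset ι, 0 ≤ ∑ i ∈ S, |w i| := fun S => sum_nonneg fun i _ => abs_nonneg _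
  induction t generalizing S q with
  | answer b =>
    refine ⟨.leaf b, by simp [DTree.depth], ?_⟩
    have : 0 ≤ q * (1 - ρ) ^ τ * ∑ i ∈ S, |w i| := mul_nonneg (by positivity) (habs S)
    simp only [Alg.acc, DTree.val, DTree.eval]
    exact le_add_of_nonneg_right this
  | query x next ih =>
    rcases S.eq_empty_or_nonempty with rfl | ⟨i0, hi0⟩
    · exact ⟨.leaf true, by simp [DTree.depth], by simp⟩
    obtain ⟨q, rfl⟩ : ∃ q', q = q' + 1 := by
      have := hq i0 hi0
      simp only [Alg.calls] at this
      exact ⟨q - 1, by omega⟩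
    obtain ⟨T1, hT1, h1⟩ := ih true (S.filter fun i => F i x = true) q
      (fun i hi => hne i (mem_filter.1 hi).1) (fun i hi => hU i (mem_filter.1 hi).1)
      (fun i hi => hρ i (mem_filter.1 hi).1) (fun i hi => by
        have := hq i (mem_filter.1 hi).1
        simp only [Alg.calls, (mem_filter.1 hi).2] at this
        omega)
    obtain ⟨T0, hT0, h0⟩ := ih false (S.filter fun i => ¬ F i x = true) q
      (fun i hi => hne i (mem_filter.1 hi).1) (fun i hi => hU i (mem_filter.1 hi).1)
      (fun i hi => hρ i (mem_filter.1 hi).1) (fun i hi => by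
        have := hq i (mem_filter.1 hi).1
        have hf : F i x = false := by simpa using (mem_filter.1 hi).2
        simp only [Alg.calls, hf] at this
        omega)
    refine ⟨.node x fun b => if b then T1 else T0, ?_, ?_⟩
    · simp only [DTree.depth, if_true, Bool.false_eq_true, if_false]
      have : max T1.depth T0.depth ≤ q * τ := max_le hT1 hT0
      rw [add_mul]
      omega
    · rw [DTree.sum_val_node]
      simp only [if_true, Bool.false_eq_true, if_false]
      have hsplit : ∑ i ∈ S, w i * (Alg.query x next).acc (F i)
          = ∑ i ∈ S with F i x = true, w i * (next true).acc (F i) +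
            ∑ i ∈ S with ¬ F i x = true, w i * (next false).acc (F i) := by
        rw [← sum_filter_add_sum_filter_not S fun i => F i x = true]
        congr 1
        · refine sum_congr rfl fun i hi => ?_
          simp only [Alg.acc, (mem_filter.1 hi).2]
        · refine sum_congr rfl fun i hi => ?_
          have : F i x = false := by simpa using (mem_filter.1 hi).2
          simp only [Alg.acc, this]
      rw [hsplit, ← sum_filter_add_sum_filter_not S (fun i => F i x = true) (fun i => |w i|)]
      have e1 : 0 ≤ (1 - ρ) ^ τ * ∑ i ∈ S with F i x = true, |w i| :=
        mul_nonneg (by positivity) (habs _)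
      have e0 : 0 ≤ (1 - ρ) ^ τ * ∑ i ∈ S with ¬ F i x = true, |w i| :=
        mul_nonneg (by positivity) (habs _)
      push_cast
      linarith
  | samp next ih =>
    rcases S.eq_empty_or_nonempty with rfl | ⟨i0, hi0⟩
    · exact ⟨.leaf true, by simp [DTree.depth], by simp⟩
    obtain ⟨q, rfl⟩ : ∃ q', q = q' + 1 := by
      have := hq i0 hi0
      simp only [Alg.calls] at this
      exact ⟨q - 1, by omega⟩
    have hUne : U.Nonempty := (hne i0 hi0).mono (hU i0 hi0)
    have hUpos : (0 : ℝ) < #U := by exact_mod_cast hUne.card_pos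
    have hcalls : ∀ i ∈ S, ∀ x, F i x = true → (next x).calls (F i) ≤ q := by
      intro i hi x hx
      have h1 := hq i hi
      simp only [Alg.calls] at h1
      have h2 := le_sup (f := fun x => (next x).calls (F i)) (s := ones (F i)) (b := x)
        (by simpa [ones] using hx)
      omega
    -- `j` is the number of trials left in the simulation of this sample. A trial succeeds with
    -- probability at least `ρ` for each function of the family.
    have inner : ∀ (j : ℕ) (S' : Finset ι), S' ⊆ S →
        ∃ T : DTree (Fin n → Bool), T.depth ≤ q * τ + j ∧
          ∑ i ∈ S', w i * (Alg.samp next).acc (F i)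
            ≤ ∑ i ∈ S', w i * T.val (F i)
              + (q * (1 - ρ) ^ τ + (1 - ρ) ^ j) * ∑ i ∈ S', |w i| := by
      intro j
      induction j with
      | zero =>
        intro S' _
        -- With no trials left any answer will do; the loss is covered by the coefficient `(1 - ρ) ^
        -- 0 = 1`.
        refine ⟨.leaf false, by simp [DTree.depth], ?_⟩
        have h1 : ∑ i ∈ S', w i * (Alg.samp next).acc (F i) ≤ ∑ i ∈ S', |w i| := by
          refine sum_le_sum fun i _ => ?_
          calc _ ≤ |w i * (Alg.samp next).acc (F i)| := le_abs_self _
            _ = |w i| * (Alg.samp next).acc (F i) := by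
                rw [abs_mul, abs_of_nonneg (Alg.acc_nonneg _ _)]
            _ ≤ |w i| := mul_le_of_le_one_right (abs_nonneg _) (Alg.acc_le_one _ _)
        have h2 : 0 ≤ q * (1 - ρ) ^ τ * ∑ i ∈ S', |w i| := mul_nonneg (by positivity) (habs _)
        simp only [DTree.val, DTree.eval, Bool.false_eq_true, if_false, mul_zero, sum_const_zero,
          pow_zero]
        linarith
      | succ j ihj =>
        intro S' hS'
        have hx : ∀ x, ∃ T : DTree (Fin n → Bool), T.depth ≤ q * τ + (j + 1) ∧
            ∑ i ∈ S', w i * (if F i x = true then (next x).acc (F i) else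
              (Alg.samp next).acc (F i))
            ≤ ∑ i ∈ S', w i * T.val (F i) + q * (1 - ρ) ^ τ * ∑ i ∈ S', |w i|
              + (1 - ρ) ^ j * ∑ i ∈ S' with ¬ F i x = true, |w i| := by
          intro x
          obtain ⟨T1, hT1, h1⟩ := ih x (S'.filter fun i => F i x = true) q
            (fun i hi => hne i (hS' (mem_filter.1 hi).1))
            (fun i hi => hU i (hS' (mem_filter.1 hi).1))
            (fun i hi => hρ i (hS' (mem_filter.1 hi).1))
            (fun i hi => hcalls i (hS' (mem_filter.1 hi).1) x (mem_filter.1 hi).2)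
          obtain ⟨T0, hT0, h0⟩ := ihj (S'.filter fun i => ¬ F i x = true)
            ((filter_subset _ _).trans hS')
          refine ⟨.node x fun b => if b then T1 else T0, ?_, ?_⟩
          · simp only [DTree.depth, if_true, Bool.false_eq_true, if_false]
            have : max T1.depth T0.depth ≤ q * τ + j := max_le (by omega) hT0
            omega
          · rw [DTree.sum_val_node]
            simp only [if_true, Bool.false_eq_true, if_false]
            have hsplit : ∑ i ∈ S', w i * (if F i x = true then (next x).acc (F i) else
                (Alg.samp next).acc (F i))
                = ∑ i ∈ S' with F i x = true, w i * (next x).acc (F i) +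
                  ∑ i ∈ S' with ¬ F i x = true, w i * (Alg.samp next).acc (F i) := by
              rw [← sum_filter_add_sum_filter_not S' fun i => F i x = true]
              congr 1
              · exact sum_congr rfl fun i hi => by rw [if_pos (mem_filter.1 hi).2]
              · exact sum_congr rfl fun i hi => by rw [if_neg (mem_filter.1 hi).2]
            rw [hsplit, ← sum_filter_add_sum_filter_not S' (fun i => F i x = true)
              (fun i => |w i|)]
            linarith
        choose T hT hTs using hx
        -- A uniform point of `U` accepted by the function is a uniform sample, and a rejected point
        -- leaves the task unchanged.
        have havg : ∀ i ∈ S', (#U : ℝ) * (Alg.samp next).acc (F i)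
            = ∑ x ∈ U, if F i x = true then (next x).acc (F i) else
              (Alg.samp next).acc (F i) := by
          intro i hi
          have hpos : (0 : ℝ) < #(ones (F i)) := by exact_mod_cast (hne i (hS' hi)).card_pos
          have hfil : (U.filter fun x => F i x = true) = ones (F i) := by
            ext x
            simp only [mem_filter, ones, mem_univ, true_and, and_iff_right_iff_imp]
            intro hx
            exact hU i (hS' hi) (by simpa [ones] using hx)
          have hcard := card_filter_add_card_filter_not (s := U) (fun x => F i x = true)
          rw [hfil] at hcard
          have hcr : (#(ones (F i)) : ℝ) + #(U.filter fun x => ¬ F i x = true) = #U := by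
            exact_mod_cast hcard
          rw [sum_ite, hfil, sum_const, nsmul_eq_mul, ← hcr, add_mul]
          congr 1
          simp only [Alg.acc]
          field_simp
        have hneg : ∑ x ∈ U, ∑ i ∈ S' with ¬ F i x = true, |w i|
            ≤ #U * ((1 - ρ) * ∑ i ∈ S', |w i|) := by
          simp only [sum_filter]
          rw [sum_comm, mul_sum, mul_sum]
          refine sum_le_sum fun i hi => ?_
          rw [← sum_filter, sum_const, nsmul_eq_mul]
          have hfil : (U.filter fun x => F i x = true) = ones (F i) := by
            ext x
            simp only [mem_filter, ones, mem_univ, true_and, and_iff_right_iff_imp]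
            intro hx
            exact hU i (hS' hi) (by simpa [ones] using hx)
          have hcard := card_filter_add_card_filter_not (s := U) (fun x => F i x = true)
          rw [hfil] at hcard
          have hcr : (#(ones (F i)) : ℝ) + #(U.filter fun x => ¬ F i x = true) = #U := by
            exact_mod_cast hcard
          rw [← mul_assoc]
          refine mul_le_mul_of_nonneg_right ?_ (abs_nonneg _)
          have := hρ i (hS' hi)
          linarith
        have hsum : ∑ x ∈ U, ∑ i ∈ S', w i * (Alg.samp next).acc (F i)
            ≤ ∑ x ∈ U, (∑ i ∈ S', w i * (T x).val (F i)
              + (q * (1 - ρ) ^ τ + (1 - ρ) ^ (j + 1)) * ∑ i ∈ S', |w i|) := by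
          calc ∑ x ∈ U, ∑ i ∈ S', w i * (Alg.samp next).acc (F i)
              = ∑ i ∈ S', w i * (#U * (Alg.samp next).acc (F i)) := by
                rw [sum_const, nsmul_eq_mul, mul_sum]
                exact sum_congr rfl fun i _ => by ring
            _ = ∑ x ∈ U, ∑ i ∈ S', w i * (if F i x = true then (next x).acc (F i) else
                  (Alg.samp next).acc (F i)) := by
                rw [sum_comm]
                exact sum_congr rfl fun i hi => by rw [havg i hi, mul_sum]
            _ ≤ ∑ x ∈ U, (∑ i ∈ S', w i * (T x).val (F i)
                  + q * (1 - ρ) ^ τ * ∑ i ∈ S', |w i|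
                  + (1 - ρ) ^ j * ∑ i ∈ S' with ¬ F i x = true, |w i|) :=
                sum_le_sum fun x _ => hTs x
            _ ≤ _ := by
                rw [sum_add_distrib, ← mul_sum]
                have h1 := mul_le_mul_of_nonneg_left hneg (pow_nonneg hρ0 j)
                have h2 : ∑ x ∈ U, (∑ i ∈ S', w i * (T x).val (F i)
                    + (q * (1 - ρ) ^ τ + (1 - ρ) ^ (j + 1)) * ∑ i ∈ S', |w i|)
                    = ∑ x ∈ U, (∑ i ∈ S', w i * (T x).val (F i)
                      + q * (1 - ρ) ^ τ * ∑ i ∈ S', |w i|)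
                      + (1 - ρ) ^ j * (#U * ((1 - ρ) * ∑ i ∈ S', |w i|)) := by
                  have : (1 - ρ) ^ j * (#U * ((1 - ρ) * ∑ i ∈ S', |w i|))
                      = ∑ x ∈ U, (1 - ρ) ^ (j + 1) * ∑ i ∈ S', |w i| := by
                    rw [sum_const, nsmul_eq_mul]; ring
                  rw [this, ← sum_add_distrib]
                  exact sum_congr rfl fun x _ => by ring
                rw [h2]
                linarith
        -- The random trial point is fixed to one that is at least as good as the average, for the
        -- whole weighted family at once.
        obtain ⟨x, _, hx⟩ := exists_le_of_sum_le hUne hsum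
        exact ⟨T x, hT x, hx⟩
    obtain ⟨T, hT, h⟩ := inner τ S subset_rfl
    refine ⟨T, by rw [add_mul, one_mul]; exact hT, h.trans (le_of_eq ?_)⟩
    push_cast
    ring

end Derandomize

/-! ### Main, selector, free and constant coordinates -/

section Coordinates

variable {n : ℕ}

/-- The coordinate with index `i`, where the coordinates beyond the dimension are 1. -/
def bit (z : Fin n → Bool) (i : ℕ) : Bool := if h : i < n then z ⟨i, h⟩ else true

/-- The support of a point on the first `d` coordinates. -/
def mainSet (d : ℕ) (z : Fin n → Bool) : Finset (Fin d) := univ.filter fun i => bit z i = true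

/-- All coordinates after the first `m` are 1. -/
def TailOne (m : ℕ) (z : Fin n → Bool) : Prop := ∀ i, m ≤ i → bit z i = true

/-- The point with given main coordinates `x`, selector bit `b` and free coordinates `p`, and ones
after that. -/
def point (n : ℕ) {d φ : ℕ} (x : Finset (Fin d)) (b : Bool) (p : Fin φ → Bool) : Fin n → Bool :=
  fun i => if h : (i : ℕ) < d then decide ((⟨i, h⟩ : Fin d) ∈ x) else
    if (i : ℕ) = d then b else
      if h : (i : ℕ) - d - 1 < φ then p ⟨i - d - 1, h⟩ else true

variable {d φ : ℕ}

lemma bit_point (h : d + 1 + φ ≤ n) (x : Finset (Fin d)) (b : Bool) (p : Fin φ → Bool) (i : ℕ) :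
    bit (point n x b p) i = if h : i < d then decide ((⟨i, h⟩ : Fin d) ∈ x) else
      if i = d then b else if h : i - d - 1 < φ then p ⟨i - d - 1, h⟩ else true := by
  unfold bit point
  by_cases hi : i < n
  · simp [hi]
  · have h1 : ¬ i < d := by omega
    have h2 : ¬ i = d := by omega
    have h3 : ¬ i - d - 1 < φ := by omega
    simp [hi, h1, h2, h3]

lemma mainSet_point (h : d + 1 + φ ≤ n) (x : Finset (Fin d)) (b : Bool) (p : Fin φ → Bool) :
    mainSet d (point n x b p) = x := by
  ext i
  simp [mainSet, bit_point h]

lemma bit_point_self (h : d + 1 + φ ≤ n) (x : Finset (Fin d)) (b : Bool) (p : Fin φ → Bool) :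
    bit (point n x b p) d = b := by
  simp [bit_point h]

lemma tailOne_point (h : d + 1 + φ ≤ n) (x : Finset (Fin d)) (b : Bool) (p : Fin φ → Bool) :
    TailOne (d + 1 + φ) (point n x b p) := by
  intro i hi
  have h1 : ¬ i < d := by omega
  have h2 : ¬ i = d := by omega
  have h3 : ¬ i - d - 1 < φ := by omega
  simp [bit_point h, h1, h2, h3]

lemma point_injective (h : d + 1 + φ ≤ n) {x x' : Finset (Fin d)} {b b' : Bool}
    {p p' : Fin φ → Bool} (he : point n x b p = point n x' b' p') : x = x' ∧ b = b' ∧ p = p' := by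
  refine ⟨?_, ?_, ?_⟩
  · rw [← mainSet_point h x b p, he, mainSet_point h]
  · rw [← bit_point_self h x b p, he, bit_point_self h]
  · ext i
    have h1 := congrArg (fun z => bit z (d + 1 + i)) he
    have h2 : ¬ d + 1 + (i : ℕ) < d := by omega
    have h3 : ¬ d + 1 + (i : ℕ) = d := by omega
    have h4 : d + 1 + (i : ℕ) - d - 1 = i := by omega
    simpa [bit_point h, h2, h3, h4] using h1

lemma exists_point {z : Fin n → Bool} (hz : TailOne (d + 1 + φ) z) :
    ∃ p : Fin φ → Bool, z = point n (mainSet d z) (bit z d) p := by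
  refine ⟨fun j => bit z (d + 1 + j), ?_⟩
  ext i
  have hb : z i = bit z i := by simp [bit]
  unfold point
  split_ifs with h1 h2 h3
  · simp [mainSet, hb]
  · rw [hb, h2]
  · rw [hb]
    congr 1
    simp only
    omega
  · rw [hb]
    exact hz i (by omega)

open scoped Classical in
lemma card_tailOne (h : d + 1 + φ ≤ n) (P : Finset (Fin d) → Bool → Prop) :
    #{z : Fin n → Bool | TailOne (d + 1 + φ) z ∧ P (mainSet d z) (bit z d)}
      = 2 ^ φ * #{y : Finset (Fin d) × Bool | P y.1 y.2} := by
  have h1 : #(({y : Finset (Fin d) × Bool | P y.1 y.2} : Finset _) ×ˢ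
      (univ : Finset (Fin φ → Bool)))
      = #{z : Fin n → Bool | TailOne (d + 1 + φ) z ∧ P (mainSet d z) (bit z d)} := by
    refine card_bij (fun y _ => point n y.1.1 y.1.2 y.2) ?_ ?_ ?_
    · intro y hy
      have := (mem_filter.1 (mem_product.1 hy).1).2
      simp only [mem_filter, mem_univ, true_and, mainSet_point h, bit_point_self h]
      exact ⟨tailOne_point h _ _ _, this⟩
    · rintro ⟨⟨x, b⟩, p⟩ _ ⟨⟨x', b'⟩, p'⟩ _ he
      obtain ⟨rfl, rfl, rfl⟩ := point_injective h he
      rfl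
    · intro z hz
      obtain ⟨hz1, hz2⟩ := (mem_filter.1 hz).2
      obtain ⟨p, hp⟩ := exists_point hz1
      exact ⟨((mainSet d z, bit z d), p), by simp [hz2], hp.symm⟩
  rw [← h1, card_product, card_univ, Fintype.card_fun, Fintype.card_bool, Fintype.card_fin,
    mul_comm]

lemma bit_mono {z z' : Fin n → Bool} (h : z ≤ z') {i : ℕ} (hi : bit z i = true) :
    bit z' i = true := by
  unfold bit at *
  split_ifs at * with h1
  · have := h ⟨i, h1⟩
    rw [hi] at this
    exact top_le_iff.1 this
  · rfl

lemma mainSet_mono {z z' : Fin n → Bool} (h : z ≤ z') : mainSet d z ⊆ mainSet d z' := by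
  intro i hi
  simp only [mainSet, mem_filter, mem_univ, true_and] at *
  exact bit_mono h hi

lemma update_point (h : d + 1 + φ ≤ n) {x : Finset (Fin d)} (b : Bool) (p : Fin φ → Bool)
    (l : Fin d) : Function.update (point n x b p) ⟨l, by omega⟩ true = point n (insert l x) b p := by
  ext i
  by_cases hi : i = ⟨l, by omega⟩
  · subst hi
    simp [point]
  · rw [Function.update_of_ne hi]
    unfold point
    by_cases h1 : (i : ℕ) < d
    · have : (⟨i, h1⟩ : Fin d) ≠ l := fun he => hi (by
        subst he
        rfl)
      simp [h1, this]
    · simp [h1]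

end Coordinates

/-! ### The hard functions and the monotonicity of the yes instances -/

section Functions

variable {n d φ L : ℕ} {B : Type*}

/-- The points whose value may depend on the regions. -/
def Relevant (d φ r : ℕ) (z : Fin n → Bool) : Prop :=
  TailOne (d + 1 + φ) z ∧ bit z d = true ∧ (#(mainSet d z) = r ∨ #(mainSet d z) = r + 1)

open scoped Classical in
/-- The function without any region. -/
noncomputable def baseFn (n d φ r : ℕ) : BoolFn n := fun z =>
  decide (TailOne (d + 1 + φ) z ∧
    (r + 2 ≤ #(mainSet d z) ∨ (bit z d = true ∧ r + 1 ≤ #(mainSet d z))))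

/-- Regions of the main cube as regions of the whole cube. -/
def lift (φ r : ℕ) (P : B → Finset (Fin d) → Prop) (b : B) (z : Fin n → Bool) : Prop :=
  Relevant d φ r z ∧ P b (mainSet d z)

/-- The hard functions. -/
noncomputable def hardFn (n φ r : ℕ) (hit core : B → Finset (Fin d) → Prop) (w : Fin L → B)
    (h : Fin L → (Fin n → Bool) → Bool) : BoolFn n :=
  overlay (lift φ r hit) (lift φ r core) (baseFn n d φ r) w h

lemma isFirst_lift {r : ℕ} {P : B → Finset (Fin d) → Prop} {w : Fin L → B} {i : Fin L}
    {z : Fin n → Bool} (hz : Relevant d φ r z) :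
    IsFirst (lift φ r P) w i z ↔ IsFirst P w i (mainSet d z) := by
  simp [IsFirst, lift, hz]

lemma isLab_lift {r : ℕ} {hit core : B → Finset (Fin d) → Prop} {w : Fin L → B} {i : Fin L}
    {z : Fin n → Bool} (hz : Relevant d φ r z) :
    IsLab (lift φ r hit) (lift φ r core) w i z ↔ IsLab hit core w i (mainSet d z) := by
  simp [IsLab, isFirst_lift hz, lift, hz]

lemma IsLab.relevant {r : ℕ} {hit core : B → Finset (Fin d) → Prop} {w : Fin L → B} {i : Fin L}
    {z : Fin n → Bool} (h : IsLab (lift φ r hit) (lift φ r core) w i z) : Relevant d φ r z := h.2.1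

variable {hit core : B → Finset (Fin d) → Prop}

lemma hardFn_of_not_relevant {r : ℕ} {w : Fin L → B} {h : Fin L → (Fin n → Bool) → Bool}
    {z : Fin n → Bool} (hz : ¬ Relevant d φ r z) :
    hardFn n φ r hit core w h z = baseFn n d φ r z :=
  overlay_of_not_lab fun _ hi => hz hi.relevant

lemma baseFn_eq_true {r : ℕ} {z : Fin n → Bool} : baseFn n d φ r z = true ↔
    TailOne (d + 1 + φ) z ∧
      (r + 2 ≤ #(mainSet d z) ∨ (bit z d = true ∧ r + 1 ≤ #(mainSet d z))) := by
  classical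
  simp [baseFn]

lemma hardFn_true_imp {r : ℕ} {w : Fin L → B} {h : Fin L → (Fin n → Bool) → Bool}
    {z : Fin n → Bool} (hz : hardFn n φ r hit core w h z = true) :
    TailOne (d + 1 + φ) z ∧ r ≤ #(mainSet d z) ∧ (bit z d = true ∨ r + 2 ≤ #(mainSet d z)) := by
  by_cases hr : Relevant d φ r z
  · exact ⟨hr.1, by have := hr.2.2; omega, Or.inl hr.2.1⟩
  · rw [hardFn_of_not_relevant hr, baseFn_eq_true] at hz
    exact ⟨hz.1, by omega, by tauto⟩

lemma hardFn_of_large {r : ℕ} {w : Fin L → B} {h : Fin L → (Fin n → Bool) → Bool}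
    {z : Fin n → Bool} (h1 : TailOne (d + 1 + φ) z) (h2 : r + 2 ≤ #(mainSet d z)) :
    hardFn n φ r hit core w h z = true := by
  rw [hardFn_of_not_relevant (fun h => by have := h.2.2; omega), baseFn_eq_true]
  exact ⟨h1, Or.inl h2⟩

/-- An interior point of a region has its neighbours in the region, so of two different labels the
smaller one would also claim the other point first. -/
lemma IsLab.eq_of_adjacent (h1 : ∀ b x i, i ∉ x → core b x → hit b (insert i x))
    (h2 : ∀ b x i, i ∉ x → core b (insert i x) → hit b x) {w : Fin L → B} {i j : Fin L}
    {x : Finset (Fin d)} {l : Fin d} (hl : l ∉ x) (hi : IsLab hit core w i x)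
    (hj : IsLab hit core w j (insert l x)) : i = j := by
  rcases lt_trichotomy i j with h | h | h
  · exact absurd (h1 _ _ _ hl hi.2) (hj.1.2 i h)
  · exact h
  · exact absurd (h2 _ _ _ hl hj.2) (hi.1.2 j h)

/-- Only comparable points with selector 1 in the two random layers matter. Unlabelled points have
value 0 on the lower layer and 1 on the upper one, which never conflicts with a neighbour, and
labelled neighbours share their constant. -/
lemma hardFn_constVal_monotone (h1 : ∀ b x i, i ∉ x → core b x → hit b (insert i x))
    (h2 : ∀ b x i, i ∉ x → core b (insert i x) → hit b x) (r k : ℕ) (w : Fin L → B)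
    (s : Fin L → Fin d) : Monotone (hardFn n φ r hit core w (constVal k s)) := by
  intro z z' hzz
  rw [Bool.le_iff_imp]
  intro hz
  obtain ⟨ht, hr, hb⟩ := hardFn_true_imp hz
  have ht' : TailOne (d + 1 + φ) z' := fun i hi => bit_mono hzz (ht i hi)
  have hsub : mainSet d z ⊆ mainSet d z' := mainSet_mono hzz
  have hcard := card_le_card hsub
  by_cases hlarge : r + 2 ≤ #(mainSet d z')
  · exact hardFn_of_large ht' hlarge
  have hb1 : bit z d = true := hb.resolve_right (by omega)
  have hrel : Relevant d φ r z := ⟨ht, hb1, by omega⟩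
  have hrel' : Relevant d φ r z' := ⟨ht', bit_mono hzz hb1, by omega⟩
  by_cases hlab' : ∃ j, IsLab (lift φ r hit) (lift φ r core) w j z'
  · obtain ⟨j, hj⟩ := hlab'
    -- Equal main parts mean that the points differ in free coordinates only, and then they have the
    -- same label.
    by_cases heq : mainSet d z = mainSet d z'
    · have hi : IsLab (lift φ r hit) (lift φ r core) w j z := by
        rw [isLab_lift hrel, heq, ← isLab_lift hrel']
        exact hj
      rw [hardFn, overlay_of_lab hi] at hz
      rw [hardFn, overlay_of_lab hj]
      exact hz
    · have hlt := card_lt_card (hsub.ssubset_of_ne heq)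
      have hc : #(mainSet d z) = r := by omega
      have hlab : ∃ i, IsLab (lift φ r hit) (lift φ r core) w i z := by
        by_contra hno
        push Not at hno
        rw [hardFn, overlay_of_not_lab hno, baseFn_eq_true] at hz
        omega
      obtain ⟨i, hi⟩ := hlab
      obtain ⟨l, hl, hins⟩ : ∃ l, l ∉ mainSet d z ∧ insert l (mainSet d z) = mainSet d z' := by
        have hsd : #(mainSet d z' \ mainSet d z) = 1 := by
          rw [card_sdiff_of_subset hsub]
          omega
        obtain ⟨l, hl⟩ := card_eq_one.1 hsd
        have hmem : l ∈ mainSet d z' \ mainSet d z := by rw [hl]; exact mem_singleton_self l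
        refine ⟨l, (mem_sdiff.1 hmem).2, ?_⟩
        rw [insert_eq, ← hl, sdiff_union_of_subset hsub]
      have hij : i = j := by
        refine IsLab.eq_of_adjacent h1 h2 (w := w) hl ((isLab_lift hrel).1 hi) ?_
        rw [hins]
        exact (isLab_lift hrel').1 hj
      subst hij
      rw [hardFn, overlay_of_lab hi] at hz
      rw [hardFn, overlay_of_lab hj]
      exact hz
  · push Not at hlab'
    rw [hardFn, overlay_of_not_lab hlab', baseFn_eq_true]
    refine ⟨ht', Or.inr ⟨hrel'.2.1, ?_⟩⟩
    by_contra hlow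
    have hc : #(mainSet d z') = r := by omega
    have heq : mainSet d z = mainSet d z' := eq_of_subset_of_card_le hsub (by omega)
    have hno : ∀ j, ¬ IsLab (lift φ r hit) (lift φ r core) w j z := fun j hj => hlab' j (by
      rw [isLab_lift hrel', ← heq, ← isLab_lift hrel]
      exact hj)
    rw [hardFn, overlay_of_not_lab hno, baseFn_eq_true] at hz
    omega

end Functions

/-! ### Binomial estimates and the number of satisfying assignments -/

section Layers

/-- Points of the cube with at least `j` ones. -/
def upper (d j : ℕ) : Finset (Finset (Fin d)) := univ.filter fun x => j ≤ #x

lemma card_layer (d j : ℕ) : #{x : Finset (Fin d) | #x = j} = d.choose j := by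
  rw [← powerset_univ, ← powersetCard_eq_filter, card_powersetCard, card_univ, Fintype.card_fin]

lemma card_upper_succ (d j : ℕ) : #(upper d j) = d.choose j + #(upper d (j + 1)) := by
  rw [← card_layer d j, ← card_union_of_disjoint]
  · congr 1
    ext x
    simp only [upper, mem_union, mem_filter, mem_univ, true_and]
    omega
  · rw [disjoint_left]
    intro x h1 h2
    simp only [upper, mem_filter, mem_univ, true_and] at h1 h2
    omega

lemma mul_choose_succ_le_mul_choose {d j a b : ℕ} (h : a * (d - j) ≤ b * (j + 1)) :
    a * d.choose (j + 1) ≤ b * d.choose j := by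
  have h1 := Nat.choose_succ_right_eq d j
  refine le_of_mul_le_mul_right ?_ (show 0 < j + 1 by omega)
  calc a * d.choose (j + 1) * (j + 1) = d.choose j * (a * (d - j)) := by
        rw [mul_assoc, h1]; ring
    _ ≤ d.choose j * (b * (j + 1)) := by gcongr
    _ = _ := by ring

lemma mul_choose_le_mul_choose_succ {d j a b : ℕ} (h : b * (j + 1) ≤ a * (d - j)) :
    b * d.choose j ≤ a * d.choose (j + 1) := by
  have h1 := Nat.choose_succ_right_eq d j
  refine le_of_mul_le_mul_right ?_ (show 0 < j + 1 by omega)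
  calc b * d.choose j * (j + 1) = d.choose j * (b * (j + 1)) := by ring
    _ ≤ d.choose j * (a * (d - j)) := by gcongr
    _ = a * d.choose (j + 1) * (j + 1) := by rw [mul_assoc, h1]; ring

/-- Above two thirds of the height each layer is at most half of the previous one, so the sizes are
dominated by a geometric series. -/
lemma card_upper_le {d j : ℕ} (h : 2 * d ≤ 3 * j) : #(upper d j) ≤ 2 * d.choose j := by
  by_cases hj : d < j
  · have : upper d j = ∅ := by
      rw [upper, filter_eq_empty_iff]
      intro x _
      have := card_le_univ x
      rw [Fintype.card_fin] at this
      omega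
    simp [this]
  · have ih := card_upper_le (d := d) (j := j + 1) (by omega)
    have h2 := mul_choose_succ_le_mul_choose (d := d) (j := j) (a := 2) (b := 1) (by omega)
    rw [card_upper_succ]
    omega
termination_by d + 1 - j

variable {k : ℕ}

lemma choose_le_sixteen (hk : 1 ≤ k) :
    (16 * k).choose (15 * k) ≤ 16 * (16 * k).choose (15 * k + 1) := by
  simpa using mul_choose_le_mul_choose_succ (d := 16 * k) (j := 15 * k) (a := 16) (b := 1) (by omega)

lemma choose_succ_le (hk : 2 ≤ k) :
    (16 * k).choose (15 * k + 1) ≤ 32 * (16 * k).choose (15 * k + 2) := by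
  simpa using mul_choose_le_mul_choose_succ (d := 16 * k) (j := 15 * k + 1) (a := 32) (b := 1) (by omega)

/-- The right side counts the edges in one fixed direction between the layers `15 * k + 1` and `15 *
k + 2`. The exact ratio is `16 * k / (k - 1)`, whence `2 ≤ k`. -/
lemma choose_le_pred (hk : 2 ≤ k) :
    (16 * k).choose (15 * k + 1) ≤ 32 * (16 * k - 1).choose (15 * k + 1) := by
  have h := Nat.choose_mul_succ_eq (16 * k - 1) (15 * k + 1)
  have e1 : 16 * k - 1 + 1 = 16 * k := by omega
  have e2 : 16 * k - (15 * k + 1) = k - 1 := by omega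
  rw [e1, e2] at h
  refine le_of_mul_le_mul_right ?_ (show 0 < k - 1 by omega)
  rw [← h, mul_assoc, mul_comm ((16 * k - 1).choose _), ← mul_assoc, mul_comm, mul_comm _ (_ - 1)]
  calc _ = (16 * k - 1).choose (15 * k + 1) * (16 * k) := by ring
    _ ≤ (16 * k - 1).choose (15 * k + 1) * (32 * (k - 1)) := Nat.mul_le_mul_left _ (by omega)
    _ = _ := by ring

end Layers

section Size

variable {n d φ L : ℕ} {B : Type*} {hit core : B → Finset (Fin d) → Prop}

open scoped Classical in
/-- A superset of the preimage of 1 of the hard functions. -/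
noncomputable def hardSupport (n d φ r : ℕ) : Finset (Fin n → Bool) :=
  univ.filter fun z => TailOne (d + 1 + φ) z ∧ r ≤ #(mainSet d z)

lemma card_hardSupport (h : d + 1 + φ ≤ n) (r : ℕ) :
    #(hardSupport n d φ r) = 2 ^ φ * (2 * #(upper d r)) := by
  classical
  have hc : #(hardSupport n d φ r)
      = 2 ^ φ * #{y : Finset (Fin d) × Bool | r ≤ #y.1} := by
    rw [hardSupport]
    convert card_tailOne h fun x _ => r ≤ #x
  have e : 2 * #(upper d r) = #(upper d r ×ˢ (univ : Finset Bool)) := by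
    rw [card_product, card_univ, Fintype.card_bool, mul_comm]
  rw [hc, e]
  congr 2
  ext y
  simp [upper]

lemma ones_hardFn_subset (r : ℕ) (w : Fin L → B) (h : Fin L → (Fin n → Bool) → Bool) :
    ones (hardFn n φ r hit core w h) ⊆ hardSupport n d φ r := by
  classical
  intro z hz
  have := hardFn_true_imp (mem_filter.1 hz).2
  exact mem_filter.2 ⟨mem_univ _, this.1, this.2.1⟩

lemma hardSupport_subset_ones (r : ℕ) (w : Fin L → B) (h : Fin L → (Fin n → Bool) → Bool) :
    hardSupport n d φ (r + 2) ⊆ ones (hardFn n φ r hit core w h) := by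
  classical
  intro z hz
  have := (mem_filter.1 hz).2
  exact mem_filter.2 ⟨mem_univ _, hardFn_of_large this.1 this.2⟩

/-- All hard functions lie between these two sets, so this one bound gives both the sparsity promise
and the success rate of rejection sampling. The constant is `2 * 16 * 32`. -/
lemma card_hardSupport_le {k : ℕ} (hk : 2 ≤ k) (h : 16 * k + 1 + φ ≤ n) :
    #(hardSupport n (16 * k) φ (15 * k)) ≤ 1024 * #(hardSupport n (16 * k) φ (15 * k + 2)) := by
  rw [card_hardSupport h, card_hardSupport h]
  have h1 := card_upper_le (d := 16 * k) (j := 15 * k) (by omega)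
  have h2 := choose_le_sixteen (k := k) (by omega)
  have h3 := choose_succ_le hk
  have h4 := card_upper_succ (16 * k) (15 * k + 2)
  calc 2 ^ φ * (2 * #(upper (16 * k) (15 * k)))
      ≤ 2 ^ φ * (1024 * (2 * #(upper (16 * k) (15 * k + 2)))) := Nat.mul_le_mul_left _ (by omega)
    _ = _ := by ring

end Size

/-! ### The no instances are far from unate -/

section Far

variable {n : ℕ}

/-- A unate function is monotone or antimonotone in each coordinate. -/
lemma unate_update {g : BoolFn n} {a : Fin n → Bool}
    (ha : Monotone fun x : Fin n → Bool => g fun i => xor (x i) (a i)) {z : Fin n → Bool}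
    {i : Fin n} (hz : z i = false) :
    (a i = false → (g z = true → g (Function.update z i true) = true)) ∧
      (a i = true → (g (Function.update z i true) = true → g z = true)) := by
  have hx : ∀ y : Fin n → Bool, (fun j => xor (xor (y j) (a j)) (a j)) = y := fun y => by
    ext j; simp
  constructor
  · intro hai hg
    have hle : (fun j => xor (z j) (a j)) ≤ fun j => xor (Function.update z i true j) (a j) := by
      intro j
      by_cases hj : j = i
      · subst hj; simp [hz, hai]
      · simp [Function.update_of_ne hj]
    have := ha hle
    simp only [hx] at this
    rw [hg] at this
    exact top_le_iff.1 this
  · intro hai hg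
    have hle : (fun j => xor (Function.update z i true j) (a j)) ≤ fun j => xor (z j) (a j) := by
      intro j
      by_cases hj : j = i
      · subst hj; simp [hz, hai]
      · simp [Function.update_of_ne hj]
    have := ha hle
    simp only [hx] at this
    rw [hg] at this
    exact top_le_iff.1 this

/-- Disjoint pairs on which `f` and `g` cannot agree. -/
lemma card_le_card_symmDiff {ι : Type*} [Fintype ι] {f g : BoolFn n} (u v : ι → Fin n → Bool)
    (hu : Function.Injective u) (hv : Function.Injective v) (huv : ∀ i j, u i ≠ v j)
    (hf : ∀ i, f (u i) = true ∧ f (v i) = false) (hg : ∀ i, g (u i) = true → g (v i) = true) :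
    Fintype.card ι ≤ #(symmDiff (ones f) (ones g)) := by
  classical
  rw [← card_univ]
  refine card_le_card_of_injOn (fun i => if g (u i) = true then v i else u i) ?_ ?_
  · intro i _
    simp only [coe_symmDiff, Set.mem_symmDiff, mem_coe, ones, mem_filter, mem_univ, true_and]
    by_cases h : g (u i) = true
    · rw [if_pos h]
      right
      simp [hg i h, (hf i).2]
    · rw [if_neg h]
      left
      exact ⟨(hf i).1, h⟩
  · intro i _ j _ hij
    simp only at hij
    split_ifs at hij
    · exact hv hij
    · exact absurd hij.symm (huv _ _)
    · exact absurd hij (huv _ _)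
    · exact hu hij

lemma le_relDistTo {f : BoolFn n} {P : Set (BoolFn n)} {ε : ℝ} (hne : P.Nonempty)
    (hf : (ones f).Nonempty)
    (h : ∀ g ∈ P, ε * #(ones f) ≤ #(symmDiff (ones f) (ones g))) : ε ≤ relDistTo f P := by
  have : Nonempty P := hne.to_subtype
  refine le_ciInf fun g => ?_
  have hpos : (0 : ℝ) < #(ones f) := by exact_mod_cast hf.card_pos
  rw [relDist, le_div_iff₀ hpos]
  exact h g.1 g.2

lemma monotoneClass_subset_unateClass (n : ℕ) : monotoneClass n ⊆ unateClass n := by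
  intro f hf
  have hf' : Monotone f := hf
  refine ⟨fun _ => false, ?_⟩
  simpa using hf'

variable {d φ L : ℕ} {B : Type*} {hit core : B → Finset (Fin d) → Prop}

/-- Points of the upper layer at which an antidictator violates monotonicity. -/
def Violated (hit core : B → Finset (Fin d) → Prop) (w : Fin L → B) (s : Fin L → Fin d)
    (y : Finset (Fin d)) : Prop :=
  ∃ i, IsLab hit core w i y ∧ s i ∈ y ∧ ∃ j, IsLab hit core w j (y.erase (s i))

open scoped Classical in
-- Since `g` increases in every main direction, it disagrees with the antidictator at an end of each
-- violated edge, for every setting of the free coordinates. These edges are disjoint.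
lemma card_violated_le_symmDiff (h1 : ∀ b x i, i ∉ x → core b x → hit b (insert i x))
    (h2 : ∀ b x i, i ∉ x → core b (insert i x) → hit b x) (hn : d + 1 + φ ≤ n) (r : ℕ)
    (w : Fin L → B) (s : Fin L → Fin d) {g : BoolFn n} {a : Fin n → Bool}
    (ha : Monotone fun x : Fin n → Bool => g fun i => xor (x i) (a i))
    (ha0 : ∀ l : Fin d, a ⟨l, by omega⟩ = false) :
    2 ^ φ * #{y : Finset (Fin d) | #y = r + 1 ∧ Violated hit core w s y}
      ≤ #(symmDiff (ones (hardFn n φ r hit core w (antiVal (mainSet d) s))) (ones g)) := by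
  have hex : ∀ y : {y : Finset (Fin d) // #y = r + 1 ∧ Violated hit core w s y}, ∃ i,
      IsLab hit core w i y.1 ∧ s i ∈ y.1 ∧ IsLab hit core w i (y.1.erase (s i)) := by
    rintro ⟨y, hy, i, hi, hs, j, hj⟩
    refine ⟨i, hi, hs, ?_⟩
    have : j = i := IsLab.eq_of_adjacent h1 h2 (notMem_erase (s i) y) hj (by rwa [insert_erase hs])
    rwa [this] at hj
  choose i hi hs he using hex
  have hcard : Fintype.card ({y : Finset (Fin d) // #y = r + 1 ∧ Violated hit core w s y} ×
      (Fin φ → Bool)) = 2 ^ φ * #{y : Finset (Fin d) | #y = r + 1 ∧ Violated hit core w s y} := by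
    rw [Fintype.card_prod, Fintype.card_subtype, Fintype.card_fun, Fintype.card_bool,
      Fintype.card_fin, mul_comm]
  rw [← hcard]
  have hce : ∀ y : {y : Finset (Fin d) // #y = r + 1 ∧ Violated hit core w s y},
      #(y.1.erase (s (i y))) = r := fun y => by
    rw [card_erase_of_mem (hs y), y.2.1]; rfl
  have hrelu : ∀ (y : {y : Finset (Fin d) // #y = r + 1 ∧ Violated hit core w s y})
      (p : Fin φ → Bool), Relevant d φ r (point n (y.1.erase (s (i y))) true p) := fun y p =>
    ⟨tailOne_point hn _ _ _, bit_point_self hn _ _ _, by rw [mainSet_point hn, hce]; simp⟩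
  have hrelv : ∀ (y : {y : Finset (Fin d) // #y = r + 1 ∧ Violated hit core w s y})
      (p : Fin φ → Bool), Relevant d φ r (point n y.1 true p) := fun y p =>
    ⟨tailOne_point hn _ _ _, bit_point_self hn _ _ _, by rw [mainSet_point hn, y.2.1]; simp⟩
  refine card_le_card_symmDiff (fun yp => point n (yp.1.1.erase (s (i yp.1))) true yp.2)
    (fun yp => point n yp.1.1 true yp.2) ?_ ?_ ?_ ?_ ?_
  · rintro ⟨y, p⟩ ⟨y', p'⟩ h
    obtain ⟨e1, _, rfl⟩ := point_injective hn h
    simp only at e1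
    -- The label of the lower end determines the direction of the edge, hence its upper end.
    have hii : i y = i y' := by
      have := he y
      rw [e1] at this
      exact this.1.unique (he y').1
    have : y.1 = y'.1 := by
      rw [← insert_erase (hs y), e1, hii, insert_erase (hs y')]
    rw [Subtype.ext this]
  · rintro ⟨y, p⟩ ⟨y', p'⟩ h
    obtain ⟨e1, _, rfl⟩ := point_injective hn h
    exact congrArg (·, p) (Subtype.ext e1)
  · rintro ⟨y, p⟩ ⟨y', p'⟩ h
    obtain ⟨e1, _, _⟩ := point_injective hn h
    have h3 := hce y
    simp only at e1
    rw [e1, y'.2.1] at h3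
    omega
  · rintro ⟨y, p⟩
    constructor
    · rw [hardFn, overlay_of_lab ((isLab_lift (hrelu y p)).2 (by rw [mainSet_point hn]; exact he y))]
      simp [antiVal, mainSet_point hn]
    · rw [hardFn, overlay_of_lab ((isLab_lift (hrelv y p)).2 (by rw [mainSet_point hn]; exact hi y))]
      simp [antiVal, mainSet_point hn, hs y]
  · rintro ⟨y, p⟩ hg
    have hb : point n (y.1.erase (s (i y))) true p ⟨s (i y), by omega⟩ = false := by
      simp [point]
    have := (unate_update ha hb).1 (ha0 _) hg
    rwa [update_point hn, insert_erase (hs y)] at this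

/-- Where the selector is 0 every hard function is the threshold at `r + 2`. It increases along all
edges of direction `l` between the layers `r + 1` and `r + 2`, while `g` does not increase in that
direction. -/
lemma card_slice_le_symmDiff (hn : d + 1 + φ ≤ n) (r : ℕ) (w : Fin L → B)
    (h : Fin L → (Fin n → Bool) → Bool) {g : BoolFn n} {a : Fin n → Bool}
    (ha : Monotone fun x : Fin n → Bool => g fun i => xor (x i) (a i))
    {l : Fin d} (hal : a ⟨l, by omega⟩ = true) :
    2 ^ φ * (d - 1).choose (r + 1)
      ≤ #(symmDiff (ones (hardFn n φ r hit core w h)) (ones g)) := by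
  have hcard : Fintype.card (↥(powersetCard (r + 1) ((univ : Finset (Fin d)).erase l)) ×
      (Fin φ → Bool)) = 2 ^ φ * (d - 1).choose (r + 1) := by
    rw [Fintype.card_prod, Fintype.card_coe, card_powersetCard, card_erase_of_mem (mem_univ l),
      card_univ, Fintype.card_fun, Fintype.card_bool, Fintype.card_fin, Fintype.card_fin, mul_comm]
  rw [← hcard]
  have hx : ∀ x : ↥(powersetCard (r + 1) ((univ : Finset (Fin d)).erase l)),
      l ∉ x.1 ∧ #x.1 = r + 1 := fun x => by
    obtain ⟨e1, e2⟩ := mem_powersetCard.1 x.2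
    exact ⟨fun hl => (mem_erase.1 (e1 hl)).1 rfl, e2⟩
  refine card_le_card_symmDiff (fun xp => point n (insert l xp.1.1) false xp.2)
    (fun xp => point n xp.1.1 false xp.2) ?_ ?_ ?_ ?_ ?_
  · rintro ⟨x, p⟩ ⟨x', p'⟩ h
    obtain ⟨e1, _, rfl⟩ := point_injective hn h
    have : x.1 = x'.1 := by
      rw [← erase_insert (hx x).1, e1, erase_insert (hx x').1]
    rw [Subtype.ext this]
  · rintro ⟨x, p⟩ ⟨x', p'⟩ h
    obtain ⟨e1, _, rfl⟩ := point_injective hn h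
    exact congrArg (·, p) (Subtype.ext e1)
  · rintro ⟨x, p⟩ ⟨x', p'⟩ h
    obtain ⟨e1, _, _⟩ := point_injective hn h
    exact (hx x').1 (e1 ▸ mem_insert_self l x.1)
  · rintro ⟨x, p⟩
    constructor
    · refine hardFn_of_large (tailOne_point hn _ _ _) ?_
      rw [mainSet_point hn, card_insert_of_notMem (hx x).1, (hx x).2]
    · rw [← Bool.not_eq_true]
      intro ht
      have := (hardFn_true_imp ht).2.2
      rw [bit_point_self hn, mainSet_point hn, (hx x).2] at this
      simp at this
  · rintro ⟨x, p⟩ hg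
    have hb : point n x.1 false p ⟨l, by omega⟩ = false := by
      simp [point, (hx x).1]
    refine (unate_update ha hb).2 hal ?_
    rwa [update_point hn]

end Far

open scoped Classical in
/-- If many points are violated, then the function with antidictators is far from unate. -/
lemma le_relDistTo_hardFn {n k φ L : ℕ} {B : Type*} {hit core : B → Finset (Fin (16 * k)) → Prop}
    (h1 : ∀ b x i, i ∉ x → core b x → hit b (insert i x))
    (h2 : ∀ b x i, i ∉ x → core b (insert i x) → hit b x) (hk : 2 ≤ k)
    (hn : 16 * k + 1 + φ ≤ n) (w : Fin L → B) (s : Fin L → Fin (16 * k))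
    (hD : (16 * k).choose (15 * k + 1)
      ≤ 2 * #{y : Finset (Fin (16 * k)) | #y = 15 * k + 1 ∧ Violated hit core w s y})
    {P : Set (BoolFn n)} (hP : P ⊆ unateClass n) (hne : P.Nonempty)
    (hf : (ones (hardFn n φ (15 * k) hit core w (antiVal (mainSet (16 * k)) s))).Nonempty) :
    1 / 2048 ≤ relDistTo (hardFn n φ (15 * k) hit core w (antiVal (mainSet (16 * k)) s)) P := by
  refine le_relDistTo hne hf fun g hg => ?_
  obtain ⟨a, ha⟩ := hP hg
  have hones := card_le_card (ones_hardFn_subset (φ := φ) (hit := hit) (core := core) (15 * k) w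
    (antiVal (mainSet (n := n) (16 * k)) s))
  rw [card_hardSupport hn] at hones
  have e1 := card_upper_le (d := 16 * k) (j := 15 * k) (by omega)
  have e2 := choose_le_sixteen (k := k) (by omega)
  have e3 : 2 ^ φ * (2 * #(upper (16 * k) (15 * k)))
      ≤ 64 * (2 ^ φ * (16 * k).choose (15 * k + 1)) := by
    calc _ ≤ 2 ^ φ * (64 * (16 * k).choose (15 * k + 1)) := Nat.mul_le_mul_left _ (by omega)
      _ = _ := by ring
  -- The factor 64 from `e3` times 32 gives 2048. The value 32 is dictated by the slice case;
  -- violated edges need only 2.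
  suffices h : 2 ^ φ * (16 * k).choose (15 * k + 1) ≤ 32 * #(symmDiff
      (ones (hardFn n φ (15 * k) hit core w (antiVal (mainSet (16 * k)) s))) (ones g)) by
    have : #(ones (hardFn n φ (15 * k) hit core w (antiVal (mainSet (n := n) (16 * k)) s)))
      ≤ 2048 * #(symmDiff
      (ones (hardFn n φ (15 * k) hit core w (antiVal (mainSet (16 * k)) s))) (ones g)) := by omega
    have hr : (#(ones (hardFn n φ (15 * k) hit core w (antiVal (mainSet (n := n) (16 * k)) s))) : ℝ)
      ≤ 2048 * #(symmDiff
      (ones (hardFn n φ (15 * k) hit core w (antiVal (mainSet (16 * k)) s))) (ones g)) := by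
      exact_mod_cast this
    linarith
  by_cases hal : ∃ l : Fin (16 * k), a ⟨l, by omega⟩ = true
  · obtain ⟨l, hl⟩ := hal
    have e4 := card_slice_le_symmDiff (hit := hit) (core := core) hn (15 * k) w
      (antiVal (mainSet (n := n) (16 * k)) s) ha hl
    have e5 := choose_le_pred hk
    calc 2 ^ φ * (16 * k).choose (15 * k + 1)
        ≤ 2 ^ φ * (32 * (16 * k - 1).choose (15 * k + 1)) := by gcongr
      _ = 32 * (2 ^ φ * (16 * k - 1).choose (15 * k + 1)) := by ring
      _ ≤ _ := by gcongr
  · push Not at hal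
    have e4 := card_violated_le_symmDiff h1 h2 hn (15 * k) w s ha
      (fun l => by simpa using hal l)
    calc 2 ^ φ * (16 * k).choose (15 * k + 1)
        ≤ 2 ^ φ * (2 * #{y : Finset (Fin (16 * k)) | #y = 15 * k + 1 ∧
          Violated hit core w s y}) := by gcongr
      _ = 2 * (2 ^ φ * #{y : Finset (Fin (16 * k)) | #y = 15 * k + 1 ∧
          Violated hit core w s y}) := by ring
      _ ≤ 32 * _ := by gcongr; norm_num

/-! ### Most points are labelled and violated -/

lemma card_coord_mul {B : Type*} [Fintype B] {L : ℕ} (P : B → Prop) [DecidablePred P]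
    (i : Fin L) :
    #{w : Fin L → B | P (w i)} * Fintype.card B = #{b | P b} * Fintype.card B ^ L := by
  have h : ({w : Fin L → B | P (w i)} : Finset _)
      = Fintype.piFinset (Function.update (fun _ => univ) i (univ.filter P)) := by
    ext w
    rw [Fintype.mem_piFinset, mem_filter]
    refine ⟨fun h j => ?_, fun h => ⟨mem_univ _, ?_⟩⟩
    · by_cases hj : j = i
      · subst hj; simpa using h
      · simp [Function.update_of_ne hj]
    · simpa using h i
  have h2 : ∏ j ∈ univ.erase i, #(Function.update (fun _ : Fin L => (univ : Finset B)) i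
      (univ.filter P) j) = ∏ _j ∈ univ.erase i, Fintype.card B :=
    prod_congr rfl fun j hj => by rw [Function.update_of_ne (ne_of_mem_erase hj), card_univ]
  have h3 : Fintype.card B ^ L = ∏ _j : Fin L, Fintype.card B := by simp
  rw [h, Fintype.card_piFinset, ← mul_prod_erase univ _ (mem_univ i), h2, Function.update_self, h3,
    ← mul_prod_erase univ (fun _ => Fintype.card B) (mem_univ i)]
  ring

open scoped Classical in
-- The label of `y` is determined by the regions alone, so for fixed `w` the coordinate attached to
-- it is uniform.
lemma card_lab_coord_le {B : Type*} {d L : ℕ} {hit core : B → Finset (Fin d) → Prop} (hd : 0 < d) (w : Fin L → B) (y : Finset (Fin d)) (P : Fin d → Prop)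
    [DecidablePred P] :
    (#{s : Fin L → Fin d | ∃ i, IsLab hit core w i y ∧ P (s i)} : ℝ)
      ≤ #{l | P l} / d * (d : ℝ) ^ L := by
  have hdr : (0 : ℝ) < d := by exact_mod_cast hd
  by_cases h : ∃ i, IsLab hit core w i y
  · obtain ⟨i, hi⟩ := h
    have hsub : ({s : Fin L → Fin d | ∃ i, IsLab hit core w i y ∧ P (s i)} : Finset _)
        ⊆ univ.filter fun s => P (s i) := by
      intro s hs
      obtain ⟨j, hj, hP⟩ := (mem_filter.1 hs).2
      rw [hj.1.unique hi.1] at hP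
      exact mem_filter.2 ⟨mem_univ _, hP⟩
    have h1 := card_coord_mul (L := L) P i
    rw [Fintype.card_fin] at h1
    refine (Nat.cast_le.2 (card_le_card hsub)).trans (le_of_eq ?_)
    rw [div_mul_eq_mul_div, eq_div_iff hdr.ne']
    exact_mod_cast h1
  · have : ({s : Fin L → Fin d | ∃ i, IsLab hit core w i y ∧ P (s i)} : Finset _) = ∅ := by
      rw [filter_eq_empty_iff]
      rintro s _ ⟨i, hi, _⟩
      exact h ⟨i, hi⟩
    rw [this]
    simp only [card_empty, Nat.cast_zero]
    positivity

section Labelled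

variable {B : Type*} [Fintype B] [Nonempty B] {d L : ℕ} {hit core : B → Finset (Fin d) → Prop}

/-- The point has no label. -/
def Unlab (hit core : B → Finset (Fin d) → Prop) (w : Fin L → B) (x : Finset (Fin d)) : Prop :=
  ∀ i, ¬ IsLab hit core w i x

open scoped Classical in
-- Either no region contains the point, with probability at most `exp (-5) < 1 / 100`, or some
-- region contains it on its boundary, with expected number at most `6 / 600`.
lemma card_unlab_le {hc : ℕ} {x : Finset (Fin d)} (hhit : #{b | hit b x} = hc)
    (hlow : 5 * Fintype.card B ≤ L * hc) (hhigh : L * hc ≤ 6 * Fintype.card B)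
    (hnc : 600 * #{b | hit b x ∧ ¬ core b x} ≤ hc) :
    (#{w : Fin L → B | Unlab hit core w x} : ℝ) ≤ 1 / 50 * (Fintype.card B : ℝ) ^ L := by
  have hB : (0 : ℝ) < Fintype.card B := by exact_mod_cast Fintype.card_pos
  have hsub : ({w : Fin L → B | Unlab hit core w x} : Finset _)
      ⊆ Fintype.piFinset (fun _ => univ.filter fun b => ¬ hit b x) ∪
        univ.biUnion fun i => univ.filter fun w : Fin L → B => hit (w i) x ∧ ¬ core (w i) x := by
    intro w hw
    have hw := (mem_filter.1 hw).2
    rw [mem_union, Fintype.mem_piFinset, mem_biUnion]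
    by_cases h : ∃ i, hit (w i) x
    · obtain ⟨i, hi⟩ := exists_isFirst h
      exact Or.inr ⟨i, mem_univ _, mem_filter.2 ⟨mem_univ _, hi.1, fun hcore => hw i ⟨hi, hcore⟩⟩⟩
    · push Not at h
      exact Or.inl fun i => mem_filter.2 ⟨mem_univ _, h i⟩
  have h1 := (card_le_card hsub).trans ((card_union_le _ _).trans
    (add_le_add le_rfl card_biUnion_le))
  have hcB : hc ≤ Fintype.card B := by rw [← hhit]; exact card_le_univ _
  have hnh : #{b | ¬ hit b x} = Fintype.card B - hc := by
    have := card_filter_add_card_filter_not (s := (univ : Finset B)) (fun b => hit b x)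
    rw [hhit, card_univ] at this
    omega
  rw [Fintype.card_piFinset, prod_const, card_univ, Fintype.card_fin, hnh] at h1
  have h2 : ∀ i : Fin L, (#{w : Fin L → B | hit (w i) x ∧ ¬ core (w i) x} : ℝ)
      = #{b | hit b x ∧ ¬ core b x} / Fintype.card B * (Fintype.card B : ℝ) ^ L := by
    intro i
    rw [div_mul_eq_mul_div, eq_div_iff hB.ne']
    exact_mod_cast card_coord_mul (fun b => hit b x ∧ ¬ core b x) i
  have h1r : (#{w : Fin L → B | Unlab hit core w x} : ℝ) ≤ (Fintype.card B - hc : ℝ) ^ L +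
      ∑ i : Fin L, (#{w : Fin L → B | hit (w i) x ∧ ¬ core (w i) x} : ℝ) := by
    have := (Nat.cast_le (α := ℝ)).2 h1
    push_cast [Nat.cast_sub hcB] at this
    exact this
  have hlowr : 5 * (Fintype.card B : ℝ) ≤ L * hc := by exact_mod_cast hlow
  have hhighr : (L * hc : ℝ) ≤ 6 * Fintype.card B := by exact_mod_cast hhigh
  have hncr : 600 * (#{b | hit b x ∧ ¬ core b x} : ℝ) ≤ hc := by exact_mod_cast hnc
  have hcBr : (hc : ℝ) ≤ Fintype.card B := by exact_mod_cast hcB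
  have h3 : (Fintype.card B - hc : ℝ) ^ L ≤ 1 / 100 * (Fintype.card B : ℝ) ^ L := by
    have e1 : (Fintype.card B - hc : ℝ) ≤ Fintype.card B * Real.exp (-(hc / Fintype.card B)) := by
      have := Real.add_one_le_exp (-(hc / Fintype.card B : ℝ))
      have := mul_le_mul_of_nonneg_left this hB.le
      have e : (Fintype.card B : ℝ) * (-(hc / Fintype.card B) + 1) = Fintype.card B - hc := by
        field_simp; ring
      linarith
    calc (Fintype.card B - hc : ℝ) ^ L
        ≤ (Fintype.card B * Real.exp (-(hc / Fintype.card B))) ^ L :=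
          pow_le_pow_left₀ (by linarith) e1 L
      _ = Real.exp (-(L * hc / Fintype.card B)) * (Fintype.card B : ℝ) ^ L := by
          rw [mul_pow, ← Real.exp_nat_mul]
          ring_nf
      _ ≤ _ := by
          refine mul_le_mul_of_nonneg_right ?_ (by positivity)
          have e5 : (5 : ℝ) ≤ L * hc / Fintype.card B := by rw [le_div_iff₀ hB]; exact hlowr
          refine (Real.exp_le_exp.2 (neg_le_neg e5)).trans ?_
          rw [Real.exp_neg, inv_le_comm₀ (Real.exp_pos _) (by norm_num)]
          have e6 : Real.exp 5 = Real.exp 1 ^ 5 := by rw [← Real.exp_nat_mul]; norm_num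
          have e7 := Real.exp_one_gt_d9
          rw [e6]
          calc (1 / 100 : ℝ)⁻¹ ≤ (2.7 : ℝ) ^ 5 := by norm_num
            _ ≤ _ := pow_le_pow_left₀ (by norm_num) (by linarith) 5
  have h4 : ∑ i : Fin L, (#{w : Fin L → B | hit (w i) x ∧ ¬ core (w i) x} : ℝ)
      ≤ 1 / 100 * (Fintype.card B : ℝ) ^ L := by
    simp only [h2]
    rw [sum_const, card_univ, Fintype.card_fin, nsmul_eq_mul, ← mul_assoc]
    refine mul_le_mul_of_nonneg_right ?_ (by positivity)
    rw [mul_div_assoc', div_le_iff₀ hB]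
    nlinarith [mul_le_mul_of_nonneg_left hncr (Nat.cast_nonneg (α := ℝ) L)]
  linarith

open scoped Classical in
-- Union bound over three failures: `y` has no label, its coordinate is one of the at most `d / 16`
-- zeros of `y`, or the lower end of the edge has no label. The sum is `1 / 50 + 1 / 16 + 1 / 50 <
-- 103 / 1000`.
lemma card_not_violated_le (hd : 0 < d) {y : Finset (Fin d)} (hy : 16 * (d - #y) ≤ d)
    (h0 : (#{w : Fin L → B | Unlab hit core w y} : ℝ) ≤ 1 / 50 * (Fintype.card B : ℝ) ^ L)
    (h1 : ∀ l ∈ y, (#{w : Fin L → B | Unlab hit core w (y.erase l)} : ℝ)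
      ≤ 1 / 50 * (Fintype.card B : ℝ) ^ L) :
    (#{ws : (Fin L → B) × (Fin L → Fin d) | ¬ Violated hit core ws.1 ws.2 y} : ℝ)
      ≤ 103 / 1000 * ((Fintype.card B : ℝ) ^ L * (d : ℝ) ^ L) := by
  have hdr : (0 : ℝ) < d := by exact_mod_cast hd
  have hw : ∀ w : Fin L → B, (#{s : Fin L → Fin d | ¬ Violated hit core w s y} : ℝ)
      ≤ (if Unlab hit core w y then (d : ℝ) ^ L else 0) + #{l | l ∉ y} / d * (d : ℝ) ^ L
        + #{l | l ∈ y ∧ Unlab hit core w (y.erase l)} / d * (d : ℝ) ^ L := by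
    intro w
    have hA := card_lab_coord_le (hit := hit) (core := core) hd w y fun l => l ∉ y
    have hC := card_lab_coord_le (hit := hit) (core := core) hd w y
      fun l => l ∈ y ∧ Unlab hit core w (y.erase l)
    by_cases hun : Unlab hit core w y
    · rw [if_pos hun]
      have : (#{s : Fin L → Fin d | ¬ Violated hit core w s y} : ℝ) ≤ (d : ℝ) ^ L := by
        have := card_le_univ ({s : Fin L → Fin d | ¬ Violated hit core w s y} : Finset _)
        rw [Fintype.card_fun, Fintype.card_fin, Fintype.card_fin] at this
        exact_mod_cast this
      have e1 : 0 ≤ (#{l | l ∉ y} : ℝ) / d * (d : ℝ) ^ L := by positivity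
      have e2 : 0 ≤ (#{l | l ∈ y ∧ Unlab hit core w (y.erase l)} : ℝ) / d * (d : ℝ) ^ L := by
        positivity
      linarith
    · rw [if_neg hun, zero_add]
      have hsub : ({s : Fin L → Fin d | ¬ Violated hit core w s y} : Finset _)
          ⊆ (univ.filter fun s => ∃ i, IsLab hit core w i y ∧ s i ∉ y) ∪
            univ.filter fun s => ∃ i, IsLab hit core w i y ∧
              (s i ∈ y ∧ Unlab hit core w (y.erase (s i))) := by
        intro s hs
        have hs := (mem_filter.1 hs).2
        unfold Unlab at hun
        push Not at hun
        obtain ⟨i, hi⟩ := hun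
        rw [mem_union, mem_filter, mem_filter]
        by_cases hm : s i ∈ y
        · exact Or.inr ⟨mem_univ _, i, hi, hm, fun j hj => hs ⟨i, hi, hm, j, hj⟩⟩
        · exact Or.inl ⟨mem_univ _, i, hi, hm⟩
      have := (card_le_card hsub).trans (card_union_le _ _)
      have := (Nat.cast_le (α := ℝ)).2 this
      push_cast at this
      linarith
  have hprod : (#{ws : (Fin L → B) × (Fin L → Fin d) | ¬ Violated hit core ws.1 ws.2 y} : ℝ)
      = ∑ w : Fin L → B, (#{s : Fin L → Fin d | ¬ Violated hit core w s y} : ℝ) := by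
    simp only [card_filter]
    rw [Fintype.sum_prod_type]
    push_cast
    rfl
  rw [hprod]
  refine (sum_le_sum fun w _ => hw w).trans ?_
  rw [sum_add_distrib, sum_add_distrib, ← sum_filter, sum_const, sum_const, ← sum_mul, ← sum_div,
    nsmul_eq_mul, nsmul_eq_mul, card_univ, Fintype.card_fun, Fintype.card_fin]
  have e2 : (#{l | l ∉ y} : ℝ) / d ≤ 1 / 16 := by
    have h2 := card_filter_add_card_filter_not (s := (univ : Finset (Fin d))) (fun l => l ∈ y)
    rw [filter_mem_eq_inter, univ_inter, card_univ, Fintype.card_fin] at h2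
    rw [div_le_iff₀ hdr]
    have h3 : 16 * #{l | l ∉ y} ≤ d := by omega
    have : (16 : ℝ) * #{l | l ∉ y} ≤ d := by exact_mod_cast h3
    linarith
  have e3 : (∑ w : Fin L → B, (#{l | l ∈ y ∧ Unlab hit core w (y.erase l)} : ℝ)) / d
      ≤ 1 / 50 * (Fintype.card B : ℝ) ^ L := by
    rw [div_le_iff₀ hdr]
    have e : ∑ w : Fin L → B, (#{l | l ∈ y ∧ Unlab hit core w (y.erase l)} : ℝ)
        = ∑ l ∈ y, (#{w : Fin L → B | Unlab hit core w (y.erase l)} : ℝ) := by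
      have : ∀ w : Fin L → B, #{l | l ∈ y ∧ Unlab hit core w (y.erase l)}
          = ∑ l ∈ y, if Unlab hit core w (y.erase l) then 1 else 0 := fun w => by
        rw [← card_filter]
        congr 1
        ext l
        simp
      simp only [this, card_filter]
      push_cast
      rw [sum_comm]
    rw [e]
    have hyd : (#y : ℝ) ≤ d := by
      have := card_le_univ y
      rw [Fintype.card_fin] at this
      exact_mod_cast this
    calc _ ≤ ∑ l ∈ y, 1 / 50 * (Fintype.card B : ℝ) ^ L := sum_le_sum h1
      _ = #y * (1 / 50 * (Fintype.card B : ℝ) ^ L) := by rw [sum_const, nsmul_eq_mul]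
      _ ≤ d * (1 / 50 * (Fintype.card B : ℝ) ^ L) := by gcongr
      _ = _ := by ring
  have f1 := mul_le_mul_of_nonneg_right h0 (show 0 ≤ (d : ℝ) ^ L by positivity)
  have f2 := mul_le_mul_of_nonneg_right e2
    (show 0 ≤ (Fintype.card B : ℝ) ^ L * (d : ℝ) ^ L by positivity)
  have f3 := mul_le_mul_of_nonneg_right e3 (show 0 ≤ (d : ℝ) ^ L by positivity)
  have f4 : 0 ≤ (Fintype.card B : ℝ) ^ L * (d : ℝ) ^ L := by positivity
  push_cast
  linarith

open scoped Classical in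
/-- With high probability half of the upper layer is violated. -/
lemma card_few_violated_le {m : ℕ} (hd : 0 < d) (hm : 16 * (d - m) ≤ d) (hmd : m ≤ d)
    (hun : ∀ x : Finset (Fin d), (#x = m ∨ #x + 1 = m) →
      (#{w : Fin L → B | Unlab hit core w x} : ℝ) ≤ 1 / 50 * (Fintype.card B : ℝ) ^ L) :
    (#{ws : (Fin L → B) × (Fin L → Fin d) |
        ¬ d.choose m ≤ 2 * #{y : Finset (Fin d) | #y = m ∧ Violated hit core ws.1 ws.2 y}} : ℝ)
      ≤ 206 / 1000 * ((Fintype.card B : ℝ) ^ L * (d : ℝ) ^ L) := by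
  set Bad := ({ws : (Fin L → B) × (Fin L → Fin d) | ¬ d.choose m
    ≤ 2 * #{y : Finset (Fin d) | #y = m ∧ Violated hit core ws.1 ws.2 y}} : Finset _) with hBad
  have hpos : (0 : ℝ) < d.choose m := by exact_mod_cast Nat.choose_pos hmd
  have h1 : ∀ ws ∈ Bad, (d.choose m : ℝ)
      ≤ 2 * #{y : Finset (Fin d) | #y = m ∧ ¬ Violated hit core ws.1 ws.2 y} := by
    intro ws hws
    have hb := (mem_filter.1 hws).2
    have h2 := card_filter_add_card_filter_not (s := ({y | #y = m} : Finset (Finset (Fin d))))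
      (fun y => Violated hit core ws.1 ws.2 y)
    rw [filter_filter, filter_filter, card_layer] at h2
    have h3 : d.choose m ≤ 2 * #{y : Finset (Fin d) | #y = m ∧ ¬ Violated hit core ws.1 ws.2 y} := by
      omega
    exact_mod_cast h3
  have h2 : ∑ ws : (Fin L → B) × (Fin L → Fin d),
      (#{y : Finset (Fin d) | #y = m ∧ ¬ Violated hit core ws.1 ws.2 y} : ℝ)
      ≤ d.choose m * (103 / 1000 * ((Fintype.card B : ℝ) ^ L * (d : ℝ) ^ L)) := by
    have e : ∑ ws : (Fin L → B) × (Fin L → Fin d),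
        (#{y : Finset (Fin d) | #y = m ∧ ¬ Violated hit core ws.1 ws.2 y} : ℝ)
        = ∑ y ∈ ({y | #y = m} : Finset (Finset (Fin d))),
          (#{ws : (Fin L → B) × (Fin L → Fin d) | ¬ Violated hit core ws.1 ws.2 y} : ℝ) := by
      simp only [← filter_filter, card_filter _ ({y | #y = m} : Finset (Finset (Fin d))),
        card_filter _ (univ : Finset ((Fin L → B) × (Fin L → Fin d)))]
      push_cast
      rw [sum_comm]
    rw [e]
    calc _ ≤ ∑ y ∈ ({y | #y = m} : Finset (Finset (Fin d))),
          103 / 1000 * ((Fintype.card B : ℝ) ^ L * (d : ℝ) ^ L) := by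
          refine sum_le_sum fun y hy => ?_
          have hy := (mem_filter.1 hy).2
          refine card_not_violated_le hd (by rw [hy]; exact hm) (hun y (Or.inl hy)) fun l hl =>
            hun _ (Or.inr ?_)
          rw [card_erase_add_one hl, hy]
      _ = _ := by rw [sum_const, nsmul_eq_mul, card_layer]
  -- Markov's inequality at one half of the layer, which doubles 103 to 206.
  have h3 : (#Bad : ℝ) * d.choose m ≤ 2 * (d.choose m *
      (103 / 1000 * ((Fintype.card B : ℝ) ^ L * (d : ℝ) ^ L))) := by
    calc (#Bad : ℝ) * d.choose m = ∑ ws ∈ Bad, (d.choose m : ℝ) := by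
          rw [sum_const, nsmul_eq_mul]
      _ ≤ ∑ ws ∈ Bad, 2 * (#{y : Finset (Fin d) | #y = m ∧
            ¬ Violated hit core ws.1 ws.2 y} : ℝ) := sum_le_sum h1
      _ ≤ ∑ ws : (Fin L → B) × (Fin L → Fin d), 2 * (#{y : Finset (Fin d) | #y = m ∧
            ¬ Violated hit core ws.1 ws.2 y} : ℝ) :=
          sum_le_sum_of_subset_of_nonneg (subset_univ _) fun _ _ _ => by positivity
      _ ≤ _ := by rw [← mul_sum]; gcongr
  refine le_of_mul_le_mul_right (h3.trans (le_of_eq ?_)) hpos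
  ring

end Labelled

/-! ### Combining the bounds: no tester with few queries -/

lemma toReal_apply_true_le {p : PMF Bool} (h : 2 / 3 ≤ p false) : (p true).toReal ≤ 1 / 3 := by
  have h1 := p.tsum_coe
  rw [tsum_bool] at h1
  have h2 : (p false).toReal + (p true).toReal = 1 := by
    rw [← ENNReal.toReal_add (p.apply_ne_top _) (p.apply_ne_top _), h1, ENNReal.toReal_one]
  have h3 := ENNReal.toReal_mono (p.apply_ne_top _) h
  rw [ENNReal.toReal_div] at h3
  norm_num at h3
  linarith

lemma le_toReal_apply_true {p : PMF Bool} (h : 2 / 3 ≤ p true) : 2 / 3 ≤ (p true).toReal := by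
  have h3 := ENNReal.toReal_mono (p.apply_ne_top _) h
  rw [ENNReal.toReal_div] at h3
  norm_num at h3
  linarith

section Hard

variable {B : Type*} [Fintype B] [Nonempty B] {n k φ L : ℕ}
  {hit core : B → Finset (Fin (16 * k)) → Prop}

/-- A decision tree with few queries does not distinguish the two families. -/
lemma sum_val_sub_le {μ : ℝ} {hc : ℕ} (hk : 0 < k) (hμ : 0 < μ) (hμ1 : μ ≤ 1)
    (hL : L * hc ≤ 6 * Fintype.card B)
    (hspread : ∀ H : List (Finset (Fin (16 * k))), H ≠ [] → ∀ S : Finset B,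
      (∀ b ∈ S, ∀ x ∈ H, hit b x) → (#S : ℝ) * Real.exp (μ * #(varying H)) ≤ hc * 3 ^ H.length)
    (T : DTree (Fin n → Bool)) {M : ℕ} (hT : T.depth ≤ M) :
    ∑ ws : (Fin L → B) × (Fin L → Fin (16 * k)),
        T.val (hardFn n φ (15 * k) hit core ws.1 (constVal k ws.2))
      - ∑ ws : (Fin L → B) × (Fin L → Fin (16 * k)),
        T.val (hardFn n φ (15 * k) hit core ws.1 (antiVal (mainSet (16 * k)) ws.2))
      ≤ (M * Real.log (110 + 6 * M) + 1) / μ / k *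
        Fintype.card ((Fin L → B) × (Fin L → Fin (16 * k))) := by
  have hkr : (0 : ℝ) < k := by exact_mod_cast hk
  have hcore : ∀ (b : B) (z : Fin n → Bool), lift φ (15 * k) core b z →
      #(mainSet (16 * k) z) = 15 * k ∨ #(mainSet (16 * k) z) = 15 * k + 1 :=
    fun b z h => h.1.2.2
  have h1 : ∀ w : Fin L → B, ∑ s : Fin L → Fin (16 * k),
      (T.val (hardFn n φ (15 * k) hit core w (constVal k s)) -
        cost (mainSet (16 * k)) (lift φ (15 * k) hit) w
          (T.path (hardFn n φ (15 * k) hit core w (constVal k s)) []) / k)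
      ≤ ∑ s : Fin L → Fin (16 * k),
        T.val (hardFn n φ (15 * k) hit core w (antiVal (mainSet (16 * k)) s)) := fun w =>
    sum_const_le_sum_anti (mainSet (16 * k)) (lift φ (15 * k) hit) (lift φ (15 * k) core) w hk rfl
      hcore (baseFn n (16 * k) φ (15 * k)) T
  have hexp : Real.exp μ ≤ 3 :=
    (Real.exp_le_exp.2 hμ1).trans (by have := Real.exp_one_lt_d9; linarith)
  have hLr : (L * hc : ℝ) ≤ 6 * Fintype.card B := by exact_mod_cast hL
  have h2 : ∀ s : Fin L → Fin (16 * k), ∑ w : Fin L → B,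
      (cost (mainSet (16 * k)) (lift φ (15 * k) hit) w
        (T.path (hardFn n φ (15 * k) hit core w (constVal k s)) []) : ℝ)
      ≤ (Fintype.card B : ℝ) ^ L * ((M * Real.log (110 + 6 * M) + 1) / μ) := by
    intro s
    -- `θ = 18` comes from `L * hc ≤ 6 * card B` and `exp μ ≤ 3`; then `2 * (1 + 3 * θ + 3 * M) =
    -- 110 + 6 * M`.
    have := sum_cost_path_le (L := L) (θ := 18) (hc := hc) (mainSet (n := n) (16 * k))
      (lift φ (15 * k) hit) hμ (by positivity) ?_ ?_
      (fun w => hardFn n φ (15 * k) hit core w (constVal k s)) T hT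
    · convert this using 5
      ring_nf
    · have : (L : ℝ) * (hc * Real.exp μ) ≤ L * (hc * 3) := by gcongr
      linarith
    · intro H hH S hS
      have := hspread (H.map (mainSet (16 * k))) (by simpa using hH) S (fun b hb x hx => by
        obtain ⟨z, hz, rfl⟩ := List.mem_map.1 hx
        exact (hS b hb z hz).2)
      rwa [List.length_map] at this
  have h3 := sum_le_sum fun (w : Fin L → B) (_ : w ∈ univ) => h1 w
  have h4 := sum_le_sum fun (s : Fin L → Fin (16 * k)) (_ : s ∈ univ) => h2 s
  simp only [sum_sub_distrib, ← sum_div] at h3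
  rw [sum_comm] at h4
  rw [Fintype.sum_prod_type, Fintype.sum_prod_type]
  rw [sum_const, card_univ, nsmul_eq_mul, Fintype.card_fun, Fintype.card_fin,
    Fintype.card_fin] at h4
  rw [Fintype.card_prod, Fintype.card_fun, Fintype.card_fun, Fintype.card_fin, Fintype.card_fin]
  have h5 := div_le_div_of_nonneg_right h4 hkr.le
  push_cast at h5 ⊢
  have h6 : (((16 * (k : ℝ)) ^ L) * ((Fintype.card B : ℝ) ^ L *
      ((M * Real.log (110 + 6 * M) + 1) / μ))) / k = (M * Real.log (110 + 6 * M) + 1) / μ / k *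
        ((Fintype.card B : ℝ) ^ L * (16 * (k : ℝ)) ^ L) := by ring
  rw [h6] at h5
  linarith

/-- No tester with few queries. -/
lemma not_isTester {μ : ℝ} {hc : ℕ} (hk : 2 ≤ k) (hn : 16 * k + 1 + φ ≤ n)
    (h1 : ∀ b x i, i ∉ x → core b x → hit b (insert i x))
    (h2 : ∀ b x i, i ∉ x → core b (insert i x) → hit b x)
    (hhit : ∀ x, ∀ S : Finset B, (∀ b, b ∈ S ↔ hit b x) → #S = hc)
    (hnc : ∀ x, ∀ S : Finset B, (∀ b, b ∈ S ↔ hit b x ∧ ¬ core b x) → 600 * #S ≤ hc)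
    (hμ : 0 < μ) (hμ1 : μ ≤ 1)
    (hlow : 5 * Fintype.card B ≤ L * hc) (hhigh : L * hc ≤ 6 * Fintype.card B)
    (hspread : ∀ H : List (Finset (Fin (16 * k))), H ≠ [] → ∀ S : Finset B,
      (∀ b ∈ S, ∀ x ∈ H, hit b x) → (#S : ℝ) * Real.exp (μ * #(varying H)) ≤ hc * 3 ^ H.length)
    {N : ℕ} (hN1 : #(hardSupport n (16 * k) φ (15 * k)) ≤ N)
    (hN2 : N ≤ 2 * #(hardSupport n (16 * k) φ (15 * k)))
    {q τ : ℕ} (hτ : 1 ≤ τ)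
    (hsmall : ((q * τ : ℕ) * Real.log (110 + 6 * (q * τ : ℕ)) + 1) / μ / k
      + 2 * (q * (1 - 1 / 1024) ^ τ) ≤ 1 / 10)
    {P : Set (BoolFn n)} (hP : P = monotoneClass n ∨ P = unateClass n) {A : RandAlg n}
    (hA : IsTester (Sparsity 2048 N) P (1 / 2048) A)
    (hq : MakesAtMost (Sparsity 2048 N) A q) : False := by
  classical
  have hPm : monotoneClass n ⊆ P := by
    rcases hP with rfl | rfl
    · exact subset_rfl
    · exact monotoneClass_subset_unateClass n
  have hPu : P ⊆ unateClass n := by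
    rcases hP with rfl | rfl
    · exact monotoneClass_subset_unateClass n
    · exact subset_rfl
  have hPne : P.Nonempty := ⟨fun _ => false, hPm (fun _ _ _ => le_rfl)⟩
  have hK := card_hardSupport_le (φ := φ) hk hn
  have hKpos : 0 < #(hardSupport n (16 * k) φ (15 * k)) := by
    rw [card_hardSupport hn, card_upper_succ]
    have := Nat.choose_pos (show 15 * k ≤ 16 * k by omega)
    positivity
  have hones1 : ∀ (w : Fin L → B) h, #(hardSupport n (16 * k) φ (15 * k))
      ≤ 1024 * #(ones (hardFn n φ (15 * k) hit core w h)) := fun w h => by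
    have := card_le_card (hardSupport_subset_ones (n := n) (φ := φ) (hit := hit) (core := core)
      (15 * k) w h)
    omega
  have hne : ∀ (w : Fin L → B) h, (ones (hardFn n φ (15 * k) hit core w h)).Nonempty :=
    fun w h => by
      have := hones1 w h
      rw [← card_pos]
      omega
  have hsp : ∀ (w : Fin L → B) h, Sparsity 2048 N (hardFn n φ (15 * k) hit core w h) := by
    intro w h
    have e1 := hones1 w h
    have e2 := card_le_card (ones_hardFn_subset (n := n) (φ := φ) (hit := hit) (core := core)
      (15 * k) w h)
    constructor
    · rw [div_le_iff₀ (by norm_num)]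
      have : N ≤ #(ones (hardFn n φ (15 * k) hit core w h)) * 2048 := by omega
      exact_mod_cast this
    · have : #(ones (hardFn n φ (15 * k) hit core w h)) ≤ 2048 * N := by omega
      exact_mod_cast this
  set fy : ((Fin L → B) × (Fin L → Fin (16 * k))) → BoolFn n := fun ws => hardFn n φ (15 * k) hit core ws.1 (constVal k ws.2) with hfy
  set fn : ((Fin L → B) × (Fin L → Fin (16 * k))) → BoolFn n := fun ws =>
    hardFn n φ (15 * k) hit core ws.1 (antiVal (mainSet (16 * k)) ws.2) with hfn
  have hyes : ∀ i, 2 / 3 ≤ (A.run (fy i) (hne _ _) true).toReal := fun i =>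
    le_toReal_apply_true ((hA _ (hne _ _) (hsp _ _)).1
      (hPm (hardFn_constVal_monotone h1 h2 (15 * k) k i.1 i.2)))
  have hcard : (Fintype.card ((Fin L → B) × (Fin L → Fin (16 * k))) : ℝ) = (Fintype.card B : ℝ) ^ L * ((16 * k : ℕ) : ℝ) ^ L := by
    rw [Fintype.card_prod, Fintype.card_fun, Fintype.card_fun, Fintype.card_fin,
      Fintype.card_fin]
    push_cast
    ring
  have hpos : (0 : ℝ) < Fintype.card ((Fin L → B) × (Fin L → Fin (16 * k))) := by
    have : (0 : ℝ) < Fintype.card B := by exact_mod_cast Fintype.card_pos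
    have : (0 : ℝ) < ((16 * k : ℕ) : ℝ) := by exact_mod_cast (by omega : 0 < 16 * k)
    rw [hcard]
    positivity
  have hbad := card_few_violated_le (B := B) (L := L) (hit := hit) (core := core)
    (d := 16 * k) (m := 15 * k + 1) (by omega) (by omega) (by omega)
    (fun x _ => card_unlab_le (hhit x _ (by simp)) hlow hhigh (hnc x _ (by simp)))
  rw [← hcard] at hbad
  set Bad := ({ws : ((Fin L → B) × (Fin L → Fin (16 * k))) | ¬ (16 * k).choose (15 * k + 1) ≤ 2 * #{y : Finset (Fin (16 * k)) |
    #y = 15 * k + 1 ∧ Violated hit core ws.1 ws.2 y}} : Finset _) with hBad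
  have hno : ∀ i, (A.run (fn i) (hne _ _) true).toReal ≤ 1 / 3 + if i ∈ Bad then 1 else 0 := by
    intro i
    by_cases hi : i ∈ Bad
    · rw [if_pos hi]
      have h3 := ENNReal.toReal_mono ENNReal.one_ne_top
        (PMF.coe_le_one (A.run (fn i) (hne _ _)) true)
      rw [ENNReal.toReal_one] at h3
      linarith
    · rw [if_neg hi, add_zero]
      refine toReal_apply_true_le ((hA _ (hne _ _) (hsp _ _)).2 ?_)
      refine le_relDistTo_hardFn h1 h2 hk hn i.1 i.2 ?_ hPu hPne (hne _ _)
      by_contra hcon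
      exact hi (mem_filter.2 ⟨mem_univ _, hcon⟩)
  have hnosum : ∑ i, (A.run (fn i) (hne _ _) true).toReal
      ≤ 1 / 3 * Fintype.card ((Fin L → B) × (Fin L → Fin (16 * k))) + 206 / 1000 * Fintype.card ((Fin L → B) × (Fin L → Fin (16 * k))) := by
    refine (sum_le_sum fun i _ => hno i).trans ?_
    rw [sum_add_distrib, sum_const, card_univ, nsmul_eq_mul, ← sum_filter, sum_const,
      nsmul_eq_mul, mul_one, filter_mem_eq_inter, univ_inter]
    linarith
  have hyessum : 2 / 3 * (Fintype.card ((Fin L → B) × (Fin L → Fin (16 * k))) : ℝ) ≤ ∑ i, (A.run (fy i) (hne _ _) true).toReal := by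
    calc _ = ∑ _i : ((Fin L → B) × (Fin L → Fin (16 * k))), (2 / 3 : ℝ) := by rw [sum_const, card_univ, nsmul_eq_mul, mul_comm]
      _ ≤ _ := sum_le_sum fun i _ => hyes i
  -- The tester must have advantage at least `2 / 3 - 1 / 3 - 206 / 1000`, which exceeds `1 / 10`.
  have hmix := RandAlg.sum_run_le A fy fn (fun i => hne _ _) (fun i => hne _ _)
    (δ := 1 / 10 * Fintype.card ((Fin L → B) × (Fin L → Fin (16 * k)))) (by positivity) ?_
  · linarith
  intro t ht
  have hρ : ∀ (w : Fin L → B) h, (1 / 1024 : ℝ) * #(hardSupport n (16 * k) φ (15 * k))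
      ≤ #(ones (hardFn n φ (15 * k) hit core w h)) := fun w h => by
    have : (#(hardSupport n (16 * k) φ (15 * k)) : ℝ)
      ≤ 1024 * #(ones (hardFn n φ (15 * k) hit core w h)) := by exact_mod_cast hones1 w h
    linarith
  -- Weights 1 and -1 make a single tree preserve the difference between the two families. The
  -- absolute weights sum to twice the family size, hence the factor 2 in `hsmall`.
  obtain ⟨T, hT, hTs⟩ := Alg.exists_dtree (ρ := 1 / 1024) (Sum.elim fy fn)
    (hardSupport n (16 * k) φ (15 * k)) (by norm_num) hτ
    (Sum.elim (fun _ => (1 : ℝ)) fun _ => -1) t univ q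
    (by rintro (i | i) _ <;> exact hne _ _)
    (by rintro (i | i) _ <;> exact ones_hardFn_subset _ _ _)
    (by rintro (i | i) _ <;> exact hρ _ _)
    (by rintro (i | i) _ <;> exact hq _ (hsp _ _) t ht)
  simp only [Fintype.sum_sum_type, Sum.elim_inl, Sum.elim_inr, one_mul, neg_mul, sum_neg_distrib,
    abs_one, abs_neg, sum_const, card_univ, nsmul_eq_mul, mul_one] at hTs
  have hval := sum_val_sub_le (n := n) (φ := φ) (L := L) (core := core) (by omega) hμ hμ1 hhigh
    hspread T hT
  have hfin := mul_le_mul_of_nonneg_right hsmall hpos.le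
  simp only [hfy, hfn] at hTs ⊢
  linarith

end Hard

open scoped Classical in
-- Fixes the regions with `J = 1200 * l` and `Q = 7200 * l`. The boundary fraction `2 * l / J` is
-- then `1 / 600`, and `6 * J ≤ Q + 2` and `J ≤ 2 * Q + 1` hold. The condition `k ≤ R ^ l` lets the
-- scales reach the dimension `16 * k`.
lemma not_isTester_of_levels {n N k φ l R q τ : ℕ} (hl : 1 ≤ l) (hR : 1 ≤ R) (hkR : k ≤ R ^ l)
    (hk : 2 ≤ k) (hn : 16 * k + 1 + φ ≤ n)
    (hN1 : #(hardSupport n (16 * k) φ (15 * k)) ≤ N)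
    (hN2 : N ≤ 2 * #(hardSupport n (16 * k) φ (15 * k))) (hτ : 1 ≤ τ)
    (hsmall : ((q * τ : ℕ) * Real.log (110 + 6 * (q * τ : ℕ)) + 1)
        / (1 / (4 * (2 * (7200 * l : ℕ) + 1) ^ 3 * R)) / k
      + 2 * (q * (1 - 1 / 1024) ^ τ) ≤ 1 / 10)
    {P : Set (BoolFn n)} (hP : P = monotoneClass n ∨ P = unateClass n) {A : RandAlg n}
    (hA : IsTester (Sparsity 2048 N) P (1 / 2048) A)
    (hq : MakesAtMost (Sparsity 2048 N) A q) : False := by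
  set u : Fin l → ℕ := fun a => 1200 * l * R ^ (a : ℕ) with hu
  have hupos : ∀ a, 0 < u a := fun a => by positivity
  have hJu : ∀ a, 1200 * l ≤ u a := fun a => Nat.le_mul_of_pos_right _ (by positivity)
  set hc := hitCount (16 * k) l (7200 * l) u with hhc
  have hcpos : 0 < hc := hitCount_pos hupos
  have hcle : hc ≤ Fintype.card (Block (16 * k) l (7200 * l) u) := hitCount_le_card
  have : Nonempty (Block (16 * k) l (7200 * l) u) := by
    rw [← Fintype.card_pos_iff]
    omega
  set b := Fintype.card (Block (16 * k) l (7200 * l) u) with hb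
  have hRr : (1 : ℝ) ≤ R := by exact_mod_cast hR
  have hL1 : 5 * b ≤ (5 * b / hc + 1) * hc := by
    have := Nat.lt_div_mul_add hcpos (a := 5 * b)
    rw [add_mul, one_mul]
    omega
  have hL2 : (5 * b / hc + 1) * hc ≤ 6 * b := by
    have := Nat.div_mul_le_self (5 * b) hc
    rw [add_mul, one_mul]
    omega
  -- This number of regions makes each point lie in five to six of them on average; rounding up adds
  -- at most one because `hc ≤ b`.
  refine not_isTester (B := Block (16 * k) l (7200 * l) u) (hit := Block.Hit) (core := Block.Core)
    (L := 5 * b / hc + 1) (hc := hc) hk hn (fun b x i hi h => h.hit_insert hi)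
    (fun b x i hi h => h.hit_of_insert hi) ?_ ?_ ?_ ?_ hL1 hL2 ?_ hN1 hN2 hτ hsmall hP hA hq
  · intro x S hS
    rw [hhc, ← card_hit x]
    congr 1
    ext b
    simp [hS]
  · intro x S hS
    have h := card_hit_not_core_le (d := 16 * k) (l := l) (Q := 7200 * l) (u := u) (1200 * l)
      (by omega) (by omega) hJu x
    have e : S = ({b : Block (16 * k) l (7200 * l) u | b.Hit x ∧ ¬ b.Core x} : Finset _) := by
      ext b
      simp [hS]
    rw [← e] at h
    have h' : 1200 * l * #S ≤ 2 * l * hc := by exact_mod_cast h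
    refine Nat.le_of_mul_le_mul_left ?_ (show 0 < 2 * l by omega)
    calc 2 * l * (600 * #S) = 1200 * l * #S := by ring
      _ ≤ _ := h'
  · positivity
  · rw [div_le_one (by positivity)]
    have h1 : (1 : ℝ) ≤ (2 * (7200 * l : ℕ) + 1) ^ 3 := by
      refine one_le_pow₀ ?_
      have : (0 : ℝ) ≤ (7200 * l : ℕ) := by positivity
      linarith
    nlinarith
  · intro H hH S hS
    have h := card_hit_list_mul_exp_le (d := 16 * k) (l := l) (Q := 7200 * l) (u := u) R (1200 * l)
      (by omega) (by omega) (by omega) (fun a => rfl) ?_ H hH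
    · refine le_trans (mul_le_mul_of_nonneg_right ?_ (Real.exp_pos _).le) h
      exact_mod_cast card_le_card fun b hb => mem_filter.2 ⟨mem_univ _, hS b hb⟩
    · have h1 : 16 < (2 * (7200 * l) + 1) ^ 2 * (1200 * l) := by nlinarith
      calc 16 * k < (2 * (7200 * l) + 1) ^ 2 * (1200 * l) * k :=
            Nat.mul_lt_mul_of_pos_right h1 (by omega)
        _ ≤ _ := Nat.mul_le_mul_left _ hkR

/-! ### Choice of the parameters -/

section Asymptotics

open Filter Topology

lemma tendsto_mul_exp_neg_rpow {l : ℕ} (hl : 1 ≤ l) :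
    Tendsto (fun x : ℝ => 2 * (x * Real.exp (-(x ^ (1 / (l : ℝ)) / 1024)))) atTop (𝓝 0) := by
  have hlr : (0 : ℝ) < l := by exact_mod_cast hl
  have h1 : Tendsto (fun x : ℝ => x ^ (1 / (l : ℝ)) / 1024) atTop atTop :=
    (tendsto_rpow_atTop (by positivity)).atTop_div_const (by norm_num)
  have h2 := ((Real.tendsto_pow_mul_exp_neg_atTop_nhds_zero l).comp h1).const_mul (2 * 1024 ^ l)
  rw [mul_zero] at h2
  refine h2.congr' ?_
  filter_upwards [eventually_ge_atTop 0] with x hx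
  have h3 : (x ^ (1 / (l : ℝ))) ^ l = x := by
    rw [← Real.rpow_natCast, ← Real.rpow_mul hx, one_div, inv_mul_cancel₀ hlr.ne', Real.rpow_one]
  simp only [Function.comp]
  rw [div_pow, h3]
  field_simp

/-- Both the scale ratio and the number of trials per sample are taken to be `R ≈ k ^ (1 / l)`. As a
ratio it costs a small power of `k`, and as a number of trials it makes the failure probability
smaller than any inverse power of `k`. -/
lemma exists_scale_of_few_queries (c : ℝ) (hc : 0 < c) (hc1 : c ≤ 1 / 2) :
    ∃ l k0 : ℕ, 1 ≤ l ∧ ∀ k : ℕ, k0 ≤ k → ∀ q : ℕ, (q : ℝ) ≤ (k : ℝ) ^ (1 - c) →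
      ∃ R : ℕ, 1 ≤ R ∧ k ≤ R ^ l ∧
        ((q * R : ℕ) * Real.log (110 + 6 * (q * R : ℕ)) + 1)
            / (1 / (4 * (2 * (7200 * l : ℕ) + 1) ^ 3 * R)) / k
          + 2 * (q * (1 - 1 / 1024) ^ R) ≤ 1 / 10 := by
  -- This makes `R` at most `2 * k ^ (c / 4)`. The loss `c` is spent on three such factors, for the
  -- trials, the logarithm and the scale ratio, and `k ^ (-c / 4)` is left.
  obtain ⟨l, hl⟩ := exists_nat_ge (4 / c)
  have hlpos : (0 : ℝ) < l := lt_of_lt_of_le (by positivity) hl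
  have hl1 : 1 ≤ l := by exact_mod_cast hlpos
  have hlc : 1 / (l : ℝ) ≤ c / 4 := by
    rw [div_le_iff₀ hlpos]
    rw [div_le_iff₀ hc] at hl
    linarith
  set C : ℝ := 4 * (2 * (7200 * l : ℕ) + 1) ^ 3 with hC
  have hCpos : 0 < C := by positivity
  set E : ℝ := C * (4 * (122 ^ (c / 4) / (c / 4)) + 2) with hE
  have hlim : Tendsto (fun x : ℝ => E * x ^ (-(c / 4))
      + 2 * (x * Real.exp (-(x ^ (1 / (l : ℝ)) / 1024)))) atTop (𝓝 0) := by
    have := ((tendsto_rpow_neg_atTop (show 0 < c / 4 by positivity)).const_mul E).add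
      (tendsto_mul_exp_neg_rpow hl1)
    simpa using this
  have hev := (hlim.comp tendsto_natCast_atTop_atTop).eventually
    (eventually_le_nhds (show (0 : ℝ) < 1 / 10 by norm_num))
  obtain ⟨k0, hk0⟩ := eventually_atTop.1 hev
  refine ⟨l, max k0 1, hl1, fun k hk q hq => ?_⟩
  have hk1 : (1 : ℝ) ≤ k := by exact_mod_cast (le_max_right _ _).trans hk
  have hkpos : (0 : ℝ) < k := by linarith
  have hlimk := hk0 k ((le_max_left _ _).trans hk)
  simp only [Function.comp] at hlimk
  set y : ℝ := (k : ℝ) ^ (1 / (l : ℝ)) with hy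
  have hy1 : 1 ≤ y := Real.one_le_rpow hk1 (by positivity)
  refine ⟨⌈y⌉₊, Nat.one_le_ceil_iff.2 (by linarith), ?_, ?_⟩
  · have h1 : (k : ℝ) = y ^ l := by
      rw [hy, ← Real.rpow_natCast, ← Real.rpow_mul hkpos.le, one_div,
        inv_mul_cancel₀ hlpos.ne', Real.rpow_one]
    have h2 : (k : ℝ) ≤ (⌈y⌉₊ : ℝ) ^ l := by
      rw [h1]
      exact pow_le_pow_left₀ (by linarith) (Nat.le_ceil y) l
    exact_mod_cast h2
  set R := ⌈y⌉₊ with hR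
  have hyR : y ≤ R := Nat.le_ceil y
  have hRy : (R : ℝ) ≤ 2 * y := by
    have := Nat.ceil_lt_add_one (show 0 ≤ y by linarith)
    linarith
  have hyc : y ≤ (k : ℝ) ^ (c / 4) := Real.rpow_le_rpow_of_exponent_le hk1 hlc
  have hRc : (R : ℝ) ≤ 2 * (k : ℝ) ^ (c / 4) := by linarith
  have hqk : (q : ℝ) ≤ k := hq.trans (by
    calc (k : ℝ) ^ (1 - c) ≤ (k : ℝ) ^ (1 : ℝ) :=
          Real.rpow_le_rpow_of_exponent_le hk1 (by linarith)
      _ = k := Real.rpow_one _)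
  have hpowadd : ∀ a b : ℝ, (k : ℝ) ^ a * (k : ℝ) ^ b = (k : ℝ) ^ (a + b) := fun a b =>
    (Real.rpow_add hkpos a b).symm
  have hqR : ((q * R : ℕ) : ℝ) ≤ 2 * (k : ℝ) ^ (1 - 3 * c / 4) := by
    push_cast
    calc (q : ℝ) * R ≤ (k : ℝ) ^ (1 - c) * (2 * (k : ℝ) ^ (c / 4)) := by gcongr
      _ = 2 * ((k : ℝ) ^ (1 - c) * (k : ℝ) ^ (c / 4)) := by ring
      _ = _ := by rw [hpowadd]; ring_nf
  have hqR2 : ((q * R : ℕ) : ℝ) ≤ 2 * k := by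
    refine hqR.trans ?_
    gcongr
    calc (k : ℝ) ^ (1 - 3 * c / 4) ≤ (k : ℝ) ^ (1 : ℝ) :=
          Real.rpow_le_rpow_of_exponent_le hk1 (by linarith)
      _ = k := Real.rpow_one _
  have hlog : Real.log (110 + 6 * (q * R : ℕ)) ≤ 122 ^ (c / 4) / (c / 4) * (k : ℝ) ^ (c / 4) := by
    have h1 : Real.log (110 + 6 * (q * R : ℕ)) ≤ Real.log (122 * k) :=
      Real.log_le_log (by positivity) (by linarith)
    refine h1.trans ((Real.log_le_rpow_div (by positivity) (show 0 < c / 4 by positivity)).trans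
      (le_of_eq ?_))
    rw [Real.mul_rpow (by norm_num) hkpos.le]
    ring
  have hone : (1 : ℝ) ≤ (k : ℝ) ^ (1 - c / 2) := Real.one_le_rpow hk1 (by linarith)
  have hterm : ((q * R : ℕ) * Real.log (110 + 6 * (q * R : ℕ)) + 1) * R
      ≤ (4 * (122 ^ (c / 4) / (c / 4)) + 2) * (k : ℝ) ^ (1 - c / 4) := by
    have h1 : ((q * R : ℕ) : ℝ) * Real.log (110 + 6 * (q * R : ℕ))
        ≤ 2 * (122 ^ (c / 4) / (c / 4)) * (k : ℝ) ^ (1 - c / 2) := by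
      calc _ ≤ 2 * (k : ℝ) ^ (1 - 3 * c / 4) *
            (122 ^ (c / 4) / (c / 4) * (k : ℝ) ^ (c / 4)) := by
            refine mul_le_mul hqR hlog (Real.log_nonneg ?_) (by positivity)
            have : (0 : ℝ) ≤ (q * R : ℕ) := by positivity
            linarith
        _ = 2 * (122 ^ (c / 4) / (c / 4)) *
            ((k : ℝ) ^ (1 - 3 * c / 4) * (k : ℝ) ^ (c / 4)) := by ring
        _ = _ := by rw [hpowadd]; ring_nf
    calc _ ≤ ((2 * (122 ^ (c / 4) / (c / 4)) + 1) * (k : ℝ) ^ (1 - c / 2)) *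
          (2 * (k : ℝ) ^ (c / 4)) := by
          refine mul_le_mul (by linarith) hRc (by positivity) (by positivity)
      _ = (4 * (122 ^ (c / 4) / (c / 4)) + 2) *
          ((k : ℝ) ^ (1 - c / 2) * (k : ℝ) ^ (c / 4)) := by ring
      _ = _ := by rw [hpowadd]; ring_nf
  have hfirst : ((q * R : ℕ) * Real.log (110 + 6 * (q * R : ℕ)) + 1)
      / (1 / (C * R)) / k ≤ E * (k : ℝ) ^ (-(c / 4)) := by
    rw [div_le_iff₀ hkpos, div_div_eq_mul_div, div_one]
    have e : (k : ℝ) ^ (-(c / 4)) * k = (k : ℝ) ^ (1 - c / 4) := by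
      nth_rewrite 2 [← Real.rpow_one (k : ℝ)]
      rw [hpowadd]
      ring_nf
    rw [mul_assoc E, e, hE]
    have := mul_le_mul_of_nonneg_left hterm hCpos.le
    linarith
  have hsecond : (q : ℝ) * (1 - 1 / 1024) ^ R ≤ k * Real.exp (-(y / 1024)) := by
    refine mul_le_mul hqk ?_ (by positivity) hkpos.le
    have h1 : (1 - 1 / 1024 : ℝ) ≤ Real.exp (-(1 / 1024)) := by
      have := Real.add_one_le_exp (-(1 / 1024) : ℝ)
      linarith
    calc (1 - 1 / 1024 : ℝ) ^ R ≤ Real.exp (-(1 / 1024)) ^ R :=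
          pow_le_pow_left₀ (by norm_num) h1 R
      _ = Real.exp (-(R / 1024)) := by rw [← Real.exp_nat_mul]; ring_nf
      _ ≤ _ := Real.exp_le_exp.2 (by linarith)
  linarith

end Asymptotics

end RelativeError

theorem theorem3 (α : ℝ) (hα₀ : 0 < α) (hα₁ : α < 1) :
    ∃ κ : ℝ, 1 ≤ κ ∧ ∀ c : ℝ, 0 < c →
      ∃ ε : ℝ, 0 < ε ∧ ∃ (a : ℝ) (k N₀ : ℕ), 0 < a ∧
        ∀ n N : ℕ, N₀ ≤ N → (N : ℝ) ≤ (2 : ℝ) ^ (α * (n : ℝ)) →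
          ∀ P : Set (BoolFn n), (P = monotoneClass n ∨ P = unateClass n) →
            ∀ A : RandAlg n, IsTester (Sparsity κ N) P ε A →
              ∀ q : ℕ, MakesAtMost (Sparsity κ N) A q →
                a * Real.log N ^ (1 - c) / Real.log (Real.log N) ^ k ≤ (q : ℝ) := by
  -- The density 1024 times the factor 2 lost by rounding `N` to a power of 2 times the size of the
  -- main part.
  refine ⟨2048, by norm_num, fun c hc => ⟨1 / 2048, by norm_num, ?_⟩⟩
  -- A smaller `c` gives a stronger bound once `log N ≥ 1`, so values above `1 / 2` reduce to `1 /
  -- 2`.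
  obtain ⟨l, k0, hl, hkey⟩ := exists_scale_of_few_queries (min c (1 / 2)) (by positivity) (min_le_right _ _)
  set c' := min c (1 / 2) with hc'
  set β := 1 - α with hβ
  have hβ0 : 0 < β := by linarith
  -- No power of `log (log N)` is needed, as logarithms are absorbed in the loss `c`. The threshold
  -- for `N` ensures `k0 + 2 ≤ k`.
  refine ⟨β / 32, 0, ⌈Real.exp (32 * (k0 + 2) / β)⌉₊, by positivity, ?_⟩
  intro n N hN hNn P hP A hA q hq
  rw [pow_zero, div_one]
  by_contra hlt
  push Not at hlt
  have hNexp : Real.exp (32 * (k0 + 2) / β) ≤ N := (Nat.le_ceil _).trans (by exact_mod_cast hN)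
  have hNpos : (0 : ℝ) < N := (Real.exp_pos _).trans_le hNexp
  have hlogN : 32 * (k0 + 2) / β ≤ Real.log N := by
    rw [Real.le_log_iff_exp_le hNpos]
    exact hNexp
  have hβlog : 32 * (k0 + 2 : ℝ) ≤ β * Real.log N := by
    rw [div_le_iff₀ hβ0] at hlogN
    linarith
  have hk0r : (0 : ℝ) ≤ k0 := by positivity
  have hlog1 : 1 ≤ Real.log N := by
    have : β * Real.log N ≤ Real.log N :=
      mul_le_of_le_one_left (le_trans (by positivity) hlogN) (by linarith)
    linarith
  set lam := Real.logb 2 N with hlam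
  have hlamge : Real.log N ≤ lam := by
    rw [hlam, Real.logb, le_div_iff₀ (Real.log_pos (by norm_num))]
    have : Real.log 2 ≤ 1 := by have := Real.log_two_lt_d9; linarith
    nlinarith
  have hlamn : lam ≤ α * n := by
    rw [hlam, Real.logb_le_iff_le_rpow (by norm_num) hNpos]
    exact hNn
  have hpow2 : (2 : ℝ) ^ lam = N := Real.rpow_logb (by norm_num) (by norm_num) hNpos
  have hβlam : β * Real.log N ≤ β * lam := by gcongr
  -- The main and selector coordinates use at most `(1 - α) * log₂ N` dimensions. The free ones use
  -- at most `log₂ N ≤ α * n`, so all fit into `n`.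
  set k := ⌊(β * lam - 1) / 16⌋₊ with hk
  have hkle : (16 * k + 1 : ℝ) ≤ β * lam := by
    have := Nat.floor_le (show 0 ≤ (β * lam - 1) / 16 by linarith)
    linarith
  have hkge : β / 32 * Real.log N ≤ k := by
    have := Nat.lt_floor_add_one ((β * lam - 1) / 16)
    linarith
  have hkk0 : (k0 + 2 : ℝ) ≤ k := by linarith
  have hkk0n : k0 + 2 ≤ k := by exact_mod_cast hkk0
  have hβlam1 : β * lam ≤ lam := mul_le_of_le_one_left (by linarith) (by linarith)
  set K := 2 * Finset.card (upper (16 * k) (15 * k)) with hK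
  have hKpos : 0 < K := by
    rw [hK, card_upper_succ]
    have := Nat.choose_pos (show 15 * k ≤ 16 * k by omega)
    positivity
  have hKN : K ≤ N := by
    have h1 : K ≤ 2 ^ (16 * k + 1) := by
      have := Finset.card_le_univ (upper (16 * k) (15 * k))
      rw [Fintype.card_finset, Fintype.card_fin] at this
      rw [hK, pow_succ]
      omega
    have h2 : ((2 ^ (16 * k + 1) : ℕ) : ℝ) ≤ N := by
      rw [← hpow2]
      push_cast
      rw [← Real.rpow_natCast]
      refine Real.rpow_le_rpow_of_exponent_le (by norm_num) ?_
      push_cast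
      linarith
    exact h1.trans (by exact_mod_cast h2)
  -- The largest number of free coordinates for which `2 ^ φ * K`, the size of the common superset,
  -- does not exceed `N`.
  set φ := Nat.log 2 (N / K) with hφ
  have hM : N / K ≠ 0 := (Nat.div_pos hKN hKpos).ne'
  have hφ1 : 2 ^ φ ≤ N / K := Nat.pow_log_le_self 2 hM
  have hφ2 : N / K < 2 ^ (φ + 1) := Nat.lt_pow_succ_log_self (by norm_num) _
  have hφn : (φ : ℝ) ≤ α * n := by
    refine le_trans ?_ hlamn
    rw [hlam, Real.le_logb_iff_rpow_le (by norm_num) hNpos, Real.rpow_natCast]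
    exact_mod_cast hφ1.trans (Nat.div_le_self _ _)
  have hn : 16 * k + 1 + φ ≤ n := by
    have h1 : β * lam ≤ β * n := by
      gcongr
      exact hlamn.trans (mul_le_of_le_one_left (by positivity) hα₁.le)
    have : (16 * k + 1 + φ : ℝ) ≤ n := by
      have : β * (n : ℝ) = n - α * n := by rw [hβ]; ring
      linarith
    exact_mod_cast this
  have hq' : (q : ℝ) ≤ (k : ℝ) ^ (1 - c') := by
    have hc1 : c' ≤ 1 / 2 := min_le_right _ _
    have hc0 : 0 < c' := by positivity
    calc (q : ℝ) ≤ β / 32 * Real.log N ^ (1 - c) := hlt.le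
      _ ≤ (β / 32) ^ (1 - c') * Real.log N ^ (1 - c') := by
          gcongr
          · exact Real.self_le_rpow_of_le_one (by positivity) (by linarith) (by linarith)
          · exact min_le_left _ _
      _ = (β / 32 * Real.log N) ^ (1 - c') :=
          (Real.mul_rpow (by positivity) (by linarith)).symm
      _ ≤ _ := Real.rpow_le_rpow (by positivity) hkge (by linarith)
  obtain ⟨R, hR, hkR, hsmall⟩ := hkey k (by omega) q hq'
  have hN1 : Finset.card (hardSupport n (16 * k) φ (15 * k)) ≤ N := by
    rw [card_hardSupport hn]
    exact (Nat.mul_le_mul_right _ hφ1).trans (Nat.div_mul_le_self _ _)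
  have hN2 : N ≤ 2 * Finset.card (hardSupport n (16 * k) φ (15 * k)) := by
    rw [card_hardSupport hn, ← hK]
    have h1 := Nat.lt_div_mul_add hKpos (a := N)
    have h2 : (N / K + 1) * K ≤ 2 ^ (φ + 1) * K := Nat.mul_le_mul_right _ hφ2
    rw [pow_succ] at h2
    calc N ≤ (N / K + 1) * K := by rw [add_mul, one_mul]; exact h1.le
      _ ≤ _ := h2
      _ = _ := by ring
  exact not_isTester_of_levels hl hR hkR (by omega) hn hN1 hN2 hR hsmall hP hA hq
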